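/- Let $d\in\{1,2\}$, $\mathbb T^d=\mathbb R^d/\mathbb Z^d$, let $H:\mathbb T^d\to(0,\infty)$ be smooth, and put $\Omega=\{(X,Y)\in\mathbb T^d\times\mathbb R:\ Y>-H(X)\}$, $\Gamma=\{Y=-H(X)\}$. For a function $S$ near $\Gamma$ let $\partial_N S=-\nabla H\cdot\nabla_X S-\partial_Y S$ be the derivative along the outward (non-unit) normal $-(\nabla H,1)$. For $j\in\mathbb Z^d$ let $\|j\|$ be its Euclidean norm and $\widehat F_j(Y)=\int_{\mathbb T^d}F(X,Y)e^{-2\pi i j\cdot X}\,dX$. For every real polynomial $Q$ and every $M\ge 0$ there is a real polynomial $Q'$, depending only on $d$, $H$, $Q$ and $M$, such that the following holds. Let $G\in L^2(\Omega)$ and $N\in L^2(\mathbb T^d)$ be real-valued with $\|G\|_{L^2(\Omega)}\le M$ and $\|N\|_{L^2(\mathbb T^d)}\le M$, satisfying the compatibility condition $$\int_\Omega G\,dX\,dY+\int_{\mathbb T^d}N\,dX=0,$$ and suppose that $|\widehat G_0(Y)|\le Q(Y)e^{-Y}$ and $|\widehat G_j(Y)|\le Q(Y)e^{-\|j\|Y}$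 for all $j\in\mathbb Z^d\setminus\{0\}$ and almost every $Y>0$. Then the Neumann problem $$-\Delta\Sigma=G\ \text{ in }\Omega,\qquad \partial_N\Sigma=N\ \text{ on }\Gamma$$ has a unique weak solution $\Sigma\in L^2(\Omega)$ (up to equality almost everywhere). Here a weak solution is a function $\Sigma\in L^2(\Omega)$ whose weak gradient is square integrable on $\Omega\cap\{Y<R\}$ for every $R$ and which satisfies $$\int_\Omega\nabla\Sigma\cdot\nabla\varphi\,dX\,dY=\int_\Omega G\varphi\,dX\,dY+\int_{\mathbb T^d}N(X)\,\varphi(X,-H(X))\,dX$$ for every smooth compactly supported $\varphi:\mathbb T^d\times\mathbb R\to\mathbb R$. Moreover $\Sigma$ has a representative that is continuous on $\{Y>0\}$ and satisfies, for all $Y>0$, $$|\widehat\Sigma_0(Y)|\le Q'(Y)e^{-Y},\qquad |\widehat\Sigma_j(Y)|\le Q'(Y)e^{-\|j\|Y}\quad(j\in\mathbb Z^d\setminus\{0\}),$$ and $|\Sigma(X,Y)|\le Q'(Y)e^{-Y}$ for all $X\in\mathbb T^d$, $Y>0$. -/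

import Mathlib

open MeasureTheory
open scoped ContDiff

noncomputable section

/-- The point of the torus `(ℝ/ℤ)^d` with coordinates `x`. -/
def toTorus {d : ℕ} (x : Fin d → ℝ) : UnitAddTorus (Fin d) := fun i => (x i : UnitAddCircle)

/-- Smooth functions on the torus: the periodic lift to `ℝ^d` is smooth. -/
def SmoothOnTorus {d : ℕ} (H : UnitAddTorus (Fin d) → ℝ) : Prop :=
  ContDiff ℝ ∞ fun x : Fin d → ℝ => H (toTorus x)

/-- The boundary layer domain `{(X, Y) ∈ 𝕋^d × ℝ : -H(X) < Y}`. -/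
def layerDomain {d : ℕ} (H : UnitAddTorus (Fin d) → ℝ) : Set (UnitAddTorus (Fin d) × ℝ) :=
  {p | -H p.1 < p.2}

/-- Lebesgue measure on the boundary layer domain. -/
def layerMeasure {d : ℕ} (H : UnitAddTorus (Fin d) → ℝ) : Measure (UnitAddTorus (Fin d) × ℝ) :=
  volume.restrict (layerDomain H)

/-- The partial derivative `∂φ/∂X_l` of a function on `𝕋^d × ℝ`. -/
def partialX {d : ℕ} (l : Fin d) (φ : UnitAddTorus (Fin d) × ℝ → ℝ)
    (p : UnitAddTorus (Fin d) × ℝ) : ℝ :=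
  deriv (fun t : ℝ => φ (p.1 + Pi.single l (t : UnitAddCircle), p.2)) 0

/-- The partial derivative `∂φ/∂Y` of a function on `𝕋^d × ℝ`. -/
def partialY {d : ℕ} (φ : UnitAddTorus (Fin d) × ℝ → ℝ) (p : UnitAddTorus (Fin d) × ℝ) : ℝ :=
  deriv (fun t : ℝ => φ (p.1, t)) p.2

/-- Test functions: smooth, compactly supported functions on `𝕋^d × ℝ`. -/
structure IsTest {d : ℕ} (φ : UnitAddTorus (Fin d) × ℝ → ℝ) : Prop where
  smooth : ContDiff ℝ ∞ fun q : (Fin d → ℝ) × ℝ => φ (toTorus q.1, q.2)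
  compact : HasCompactSupport φ

/-- `(SX, SY)` is the weak gradient of `S` on the boundary layer domain
(tested against smooth functions with compact support in the open domain). -/
structure IsWeakGradient {d : ℕ} (H : UnitAddTorus (Fin d) → ℝ)
    (S : UnitAddTorus (Fin d) × ℝ → ℝ) (SX : Fin d → UnitAddTorus (Fin d) × ℝ → ℝ)
    (SY : UnitAddTorus (Fin d) × ℝ → ℝ) : Prop where
  weakX : ∀ (l : Fin d) (φ : UnitAddTorus (Fin d) × ℝ → ℝ), IsTest φ →
    tsupport φ ⊆ layerDomain H →
    ∫ p, S p * partialX l φ p ∂layerMeasure H = -∫ p, SX l p * φ p ∂layerMeasure H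
  weakY : ∀ φ : UnitAddTorus (Fin d) × ℝ → ℝ, IsTest φ →
    tsupport φ ⊆ layerDomain H →
    ∫ p, S p * partialY φ p ∂layerMeasure H = -∫ p, SY p * φ p ∂layerMeasure H

/-- `S ∈ L²(Ω)` is a weak (variational) solution of `-ΔS = G` in `Ω = {Y > -H(X)}` with
`∂_N S = N` on `Γ = {Y = -H(X)}`, where `∂_N S = -∇H·∇_X S - ∂_Y S` is the derivative along the
outward, non-normalized normal vector `-(∇H, 1)`; the surface element of `Γ` times the unit normal
is this vector times `dX`, so that the boundary term is an integral over the torus against `dX`.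
The weak gradient is square integrable on each bounded part of `Ω`, and the test functions are
smooth with compact support in the closure of `Ω`. -/
def IsWeakNeumannSolution {d : ℕ} (H : UnitAddTorus (Fin d) → ℝ)
    (G : UnitAddTorus (Fin d) × ℝ → ℝ) (N : UnitAddTorus (Fin d) → ℝ)
    (S : UnitAddTorus (Fin d) × ℝ → ℝ) : Prop :=
  MemLp S 2 (layerMeasure H) ∧
  ∃ (SX : Fin d → UnitAddTorus (Fin d) × ℝ → ℝ) (SY : UnitAddTorus (Fin d) × ℝ → ℝ),
    (∀ R : ℝ, (∀ l, MemLp (SX l) 2 ((layerMeasure H).restrict {p | p.2 < R})) ∧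
      MemLp SY 2 ((layerMeasure H).restrict {p | p.2 < R})) ∧
    IsWeakGradient H S SX SY ∧
    ∀ φ : UnitAddTorus (Fin d) × ℝ → ℝ, IsTest φ →
      ∫ p, ((∑ l, SX l p * partialX l φ p) + SY p * partialY φ p) ∂layerMeasure H
        = (∫ p, G p * φ p ∂layerMeasure H) + ∫ X, N X * φ (X, -H X)

/-- The Fourier coefficient `∫_{𝕋^d} F(X, Y) e^{-2πi j·X} dX`. -/
def layerCoeff {d : ℕ} (F : UnitAddTorus (Fin d) × ℝ → ℝ) (j : Fin d → ℤ) (Y : ℝ) : ℂ :=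
  UnitAddTorus.mFourierCoeff (fun X => (F (X, Y) : ℂ)) j

/-- The Euclidean norm of a frequency. -/
def freqNorm {d : ℕ} (j : Fin d → ℤ) : ℝ := Real.sqrt (∑ l, (j l : ℝ) ^ 2)

end

noncomputable section

/-! Existence. On the unbounded layer the Dirichlet form does not control the L² norm, because
functions of Y alone obey no Poincaré inequality. The horizontal mean is therefore split off. From a
test function one subtracts its slice means, frozen at their value at Y = 0 below that height. For
the result, `reduced φ`, Wirtinger's inequality on the slices Y > 0 and a vertical trace inequality
below them bound the L² norm and the boundary trace by the gradient (`lintegral_reduced_le`,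
`lintegral_trace_le`). The Riesz theorem in the closure of these functions
(`exists_variational_solution`) gives W, with mean zero on the slices Y > 0. The mean mode solves
-A'' = γ, with γ the slice mean of G; it is integrated explicitly from infinity and kept constant
for Y ≤ 0. Then S = W + A is a weak solution: the only leftover term is a multiple of the
compatibility condition (`exists_weak_solution`).

Decay. For j ≠ 0 the cosine and sine coefficients of S solve s'' = k² s - γ with k = 2π‖j‖ and γ the
matching coefficient of G. Square integrability excludes the growing exponential and leaves an
explicit formula (`exists_mode_representative`). The layer reaches down to Y = -h with h = min H >
0, so values below -h/2 arrive at Y = 0 damped by e^{-kh/2}. Together with terms k⁻³, summable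
because d ≤ 2, and Parseval's identity for G, this yields a summable majorant of the coefficients on
Y ≥ 0, hence an absolutely convergent series and a continuous representative. As k exceeds the rate
of the data, each coefficient inherits that rate with one more power of 1 + Y
(`abs_mode_le_of_decay`). Summing over j gives the pointwise bound.

Uniqueness. Let T be the difference of two solutions. Traces and density up to the boundary are
avoided by correlating T with its translates. Shifts that push the closed layer into the open layer
turn weak derivatives into derivatives of correlations, which are continuous in the shift; letting
the shift tend to zero gives the energy identity (`localized_energy_identity`). A cutoff at height R
and T ∈ L² then force ∂_Y T = 0. Consequently the autocorrelation of T does not change under upward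
shifts, while it tends to zero at infinity, so ‖T‖ = 0 (`ae_eq_zero_of_homogeneous`). -/

/-- The covering map `ℝ^d × ℝ → 𝕋^d × ℝ`. -/
def layerProj {d : ℕ} (q : (Fin d → ℝ) × ℝ) : UnitAddTorus (Fin d) × ℝ := (toTorus q.1, q.2)

/-- Smooth functions on `𝕋^d × ℝ`: the periodic lift is smooth. -/
def SmoothLift {d : ℕ} (φ : UnitAddTorus (Fin d) × ℝ → ℝ) : Prop :=
  ContDiff ℝ ∞ fun q : (Fin d → ℝ) × ℝ => φ (layerProj q)

/-! ### Calculus on 𝕋^d × ℝ through periodic lifts -/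

section Covering

variable {d : ℕ}

/-- The quotient property lets continuity and pointwise identities on the torus be checked on
periodic lifts. -/
lemma isOpenQuotientMap_toTorus : IsOpenQuotientMap (toTorus (d := d)) :=
  IsOpenQuotientMap.piMap (f := fun (_ : Fin d) (x : ℝ) => (x : UnitAddCircle))
    fun _ => QuotientAddGroup.isOpenQuotientMap_mk

lemma isOpenQuotientMap_layerProj : IsOpenQuotientMap (layerProj (d := d)) :=
  isOpenQuotientMap_toTorus.prodMap IsOpenQuotientMap.id

lemma toTorus_add (x y : Fin d → ℝ) : toTorus (x + y) = toTorus x + toTorus y := by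
  ext i; simp [toTorus]

lemma toTorus_sub (x y : Fin d → ℝ) : toTorus (x - y) = toTorus x - toTorus y := by
  ext i; simp [toTorus]

lemma toTorus_single (l : Fin d) (t : ℝ) :
    toTorus (Pi.single l t) = Pi.single l (t : UnitAddCircle) := by
  ext i
  by_cases h : i = l
  · subst h; simp [toTorus]
  · simp [toTorus, h]

lemma layerProj_add (q r : (Fin d → ℝ) × ℝ) : layerProj (q + r) = layerProj q + layerProj r := by
  simp [layerProj, toTorus_add]

lemma layerProj_sub (q r : (Fin d → ℝ) × ℝ) : layerProj (q - r) = layerProj q - layerProj r := by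
  simp [layerProj, toTorus_sub]

lemma continuous_single_coe (l : Fin d) :
    Continuous fun t : ℝ => (Pi.single l (t : UnitAddCircle) : UnitAddTorus (Fin d)) := by
  simp_rw [← toTorus_single]
  refine isOpenQuotientMap_toTorus.continuous.comp (continuous_pi fun i => ?_)
  by_cases h : i = l
  · subst h
    simp only [Pi.single_eq_same]
    exact continuous_id
  · simpa [h] using continuous_const

lemma exists_layerProj (p : UnitAddTorus (Fin d) × ℝ) : ∃ q, layerProj q = p :=
  isOpenQuotientMap_layerProj.surjective p

end Covering

namespace SmoothLift

variable {d : ℕ} {φ ψ : UnitAddTorus (Fin d) × ℝ → ℝ}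

lemma continuous (h : SmoothLift φ) : Continuous φ :=
  isOpenQuotientMap_layerProj.continuous_comp_iff.1 (ContDiff.continuous h)

lemma const (c : ℝ) : SmoothLift (fun _ : UnitAddTorus (Fin d) × ℝ => c) := contDiff_const

lemma add (h : SmoothLift φ) (h' : SmoothLift ψ) : SmoothLift (φ + ψ) := ContDiff.add h h'
lemma sub (h : SmoothLift φ) (h' : SmoothLift ψ) : SmoothLift (φ - ψ) := ContDiff.sub h h'
lemma mul (h : SmoothLift φ) (h' : SmoothLift ψ) : SmoothLift (φ * ψ) := ContDiff.mul h h'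

lemma const_smul (c : ℝ) (h : SmoothLift φ) : SmoothLift (c • φ) := contDiff_const.mul h

lemma of_snd {f : ℝ → ℝ} (hf : ContDiff ℝ ∞ f) :
    SmoothLift (fun p : UnitAddTorus (Fin d) × ℝ => f p.2) := hf.comp contDiff_snd

lemma comp_add (h : SmoothLift φ) (a : UnitAddTorus (Fin d) × ℝ) :
    SmoothLift (fun p => φ (p + a)) := by
  obtain ⟨b, rfl⟩ := exists_layerProj a
  have : (fun q : (Fin d → ℝ) × ℝ => φ (layerProj q + layerProj b))
      = (fun q => φ (layerProj q)) ∘ fun q => q + b := by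
    ext q; simp [layerProj_add]
  unfold SmoothLift
  rw [this]
  exact ContDiff.comp h (contDiff_id.add contDiff_const)

lemma comp_const_sub (h : SmoothLift φ) (a : UnitAddTorus (Fin d) × ℝ) :
    SmoothLift (fun p => φ (a - p)) := by
  obtain ⟨b, rfl⟩ := exists_layerProj a
  have : (fun q : (Fin d → ℝ) × ℝ => φ (layerProj b - layerProj q))
      = (fun q => φ (layerProj q)) ∘ fun q => b - q := by
    ext q; simp [layerProj_sub]
  unfold SmoothLift
  rw [this]
  exact ContDiff.comp h (contDiff_const.sub contDiff_id)

lemma differentiable (h : SmoothLift φ) :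
    Differentiable ℝ fun q : (Fin d → ℝ) × ℝ => φ (layerProj q) :=
  ContDiff.differentiable h (by simp)

/-- Translation by `Pi.single l t` lifts to a straight line in ℝ^d, so the chain rule applies.
Smoothness of the partial derivatives is then read off from `fderiv` of the lift. -/
lemma partialX_layerProj (h : SmoothLift φ) (l : Fin d) (q : (Fin d → ℝ) × ℝ) :
    partialX l φ (layerProj q)
      = fderiv ℝ (fun q : (Fin d → ℝ) × ℝ => φ (layerProj q)) q (Pi.single l 1, 0) := by
  have h1 : HasDerivAt (fun t : ℝ => q + t • ((Pi.single l 1, 0) : (Fin d → ℝ) × ℝ))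
      (Pi.single l 1, 0) 0 := by
    simpa using ((hasDerivAt_id (0 : ℝ)).smul_const
      ((Pi.single l 1, 0) : (Fin d → ℝ) × ℝ)).const_add q
  have h2 : HasFDerivAt (fun q : (Fin d → ℝ) × ℝ => φ (layerProj q))
      (fderiv ℝ (fun q : (Fin d → ℝ) × ℝ => φ (layerProj q)) q)
      (q + (0 : ℝ) • ((Pi.single l 1, 0) : (Fin d → ℝ) × ℝ)) := by
    simpa using (h.differentiable q).hasFDerivAt
  have h3 := h2.comp_hasDerivAt (0 : ℝ) h1
  rw [partialX, ← h3.deriv]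
  congr 1
  ext t
  simp only [Function.comp, layerProj, Prod.fst_add, Prod.smul_fst, toTorus_add, Prod.snd_add,
    Prod.smul_snd, smul_zero, add_zero]
  rw [← Pi.single_smul, smul_eq_mul, mul_one, toTorus_single]

lemma partialY_layerProj (h : SmoothLift φ) (q : (Fin d → ℝ) × ℝ) :
    partialY φ (layerProj q)
      = fderiv ℝ (fun q : (Fin d → ℝ) × ℝ => φ (layerProj q)) q (0, 1) := by
  have h1 : HasDerivAt (fun t : ℝ => ((q.1, t) : (Fin d → ℝ) × ℝ)) (0, 1) q.2 :=
    (hasDerivAt_const _ _).prodMk (hasDerivAt_id _)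
  have h3 := (h.differentiable q).hasFDerivAt.comp_hasDerivAt (f := fun t : ℝ => (q.1, t)) q.2 h1
  rw [partialY, ← h3.deriv]
  rfl

lemma partialX (h : SmoothLift φ) (l : Fin d) : SmoothLift (partialX l φ) := by
  unfold SmoothLift
  simp_rw [h.partialX_layerProj l]
  exact (ContDiff.fderiv_right h (by simp)).clm_apply contDiff_const

lemma partialY (h : SmoothLift φ) : SmoothLift (partialY φ) := by
  unfold SmoothLift
  simp_rw [h.partialY_layerProj]
  exact (ContDiff.fderiv_right h (by simp)).clm_apply contDiff_const

lemma hasDerivAt_fst (h : SmoothLift φ) (l : Fin d) (p : UnitAddTorus (Fin d) × ℝ) (s : ℝ) :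
    HasDerivAt (fun t : ℝ => φ (p.1 + Pi.single l (t : UnitAddCircle), p.2))
      (_root_.partialX l φ (p.1 + Pi.single l (s : UnitAddCircle), p.2)) s := by
  obtain ⟨q, rfl⟩ := exists_layerProj p
  have e : ∀ t : ℝ, ((layerProj q).1 + Pi.single l (t : UnitAddCircle), (layerProj q).2)
      = layerProj (q + t • ((Pi.single l 1, 0) : (Fin d → ℝ) × ℝ)) := by
    intro t
    simp only [layerProj, Prod.fst_add, Prod.smul_fst, toTorus_add, Prod.snd_add,
      Prod.smul_snd, smul_zero, add_zero]
    rw [← Pi.single_smul, smul_eq_mul, mul_one, toTorus_single]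
  simp_rw [e]
  rw [h.partialX_layerProj]
  have h1 : HasDerivAt (fun t : ℝ => q + t • ((Pi.single l 1, 0) : (Fin d → ℝ) × ℝ))
      (Pi.single l 1, 0) s := by
    simpa using ((hasDerivAt_id s).smul_const
      ((Pi.single l 1, 0) : (Fin d → ℝ) × ℝ)).const_add q
  exact (h.differentiable _).hasFDerivAt.comp_hasDerivAt s h1

lemma hasDerivAt_snd (h : SmoothLift φ) (X : UnitAddTorus (Fin d)) (s : ℝ) :
    HasDerivAt (fun t : ℝ => φ (X, t)) (_root_.partialY φ (X, s)) s := by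
  obtain ⟨q, hq⟩ := exists_layerProj (X, s)
  have h1 : HasDerivAt (fun t : ℝ => ((q.1, t) : (Fin d → ℝ) × ℝ)) (0, 1) q.2 :=
    (hasDerivAt_const _ _).prodMk (hasDerivAt_id _)
  have h3 := (h.differentiable q).hasFDerivAt.comp_hasDerivAt (f := fun t : ℝ => (q.1, t)) q.2 h1
  rw [← hq, h.partialY_layerProj]
  have : q.2 = s := congrArg Prod.snd hq
  have h4 : toTorus q.1 = X := congrArg Prod.fst hq
  rw [this] at h3
  simpa [Function.comp_def, layerProj, h4] using h3

lemma hasDerivAt_fst_zero (h : SmoothLift φ) (l : Fin d) (p : UnitAddTorus (Fin d) × ℝ) :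
    HasDerivAt (fun t : ℝ => φ (p.1 + Pi.single l (t : UnitAddCircle), p.2))
      (_root_.partialX l φ p) 0 := by
  simpa using h.hasDerivAt_fst l p 0

lemma partialX_mul (h : SmoothLift φ) (h' : SmoothLift ψ) (l : Fin d)
    (p : UnitAddTorus (Fin d) × ℝ) :
    _root_.partialX l (φ * ψ) p
      = _root_.partialX l φ p * ψ p + φ p * _root_.partialX l ψ p := by
  have := ((h.hasDerivAt_fst_zero l p).mul (h'.hasDerivAt_fst_zero l p)).deriv
  simpa [_root_.partialX, Pi.mul_def] using this

lemma partialX_add (h : SmoothLift φ) (h' : SmoothLift ψ) (l : Fin d) :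
    _root_.partialX l (φ + ψ) = _root_.partialX l φ + _root_.partialX l ψ := by
  ext p
  exact ((h.hasDerivAt_fst_zero l p).add (h'.hasDerivAt_fst_zero l p)).deriv

lemma partialX_const_smul (h : SmoothLift φ) (c : ℝ) (l : Fin d) :
    _root_.partialX l (c • φ) = c • _root_.partialX l φ := by
  ext p
  exact ((h.hasDerivAt_fst_zero l p).const_mul c).deriv

lemma partialY_mul (h : SmoothLift φ) (h' : SmoothLift ψ) (p : UnitAddTorus (Fin d) × ℝ) :
    _root_.partialY (φ * ψ) p = _root_.partialY φ p * ψ p + φ p * _root_.partialY ψ p :=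
  ((h.hasDerivAt_snd p.1 p.2).mul (h'.hasDerivAt_snd p.1 p.2)).deriv

lemma partialY_add (h : SmoothLift φ) (h' : SmoothLift ψ) :
    _root_.partialY (φ + ψ) = _root_.partialY φ + _root_.partialY ψ := by
  ext p
  exact ((h.hasDerivAt_snd p.1 p.2).add (h'.hasDerivAt_snd p.1 p.2)).deriv

lemma partialY_const_smul (h : SmoothLift φ) (c : ℝ) :
    _root_.partialY (c • φ) = c • _root_.partialY φ := by
  ext p
  exact ((h.hasDerivAt_snd p.1 p.2).const_mul c).deriv

end SmoothLift

lemma partialY_of_snd {d : ℕ} (f : ℝ → ℝ) (p : UnitAddTorus (Fin d) × ℝ) :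
    partialY (fun p => f p.2) p = deriv f p.2 := rfl

/-! ### Test functions -/

namespace IsTest

variable {d : ℕ} {φ ψ : UnitAddTorus (Fin d) × ℝ → ℝ}

lemma lift (h : IsTest φ) : SmoothLift φ := h.smooth

lemma continuous (h : IsTest φ) : Continuous φ := h.lift.continuous

end IsTest

lemma tsupport_partialX_subset {d : ℕ} (l : Fin d) (φ : UnitAddTorus (Fin d) × ℝ → ℝ) :
    tsupport (partialX l φ) ⊆ tsupport φ := by
  refine closure_minimal (fun p hp => ?_) (isClosed_tsupport φ)
  by_contra hn
  apply hp
  have hev := notMem_tsupport_iff_eventuallyEq.1 hn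
  have hc : Filter.Tendsto
      (fun t : ℝ => ((p.1 + Pi.single l (t : UnitAddCircle), p.2) : UnitAddTorus (Fin d) × ℝ))
      (nhds 0) (nhds p) := by
    have : Continuous (fun t : ℝ =>
        ((p.1 + Pi.single l (t : UnitAddCircle), p.2) : UnitAddTorus (Fin d) × ℝ)) := by
      have := continuous_single_coe l
      fun_prop
    simpa using this.tendsto 0
  have h2 := hc.eventually hev
  have : (fun t : ℝ => φ (p.1 + Pi.single l (t : UnitAddCircle), p.2)) =ᶠ[nhds 0]
      fun _ => (0 : ℝ) := h2
  simp [partialX, this.deriv_eq]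

lemma tsupport_partialY_subset {d : ℕ} (φ : UnitAddTorus (Fin d) × ℝ → ℝ) :
    tsupport (partialY φ) ⊆ tsupport φ := by
  refine closure_minimal (fun p hp => ?_) (isClosed_tsupport φ)
  by_contra hn
  apply hp
  have hev := notMem_tsupport_iff_eventuallyEq.1 hn
  have hc : Filter.Tendsto (fun t : ℝ => ((p.1, t) : UnitAddTorus (Fin d) × ℝ))
      (nhds p.2) (nhds p) := by
    have : Continuous (fun t : ℝ => ((p.1, t) : UnitAddTorus (Fin d) × ℝ)) := by fun_prop
    simpa using this.tendsto p.2
  have h2 := hc.eventually hev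
  have : (fun t : ℝ => φ (p.1, t)) =ᶠ[nhds p.2] fun _ => (0 : ℝ) := h2
  simp [partialY, this.deriv_eq]

namespace IsTest

variable {d : ℕ} {φ ψ : UnitAddTorus (Fin d) × ℝ → ℝ}

lemma partialX (h : IsTest φ) (l : Fin d) : IsTest (partialX l φ) :=
  ⟨h.lift.partialX l, h.compact.of_isClosed_subset (isClosed_tsupport _)
    (tsupport_partialX_subset l φ)⟩

lemma partialY (h : IsTest φ) : IsTest (partialY φ) :=
  ⟨h.lift.partialY, h.compact.of_isClosed_subset (isClosed_tsupport _)
    (tsupport_partialY_subset φ)⟩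

lemma add (h : IsTest φ) (h' : IsTest ψ) : IsTest (φ + ψ) :=
  ⟨h.lift.add h'.lift, h.compact.add h'.compact⟩

lemma const_smul (c : ℝ) (h : IsTest φ) : IsTest (c • φ) :=
  ⟨h.lift.const_smul c, h.compact.mul_left (f := fun _ => c)⟩

lemma mul_left (h : IsTest φ) (h' : SmoothLift ψ) : IsTest (ψ * φ) :=
  ⟨h'.mul h.lift, h.compact.mul_left⟩

lemma comp_add (h : IsTest φ) (a : UnitAddTorus (Fin d) × ℝ) : IsTest (fun p => φ (p + a)) :=
  ⟨h.lift.comp_add a, h.compact.comp_homeomorph (Homeomorph.addRight a)⟩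

lemma comp_const_sub (h : IsTest φ) (a : UnitAddTorus (Fin d) × ℝ) :
    IsTest (fun p => φ (a - p)) :=
  ⟨h.lift.comp_const_sub a, h.compact.comp_homeomorph (Homeomorph.subLeft a)⟩

lemma zero : IsTest (0 : UnitAddTorus (Fin d) × ℝ → ℝ) :=
  ⟨contDiff_const, HasCompactSupport.zero⟩

lemma exists_bound (h : IsTest φ) : ∃ C, 0 ≤ C ∧ ∀ p, |φ p| ≤ C := by
  obtain ⟨C, hC⟩ := h.compact.exists_bound_of_continuous h.continuous
  exact ⟨C, (norm_nonneg _).trans (hC (0, 0)), hC⟩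

/-- A test function vanishes outside of a strip. -/
lemma exists_strip (h : IsTest φ) : ∃ R, 0 < R ∧ ∀ p, φ p ≠ 0 → |p.2| ≤ R := by
  obtain ⟨R, hR⟩ := (h.compact.isCompact.image continuous_snd).isBounded.exists_norm_le
  refine ⟨max R 1, by positivity, fun p hp => ?_⟩
  exact (hR p.2 ⟨p, subset_tsupport _ hp, rfl⟩).trans (le_max_left _ _)

lemma integrable (h : IsTest φ) : Integrable φ (volume.prod volume) :=
  h.continuous.integrable_of_hasCompactSupport h.compact

end IsTest

/-! ### Measure and integration on the torus -/

section Torus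

variable {d : ℕ}

instance instIsProbabilityMeasureUnitAddCircle :
    IsProbabilityMeasure (volume : Measure UnitAddCircle) :=
  ⟨by simp [AddCircle.measure_univ]⟩

instance instIsProbabilityMeasureUnitAddTorus :
    IsProbabilityMeasure (volume : Measure (UnitAddTorus (Fin d))) :=
  inferInstanceAs (IsProbabilityMeasure (Measure.pi fun _ : Fin d => (volume : Measure UnitAddCircle)))

instance instIsAddHaarMeasureLayer :
    (volume : Measure (UnitAddTorus (Fin d) × ℝ)).IsAddHaarMeasure :=
  Measure.prod.instIsAddHaarMeasure (volume : Measure (UnitAddTorus (Fin d))) (volume : Measure ℝ)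

/-- Along each circle in direction `l` the integral is zero by periodicity. Averaging over the base
point and exchanging the integrals recovers the slice integral, by translation invariance. -/
lemma integral_partialX_slice {φ : UnitAddTorus (Fin d) × ℝ → ℝ} (h : SmoothLift φ) (l : Fin d)
    (Y : ℝ) : ∫ X, partialX l φ (X, Y) = 0 := by
  have hc := (h.partialX l).continuous
  have hs := continuous_single_coe l
  have h0 : ∀ X : UnitAddTorus (Fin d),
      ∫ t in (0 : ℝ)..1, partialX l φ (X + Pi.single l (t : UnitAddCircle), Y) = 0 := by
    intro X
    rw [intervalIntegral.integral_eq_sub_of_hasDerivAt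
      (fun t _ => h.hasDerivAt_fst l (X, Y) t)]
    · simp [AddCircle.coe_period]
    · exact Continuous.intervalIntegrable (by fun_prop) _ _
  have h1 : ∫ X : UnitAddTorus (Fin d),
      ∫ t in (0 : ℝ)..1, partialX l φ (X + Pi.single l (t : UnitAddCircle), Y) = 0 := by
    simp [h0]
  simp_rw [intervalIntegral.integral_of_le zero_le_one] at h1
  rw [integral_integral_swap] at h1
  · simp_rw [integral_add_right_eq_self (μ := (volume : Measure (UnitAddTorus (Fin d))))
      (fun X => partialX l φ (X, Y))] at h1
    simpa using h1
  · have : IsCompact ((Set.univ : Set (UnitAddTorus (Fin d))) ×ˢ Set.Icc (0 : ℝ) 1) :=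
      isCompact_univ.prod isCompact_Icc
    have h2 : Continuous (Function.uncurry fun (X : UnitAddTorus (Fin d)) (t : ℝ) =>
        partialX l φ (X + Pi.single l (t : UnitAddCircle), Y)) := by
      exact hc.comp ((continuous_fst.add (hs.comp continuous_snd)).prodMk continuous_const)
    have h3 := h2.continuousOn.integrableOn_compact (μ := volume.prod volume) this
    rw [IntegrableOn, ← Measure.prod_restrict, Measure.restrict_univ] at h3
    exact h3.mono_measure (Measure.prod_mono le_rfl (Measure.restrict_mono Set.Ioc_subset_Icc_self le_rfl))

end Torus

/-! ### Abstract variational existence -/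

/-- Existence of a variational solution in the completion of a space of test functions, in which
`‖g φ‖` controls the other norms. The pair `(w, F)` lies in the closed span of the `(u φ, g φ)`,
which is expressed by continuous functionals. -/
theorem exists_variational_solution {V E₀ E₁ E₂ : Type*} [AddCommGroup V] [Module ℝ V]
    [NormedAddCommGroup E₀] [InnerProductSpace ℝ E₀] [CompleteSpace E₀]
    [NormedAddCommGroup E₁] [InnerProductSpace ℝ E₁] [CompleteSpace E₁]
    [NormedAddCommGroup E₂] [InnerProductSpace ℝ E₂] [CompleteSpace E₂]
    (u : V →ₗ[ℝ] E₀) (g : V →ₗ[ℝ] E₁) (τ : V →ₗ[ℝ] E₂) {C : ℝ} (hC : 0 ≤ C)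
    (hu : ∀ φ, ‖u φ‖ ≤ C * ‖g φ‖) (hτ : ∀ φ, ‖τ φ‖ ≤ C * ‖g φ‖) (G : E₀) (N : E₂) :
    ∃ (w : E₀) (F : E₁), (∀ φ, inner ℝ F (g φ) = inner ℝ G (u φ) + inner ℝ N (τ φ)) ∧
      ‖F‖ ≤ C * (‖G‖ + ‖N‖) ∧ ‖w‖ ≤ C * ‖F‖ ∧
      ∀ (a : E₀ →L[ℝ] ℝ) (b : E₁ →L[ℝ] ℝ), (∀ φ, a (u φ) + b (g φ) = 0) → a w + b F = 0 := by
  set E : Submodule ℝ E₁ := (LinearMap.range g).topologicalClosure with hE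
  have : CompleteSpace E := (Submodule.isClosed_topologicalClosure _).completeSpace_coe
  let e : V →ₗ[ℝ] E := g.codRestrict E fun φ =>
    Submodule.le_topologicalClosure _ (LinearMap.mem_range_self g φ)
  have hnorm : ∀ φ, ‖e φ‖ = ‖g φ‖ := fun φ => rfl
  have hd : DenseRange e := by
    rw [DenseRange, Subtype.dense_iff]
    intro x hx
    refine closure_mono ?_ hx
    rintro _ ⟨φ, rfl⟩
    exact ⟨e φ, ⟨φ, rfl⟩, rfl⟩
  -- The bounds `hu` and `hτ` make `u` and `τ` continuous for the norm of `g`, so both extend from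
  -- the dense range of `e` to all of `E`.
  let U : E →L[ℝ] E₀ := u.extendOfNorm e
  let T : E →L[ℝ] E₂ := τ.extendOfNorm e
  have hU : ∀ φ, U (e φ) = u φ := LinearMap.extendOfNorm_eq hd ⟨C, hu⟩
  have hT : ∀ φ, T (e φ) = τ φ := LinearMap.extendOfNorm_eq hd ⟨C, hτ⟩
  have hUn : ∀ x, ‖U x‖ ≤ C * ‖x‖ := LinearMap.norm_extendOfNorm_apply_le hd C hu
  have hTn : ∀ x, ‖T x‖ ≤ C * ‖x‖ := LinearMap.norm_extendOfNorm_apply_le hd C hτ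
  let L : E →L[ℝ] ℝ := (innerSL ℝ G).comp U + (innerSL ℝ N).comp T
  -- Riesz representation in `E`. The element `U F` plays the role of the function whose gradient is
  -- `F`.
  let F : E := (InnerProductSpace.toDual ℝ E).symm L
  have hF : ∀ x, inner ℝ F x = inner ℝ G (U x) + inner ℝ N (T x) := fun x =>
    InnerProductSpace.toDual_symm_apply
  refine ⟨U F, F, fun φ => ?_, ?_, hUn F, fun a b hab => ?_⟩
  · rw [← hU, ← hT, ← hF]; rfl
  · change ‖F‖ ≤ _
    rw [show ‖F‖ = ‖L‖ from LinearIsometryEquiv.norm_map _ _]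
    refine L.opNorm_le_bound (by positivity) fun x => ?_
    calc ‖L x‖ ≤ ‖inner ℝ G (U x)‖ + ‖inner ℝ N (T x)‖ := by
          simpa [L] using norm_add_le (inner ℝ G (U x)) (inner ℝ N (T x))
      _ ≤ ‖G‖ * (C * ‖x‖) + ‖N‖ * (C * ‖x‖) := by
          gcongr
          · exact (norm_inner_le_norm _ _).trans (by gcongr; exact hUn x)
          · exact (norm_inner_le_norm _ _).trans (by gcongr; exact hTn x)
      _ = C * (‖G‖ + ‖N‖) * ‖x‖ := by ring
  -- Functionals that annihilate all pairs (u φ, g φ) annihilate the graph of `U`, by density.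
  · have : ∀ x, (a.comp U + b.comp E.subtypeL) x = 0 := by
      have h0 : ⇑(a.comp U + b.comp E.subtypeL) = fun _ => 0 := by
        refine hd.equalizer (a.comp U + b.comp E.subtypeL).continuous continuous_const ?_
        ext φ
        have h1 := hab φ
        rw [← hU] at h1
        exact h1
      exact fun x => congrFun h0 x
    simpa using this F

/-! ### Fourier coefficients and Parseval on the torus -/

section FourierTorus

variable {d : ℕ}

/-- `mFourierCoeff` integrates against normalized Haar measure; on a circle of length one this is
Lebesgue measure. -/
lemma pi_haarAddCircle :
    (Measure.pi fun _ : Fin d => (AddCircle.haarAddCircle : Measure UnitAddCircle)) = volume := by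
  rw [volume_pi]
  congr 1
  ext1 i
  rw [AddCircle.volume_eq_smul_haarAddCircle]
  simp

open UnitAddTorus in
lemma mFourierCoeff_eq_integral_volume (f : UnitAddTorus (Fin d) → ℂ) (j : Fin d → ℤ) :
    mFourierCoeff f j = ∫ X, mFourier (-j) X * f X := by
  have : mFourierCoeff f j
      = ∫ X, mFourier (-j) X * f X ∂(Measure.pi fun _ : Fin d => AddCircle.haarAddCircle) := rfl
  rw [this, pi_haarAddCircle]

open UnitAddTorus in

open UnitAddTorus in
/-- **Parseval's identity** for square integrable functions. -/
lemma hasSum_sq_mFourierCoeff_of_memLp {f : UnitAddTorus (Fin d) → ℂ} (hf : MemLp f 2 volume) :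
    HasSum (fun j => ‖mFourierCoeff f j‖ ^ 2) (∫ X, ‖f X‖ ^ 2) := by
  rw [← pi_haarAddCircle] at hf ⊢
  have h := hasSum_sq_mFourierCoeff hf.toLp
  have hc := hf.coeFn_toLp
  have e : ∀ j, mFourierCoeff hf.toLp j = mFourierCoeff f j := fun j =>
    integral_congr_ae (hc.mono fun X hX => by simp only [hX])
  simp_rw [e] at h
  convert h using 1
  exact integral_congr_ae (hc.mono fun X hX => by simp only [hX])

open UnitAddTorus in
/-- Square integrable functions with the same Fourier coefficients agree almost everywhere. -/
lemma ae_eq_of_mFourierCoeff_eq {f g : UnitAddTorus (Fin d) → ℂ} (hf : MemLp f 2 volume)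
    (hg : MemLp g 2 volume) (h : ∀ j, mFourierCoeff f j = mFourierCoeff g j) :
    f =ᵐ[volume] g := by
  have hs := hasSum_sq_mFourierCoeff_of_memLp (hf.sub hg)
  have h0 : ∀ j, mFourierCoeff (f - g) j = 0 := by
    intro j
    have hb : ∀ {k : UnitAddTorus (Fin d) → ℂ}, MemLp k 2 volume →
        Integrable (fun X => mFourier (-j) X * k X) := fun {k} hk =>
      (hk.integrable (by norm_num)).bdd_mul (c := 1)
        (mFourier (-j)).continuous.aestronglyMeasurable
        (Filter.Eventually.of_forall fun X =>
          ((mFourier (-j)).norm_coe_le_norm X).trans_eq mFourier_norm)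
    rw [mFourierCoeff_eq_integral_volume]
    simp_rw [Pi.sub_apply, mul_sub]
    rw [integral_sub (hb hf) (hb hg), ← mFourierCoeff_eq_integral_volume,
      ← mFourierCoeff_eq_integral_volume, h, sub_self]
  simp only [h0, norm_zero, ne_eq, OfNat.ofNat_ne_zero, not_false_eq_true, zero_pow] at hs
  have h1 := hs.unique hasSum_zero
  rw [integral_eq_zero_iff_of_nonneg (fun X => by positivity)
    ((hf.sub hg).integrable_norm_pow (by norm_num))] at h1
  filter_upwards [h1] with X hX
  simpa [sub_eq_zero] using hX

end FourierTorus

/-! ### Real Fourier modes and Wirtinger's inequality -/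

section Modes

variable {d : ℕ}

open UnitAddTorus

/-- The real part of a Fourier monomial, as a function on `𝕋^d × ℝ`. -/
def cosMode (j : Fin d → ℤ) (p : UnitAddTorus (Fin d) × ℝ) : ℝ := (mFourier j p.1).re

/-- The imaginary part of a Fourier monomial, as a function on `𝕋^d × ℝ`. -/
def sinMode (j : Fin d → ℤ) (p : UnitAddTorus (Fin d) × ℝ) : ℝ := (mFourier j p.1).im

lemma mFourier_toTorus (j : Fin d → ℤ) (x : Fin d → ℝ) :
    mFourier j (toTorus x) = Complex.exp ((2 * Real.pi * ∑ l, (j l : ℝ) * x l : ℝ) * Complex.I) := by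
  have : mFourier j (toTorus x) = ∏ l, fourier (j l) (x l : UnitAddCircle) := rfl
  rw [this]
  simp_rw [fourier_coe_apply]
  rw [← Complex.exp_sum]
  congr 1
  push_cast
  rw [Finset.mul_sum, Finset.sum_mul]
  refine Finset.sum_congr rfl fun l _ => ?_
  simp; ring

lemma cosMode_layerProj (j : Fin d → ℤ) (q : (Fin d → ℝ) × ℝ) :
    cosMode j (layerProj q) = Real.cos (2 * Real.pi * ∑ l, (j l : ℝ) * q.1 l) := by
  rw [cosMode, layerProj, mFourier_toTorus, Complex.exp_ofReal_mul_I_re]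

lemma sinMode_layerProj (j : Fin d → ℤ) (q : (Fin d → ℝ) × ℝ) :
    sinMode j (layerProj q) = Real.sin (2 * Real.pi * ∑ l, (j l : ℝ) * q.1 l) := by
  rw [sinMode, layerProj, mFourier_toTorus, Complex.exp_ofReal_mul_I_im]

lemma contDiff_phase (j : Fin d → ℤ) :
    ContDiff ℝ ∞ fun q : (Fin d → ℝ) × ℝ => 2 * Real.pi * ∑ l, (j l : ℝ) * q.1 l := by
  refine contDiff_const.mul (ContDiff.sum fun l _ => contDiff_const.mul ?_)
  exact (contDiff_apply ℝ ℝ l).comp contDiff_fst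

lemma smoothLift_cosMode (j : Fin d → ℤ) : SmoothLift (cosMode j) := by
  unfold SmoothLift
  simp_rw [cosMode_layerProj]
  exact (contDiff_phase j).cos

lemma smoothLift_sinMode (j : Fin d → ℤ) : SmoothLift (sinMode j) := by
  unfold SmoothLift
  simp_rw [sinMode_layerProj]
  exact (contDiff_phase j).sin

lemma hasDerivAt_phase (j : Fin d → ℤ) (x : Fin d → ℝ) (l : Fin d) :
    HasDerivAt (fun t : ℝ => 2 * Real.pi * ∑ i, (j i : ℝ) * (x + (Pi.single l t : Fin d → ℝ)) i)
      (2 * Real.pi * j l) 0 := by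
  refine HasDerivAt.const_mul _ ?_
  have : ∀ t : ℝ, ∑ i, (j i : ℝ) * (x + (Pi.single l t : Fin d → ℝ)) i
      = ∑ i, (j i : ℝ) * x i + j l * t := by
    intro t
    simp [mul_add, Finset.sum_add_distrib, Pi.single_apply]
  simp_rw [this]
  simpa using ((hasDerivAt_id (0 : ℝ)).const_mul (j l : ℝ)).const_add (∑ i, (j i : ℝ) * x i)

lemma partialX_cosMode (j : Fin d → ℤ) (l : Fin d) (p : UnitAddTorus (Fin d) × ℝ) :
    partialX l (cosMode j) p = -(2 * Real.pi * j l) * sinMode j p := by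
  obtain ⟨q, rfl⟩ := exists_layerProj p
  have e : ∀ t : ℝ, ((layerProj q).1 + Pi.single l (t : UnitAddCircle), (layerProj q).2)
      = layerProj (q.1 + Pi.single l t, q.2) := fun t => by
    simp [layerProj, toTorus_add, toTorus_single]
  unfold partialX
  simp_rw [e, cosMode_layerProj, sinMode_layerProj]
  rw [(hasDerivAt_phase j q.1 l).cos.deriv]
  simp; ring

lemma partialX_sinMode (j : Fin d → ℤ) (l : Fin d) (p : UnitAddTorus (Fin d) × ℝ) :
    partialX l (sinMode j) p = (2 * Real.pi * j l) * cosMode j p := by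
  obtain ⟨q, rfl⟩ := exists_layerProj p
  have e : ∀ t : ℝ, ((layerProj q).1 + Pi.single l (t : UnitAddCircle), (layerProj q).2)
      = layerProj (q.1 + Pi.single l t, q.2) := fun t => by
    simp [layerProj, toTorus_add, toTorus_single]
  unfold partialX
  simp_rw [e, cosMode_layerProj, sinMode_layerProj]
  rw [(hasDerivAt_phase j q.1 l).sin.deriv]
  simp; ring

lemma abs_cosMode_le (j : Fin d → ℤ) (p : UnitAddTorus (Fin d) × ℝ) : |cosMode j p| ≤ 1 := by
  obtain ⟨q, rfl⟩ := exists_layerProj p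
  rw [cosMode_layerProj]; exact Real.abs_cos_le_one _

lemma abs_sinMode_le (j : Fin d → ℤ) (p : UnitAddTorus (Fin d) × ℝ) : |sinMode j p| ≤ 1 := by
  obtain ⟨q, rfl⟩ := exists_layerProj p
  rw [sinMode_layerProj]; exact Real.abs_sin_le_one _

/-- Test functions are real, so equations are derived for cosine and sine coefficients; this is the
dictionary to complex coefficients. The height `Y` is a dummy, since the modes do not depend on it.
-/
lemma mFourierCoeff_ofReal {f : UnitAddTorus (Fin d) → ℝ} (hf : Integrable f) (j : Fin d → ℤ)
    (Y : ℝ) : mFourierCoeff (fun X => (f X : ℂ)) j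
      = (∫ X, f X * cosMode j (X, Y) : ℝ) - (∫ X, f X * sinMode j (X, Y) : ℝ) * Complex.I := by
  have hc : Integrable fun X => f X * cosMode j (X, Y) :=
    hf.mul_bdd (c := 1) ((smoothLift_cosMode j).continuous.comp
      (continuous_id.prodMk continuous_const)).aestronglyMeasurable
      (Filter.Eventually.of_forall fun X => abs_cosMode_le j _)
  have hs : Integrable fun X => f X * sinMode j (X, Y) :=
    hf.mul_bdd (c := 1) ((smoothLift_sinMode j).continuous.comp
      (continuous_id.prodMk continuous_const)).aestronglyMeasurable
      (Filter.Eventually.of_forall fun X => abs_sinMode_le j _)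
  rw [mFourierCoeff_eq_integral_volume, ← integral_complex_ofReal, ← integral_complex_ofReal,
    ← integral_mul_const, ← integral_sub hc.ofReal (hs.ofReal.mul_const _)]
  refine integral_congr_ae (Filter.Eventually.of_forall fun X => ?_)
  simp only [mFourier_neg]
  apply Complex.ext <;> simp [cosMode, sinMode] <;> ring

/-- Integration by parts on the slice against both real modes; `integral_partialX_slice` shows that
no boundary term appears. -/
lemma layerCoeff_partialX {φ : UnitAddTorus (Fin d) × ℝ → ℝ} (h : SmoothLift φ) (l : Fin d)
    (j : Fin d → ℤ) (Y : ℝ) :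
    layerCoeff (partialX l φ) j Y = (2 * Real.pi * j l : ℝ) * Complex.I * layerCoeff φ j Y := by
  have hi : ∀ {ψ : UnitAddTorus (Fin d) × ℝ → ℝ}, SmoothLift ψ →
      Integrable fun X => ψ (X, Y) := fun {ψ} hψ =>
    Continuous.integrable_of_hasCompactSupport
      (hψ.continuous.comp (continuous_id.prodMk continuous_const))
      (HasCompactSupport.of_compactSpace _)
  have hibp : ∀ {ψ : UnitAddTorus (Fin d) × ℝ → ℝ}, SmoothLift ψ →
      ∫ X, partialX l φ (X, Y) * ψ (X, Y) = -∫ X, φ (X, Y) * partialX l ψ (X, Y) := by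
    intro ψ hψ
    have h1 := integral_partialX_slice (h.mul hψ) l Y
    simp_rw [h.partialX_mul hψ] at h1
    have h2 := integral_add (hi ((h.partialX l).mul hψ)) (hi (h.mul (hψ.partialX l)))
    simp only [Pi.mul_apply] at h2
    rw [h2] at h1
    linarith
  rw [layerCoeff, layerCoeff, mFourierCoeff_ofReal (hi (h.partialX l)) j Y,
    mFourierCoeff_ofReal (hi h) j Y, hibp (smoothLift_cosMode j), hibp (smoothLift_sinMode j)]
  simp_rw [partialX_cosMode, partialX_sinMode]
  have e1 : ∀ X, φ (X, Y) * (-(2 * Real.pi * j l) * sinMode j (X, Y))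
    = (-(2 * Real.pi * j l)) * (φ (X, Y) * sinMode j (X, Y)) := fun X => by ring
  have e2 : ∀ X, φ (X, Y) * ((2 * Real.pi * j l) * cosMode j (X, Y))
    = (2 * Real.pi * j l) * (φ (X, Y) * cosMode j (X, Y)) := fun X => by ring
  simp_rw [e1, e2, integral_const_mul]
  apply Complex.ext <;> simp

lemma SmoothLift.memLp_slice {φ : UnitAddTorus (Fin d) × ℝ → ℝ} (h : SmoothLift φ) (Y : ℝ) :
    MemLp (fun X => φ (X, Y)) 2 volume :=
  Continuous.memLp_of_hasCompactSupport
    (h.continuous.comp (continuous_id.prodMk continuous_const)) (HasCompactSupport.of_compactSpace _)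

lemma SmoothLift.integrable_slice {φ : UnitAddTorus (Fin d) × ℝ → ℝ} (h : SmoothLift φ) (Y : ℝ) :
    Integrable (fun X => φ (X, Y)) := (h.memLp_slice Y).integrable (by norm_num)

/-- The mean of a function over a horizontal slice. -/
def sliceMean (φ : UnitAddTorus (Fin d) × ℝ → ℝ) (Y : ℝ) : ℝ := ∫ X, φ (X, Y)

/-- **Wirtinger's inequality** on the slices. -/
lemma integral_sub_sliceMean_sq_le {φ : UnitAddTorus (Fin d) × ℝ → ℝ} (h : SmoothLift φ) (Y : ℝ) :
    ∫ X, (φ (X, Y) - sliceMean φ Y) ^ 2 ≤ ∑ l, ∫ X, (partialX l φ (X, Y)) ^ 2 := by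
  have hψ : SmoothLift (φ - fun _ => sliceMean φ Y) := h.sub (SmoothLift.const _)
  have h1 := hasSum_sq_mFourierCoeff_of_memLp (hψ.memLp_slice Y).ofReal
  have h2 := hasSum_sum fun l (_ : l ∈ Finset.univ) =>
    hasSum_sq_mFourierCoeff_of_memLp ((h.partialX l).memLp_slice Y).ofReal
  have key := hasSum_le ?_ h1 h2
  · simpa [← Complex.ofReal_sub] using key
  intro j
  -- Parseval's identity is compared term by term. The zeroth coefficient vanishes once the mean is
  -- subtracted; for j ≠ 0 some |j l| ≥ 1, and ∂_l multiplies the coefficient by at least 2π in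
  -- modulus.
  by_cases hj : j = 0
  · subst hj
    have : mFourierCoeff (fun X => ((φ (X, Y) - sliceMean φ Y : ℝ) : ℂ)) 0 = 0 := by
      rw [mFourierCoeff_eq_integral_volume]
      simp only [neg_zero, mFourier_zero, ContinuousMap.one_apply, one_mul]
      rw [integral_complex_ofReal]
      have : ∫ X, (φ (X, Y) - sliceMean φ Y) = 0 := by
        rw [integral_sub (h.integrable_slice Y) (integrable_const _)]
        simp [sliceMean]
      simp [this]
    simp only [RCLike.ofReal_eq_complex_ofReal] at this ⊢
    erw [this]
    simp only [norm_zero, ne_eq, OfNat.ofNat_ne_zero, not_false_eq_true, zero_pow]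
    positivity
  · obtain ⟨l, hl⟩ := Function.ne_iff.1 hj
    have hl' : (1 : ℝ) ≤ |(j l : ℝ)| := by exact_mod_cast Int.one_le_abs hl
    have e := layerCoeff_partialX hψ l j Y
    have e2 : partialX l (φ - fun _ => sliceMean φ Y) = partialX l φ := by
      ext p; simp [partialX]
    rw [e2, layerCoeff, layerCoeff] at e
    refine le_trans ?_ (Finset.single_le_sum (fun i _ => by positivity) (Finset.mem_univ l))
    erw [e]
    rw [norm_mul, norm_mul, Complex.norm_I, mul_one, Complex.norm_real, mul_pow]
    refine le_mul_of_one_le_left (by positivity) (one_le_pow₀ ?_)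
    rw [Real.norm_eq_abs, abs_mul, abs_of_pos (by positivity : 0 < 2 * Real.pi)]
    nlinarith [Real.pi_gt_three]

end Modes

/-! ### Weak derivatives on a half-line -/

section WeakDerivative

open Set

lemma MeasureTheory.LocallyIntegrable.intervalIntegrable_volume {v : ℝ → ℝ}
    (hv : LocallyIntegrable v) (a b : ℝ) : IntervalIntegrable v volume a b :=
  (hv.integrableOn_isCompact isCompact_uIcc).intervalIntegrable

/-- Integration by parts for the primitive of a locally integrable function. -/
lemma integral_primitive_mul_deriv {u v ψ : ℝ → ℝ} (hv : LocallyIntegrable v)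
    (hu : ∀ a b, u b - u a = ∫ x in a..b, v x) (hψ : ContDiff ℝ 1 ψ) (hc : HasCompactSupport ψ) :
    ∫ x, u x * deriv ψ x = -∫ x, v x * ψ x := by
  have hvi : ∀ a b, IntervalIntegrable v volume a b := hv.intervalIntegrable_volume
  obtain ⟨R, hR⟩ := hc.isCompact.isBounded.exists_norm_le
  set b : ℝ := max R 0 + 1
  have hb : 0 < b := by positivity
  have hsupp : ∀ x, x ∉ Ioc (-b) b → x ∉ tsupport ψ := fun x hx hxs => by
    have h1 := abs_le.1 (hR x hxs)
    have h2 := le_max_left R 0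
    exact hx ⟨by simp only [b]; linarith, by simp only [b]; linarith⟩
  have hψ0 : ∀ x, x ∉ tsupport ψ → ψ x = 0 := fun x hx => image_eq_zero_of_notMem_tsupport hx
  have hψ1 : ∀ x, x ∉ tsupport ψ → deriv ψ x = 0 := fun x hx =>
    image_eq_zero_of_notMem_tsupport fun h => hx (tsupport_deriv_subset h)
  have hends : ψ b = 0 ∧ ψ (-b) = 0 := by
    constructor
    · refine hψ0 b fun h => ?_
      have := hR b h
      rw [Real.norm_eq_abs, abs_of_pos hb] at this
      have h2 := le_max_left R 0
      simp only [b] at this; linarith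
    · exact hψ0 _ (hsupp _ (by simp))
  have e1 : ∫ x, u x * deriv ψ x = ∫ x in (-b)..b, u x * deriv ψ x := by
    rw [intervalIntegral.integral_of_le (by linarith), setIntegral_eq_integral_of_forall_compl_eq_zero]
    intro x hx; rw [hψ1 x (hsupp x hx), mul_zero]
  have e2 : ∫ x, v x * ψ x = ∫ x in (-b)..b, v x * ψ x := by
    rw [intervalIntegral.integral_of_le (by linarith), setIntegral_eq_integral_of_forall_compl_eq_zero]
    intro x hx; rw [hψ0 x (hsupp x hx), mul_zero]
  have hu' : u = fun x => u 0 + ∫ t in (0 : ℝ)..x, v t := by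
    ext x; rw [← hu]; ring
  -- A primitive of an integrable function is absolutely continuous, which suffices for integration
  -- by parts on [-b, b]. The boundary terms vanish because `b` lies beyond the support of `ψ`.
  have hac : AbsolutelyContinuousOnInterval u (-b) b := by
    have h0 := (hvi (-b) b).absolutelyContinuousOnInterval_intervalIntegral (c := 0)
      (by rw [mem_uIcc]; left; constructor <;> linarith)
    have hk : AbsolutelyContinuousOnInterval (fun _ : ℝ => u 0) (-b) b :=
      (LipschitzOnWith.of_dist_le_mul (K := 0) fun x _ y _ => by simp).absolutelyContinuousOnInterval
    rw [hu']
    exact hk.fun_add h0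
  have hacψ : AbsolutelyContinuousOnInterval ψ (-b) b :=
    hψ.contDiffOn.absolutelyContinuousOnInterval
  rw [e1, e2, hac.integral_mul_deriv_eq_deriv_mul hacψ, hends.1, hends.2]
  simp only [mul_zero, sub_zero, zero_sub, neg_inj]
  apply intervalIntegral.integral_congr_ae
  filter_upwards [_root_.LocallyIntegrable.ae_hasDerivAt_integral hv] with x hx _
  have := (hx 0).const_add (u 0)
  rw [← hu'] at this
  rw [this.deriv]

/-- `v` is the weak derivative of `u` on the half-line `(a, ∞)`. -/
structure HasWeakDerivIoi (a : ℝ) (u v : ℝ → ℝ) : Prop where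
  left : LocallyIntegrable u
  right : LocallyIntegrable v
  weak : ∀ ψ : ℝ → ℝ, ContDiff ℝ ∞ ψ → HasCompactSupport ψ → tsupport ψ ⊆ Ioi a →
    ∫ x, u x * deriv ψ x = -∫ x, v x * ψ x

lemma MeasureTheory.LocallyIntegrable.integrable_mul_of_hasCompactSupport {u ψ : ℝ → ℝ}
    (hu : LocallyIntegrable u) (hψ : Continuous ψ) (hc : HasCompactSupport ψ) :
    Integrable fun x => u x * ψ x := by
  simpa [mul_comm] using hu.integrable_smul_left_of_hasCompactSupport hψ hc

lemma exists_bump_Ioi (a : ℝ) : ∃ ρ : ℝ → ℝ, ContDiff ℝ ∞ ρ ∧ HasCompactSupport ρ ∧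
    tsupport ρ ⊆ Ioi a ∧ ∫ x, ρ x = 1 := by
  let f : ContDiffBump (a + 2) := ⟨1 / 2, 1, by norm_num, by norm_num⟩
  refine ⟨f.normed volume, f.contDiff_normed, f.hasCompactSupport_normed, ?_, f.integral_normed⟩
  rw [f.tsupport_normed_eq]
  intro x hx
  rw [Metric.mem_closedBall, Real.dist_eq] at hx
  have := (abs_le.1 hx).1
  simp only [f] at this
  rw [mem_Ioi]; linarith

/-- The primitive starts at the left end of the support. To the right of the support it equals the
full integral of `θ`, which is zero. -/
lemma exists_primitive_of_integral_eq_zero {a : ℝ} {θ : ℝ → ℝ} (hθ : ContDiff ℝ ∞ θ)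
    (hc : HasCompactSupport θ) (hs : tsupport θ ⊆ Ioi a) (h0 : ∫ x, θ x = 0) :
    ∃ Θ : ℝ → ℝ, ContDiff ℝ ∞ Θ ∧ HasCompactSupport Θ ∧ tsupport Θ ⊆ Ioi a ∧ deriv Θ = θ := by
  by_cases hne : (tsupport θ).Nonempty
  swap
  · rw [not_nonempty_iff_eq_empty, tsupport_eq_empty_iff] at hne
    exact ⟨0, contDiff_const, HasCompactSupport.zero, by simp [tsupport],
      by rw [hne]; exact deriv_zero⟩
  obtain ⟨lo, hlo, hlo'⟩ := hc.isCompact.exists_isLeast hne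
  obtain ⟨hi, hhi, hhi'⟩ := hc.isCompact.exists_isGreatest hne
  have hz : ∀ x, x ∉ Icc lo hi → θ x = 0 := fun x hx =>
    image_eq_zero_of_notMem_tsupport fun h => hx ⟨hlo' h, hhi' h⟩
  have hle : lo ≤ hi := hlo' hhi
  have hsupp : ∀ x, x ∉ Icc lo hi → ∫ t in lo..x, θ t = 0 := by
    intro x hx
    rcases lt_or_ge x lo with h | h
    · rw [intervalIntegral.integral_of_ge h.le]
      rw [setIntegral_congr_ae (g := fun _ => (0 : ℝ)) measurableSet_Ioc]
      · simp
      · have : ∀ᵐ t : ℝ, t ≠ lo := by simp [ae_iff]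
        filter_upwards [this] with t ht htx
        exact hz t fun h' => ht (le_antisymm htx.2 h'.1)
    · have hx' : hi < x := not_le.1 fun h' => hx ⟨h, h'⟩
      rw [intervalIntegral.integral_of_le h]
      rw [← integral_Icc_eq_integral_Ioc, setIntegral_eq_integral_of_forall_compl_eq_zero, h0]
      intro t ht
      exact hz t fun h' => ht ⟨h'.1, h'.2.trans hx'.le⟩
  have hd : ∀ x, HasDerivAt (fun x => ∫ t in lo..x, θ t) (θ x) x := fun x =>
    hθ.continuous.integral_hasStrictDerivAt lo x |>.hasDerivAt
  have hd' : deriv (fun x => ∫ t in lo..x, θ t) = θ := funext fun x => (hd x).deriv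
  have hts : tsupport (fun x => ∫ t in lo..x, θ t) ⊆ Icc lo hi :=
    closure_minimal (fun x hx => by_contra fun h => hx (hsupp x h)) isClosed_Icc
  refine ⟨fun x => ∫ t in lo..x, θ t, ?_, ?_, ?_, hd'⟩
  · rw [contDiff_infty_iff_deriv, hd']
    exact ⟨fun x => (hd x).differentiableAt, hθ⟩
  · exact isCompact_Icc.of_isClosed_subset (isClosed_tsupport _) hts
  · exact hts.trans fun x hx => lt_of_lt_of_le (hs hlo) hx.1

/-- A function with vanishing weak derivative is constant. -/
lemma ae_eq_const_of_weakDeriv_eq_zero {a : ℝ} {w : ℝ → ℝ} (hw : LocallyIntegrable w)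
    (h : ∀ ψ : ℝ → ℝ, ContDiff ℝ ∞ ψ → HasCompactSupport ψ → tsupport ψ ⊆ Ioi a →
      ∫ x, w x * deriv ψ x = 0) : ∃ c, ∀ᵐ x, x ∈ Ioi a → w x = c := by
  obtain ⟨ρ, hρ, hρc, hρs, hρ1⟩ := exists_bump_Ioi a
  refine ⟨∫ x, w x * ρ x, ?_⟩
  have key : ∀ᵐ x, x ∈ Ioi a → w x - ∫ x, w x * ρ x = 0 := by
    refine isOpen_Ioi.ae_eq_zero_of_integral_contDiff_smul_eq_zero
      ((hw.sub (locallyIntegrable_const _)).locallyIntegrableOn _) ?_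
    intro ψ hψ hψc hψs
    have hψi : Integrable ψ := hψ.continuous.integrable_of_hasCompactSupport hψc
    have hρi : Integrable ρ := hρ.continuous.integrable_of_hasCompactSupport hρc
    have hwψ := hw.integrable_mul_of_hasCompactSupport hψ.continuous hψc
    have hwρ := hw.integrable_mul_of_hasCompactSupport hρ.continuous hρc
    -- Subtracting (∫ψ) ρ makes the integral zero without leaving the half-line, so the result is
    -- the derivative of an admissible test function.
    obtain ⟨Θ, hΘ, hΘc, hΘs, hΘd⟩ := exists_primitive_of_integral_eq_zero (a := a)
      (θ := fun x => ψ x + (-∫ x, ψ x) * ρ x)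
      (hψ.add (contDiff_const.mul hρ)) (hψc.add hρc.mul_left)
      ((closure_mono (Function.support_add _ _)).trans (by
        rw [closure_union]
        exact union_subset hψs ((closure_mono (Function.support_mul_subset_right _ _)).trans hρs)))
      (by rw [integral_add hψi (hρi.const_mul _), integral_const_mul, hρ1]; ring)
    have h2 := h Θ hΘ hΘc hΘs
    rw [hΘd] at h2
    have e : ∀ x, w x * (ψ x + (-∫ x, ψ x) * ρ x)
      = w x * ψ x + (-∫ x, ψ x) * (w x * ρ x) := fun x => by ring
    simp_rw [e] at h2
    rw [integral_add hwψ (hwρ.const_mul _), integral_const_mul] at h2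
    have e3 : ∀ x, ψ x • (w x - ∫ x, w x * ρ x) = w x * ψ x - (∫ x, w x * ρ x) * ψ x :=
      fun x => by simp only [smul_eq_mul]; ring
    simp_rw [e3]
    rw [integral_sub hwψ (hψi.const_mul _), integral_const_mul]
    linarith
  filter_upwards [key] with x hx hxa
  linarith [hx hxa]

namespace HasWeakDerivIoi

variable {a : ℝ} {u v u' v' : ℝ → ℝ}

/-- A function with a locally integrable weak derivative is a primitive of it. -/
lemma exists_ae_eq (h : HasWeakDerivIoi a u v) :
    ∃ c, ∀ᵐ x, x ∈ Ioi a → u x = c + ∫ t in a..x, v t := by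
  have hv := h.right
  have hcont : Continuous fun x => ∫ t in a..x, v t :=
    intervalIntegral.continuous_primitive (hv.intervalIntegrable_volume) a
  obtain ⟨c, hc⟩ := ae_eq_const_of_weakDeriv_eq_zero (a := a)
    (w := fun x => u x - ∫ t in a..x, v t) (h.left.sub hcont.locallyIntegrable) (by
      intro ψ hψ hψc hψs
      have hdc := hψ.continuous_deriv (by simp)
      simp_rw [sub_mul]
      rw [integral_sub (h.left.integrable_mul_of_hasCompactSupport hdc hψc.deriv)
        (hcont.locallyIntegrable.integrable_mul_of_hasCompactSupport hdc hψc.deriv),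
        h.weak ψ hψ hψc hψs, integral_primitive_mul_deriv hv (fun x y => by
          rw [intervalIntegral.integral_interval_sub_left] <;> exact hv.intervalIntegrable_volume _ _)
          (hψ.of_le (by simp)) hψc, sub_self])
  refine ⟨c, hc.mono fun x hx hxa => by linarith [hx hxa]⟩

/-- The integrating factor for the first-order equations of the modes; the exponential is absorbed
into the test function. -/
lemma mul_exp (h : HasWeakDerivIoi a u v) (k : ℝ) :
    HasWeakDerivIoi a (fun x => u x * Real.exp (k * x))
      (fun x => (v x + k * u x) * Real.exp (k * x)) where
  left := by
    have : Continuous fun x => Real.exp (k * x) := by fun_prop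
    simpa [mul_comm] using h.left.smul_continuous this
  right := by
    have : Continuous fun x => Real.exp (k * x) := by fun_prop
    have h2 := (h.right.add (h.left.smul k)).smul_continuous this
    simpa [mul_comm] using h2
  weak ψ hψ hc hs := by
    have he : ContDiff ℝ ∞ fun x => Real.exp (k * x) := (contDiff_const.mul contDiff_id).exp
    have h1 := h.weak (fun x => Real.exp (k * x) * ψ x) (he.mul hψ) hc.mul_left
      ((closure_mono (Function.support_mul_subset_right _ _)).trans hs)
    have hd : ∀ x, deriv (fun x => Real.exp (k * x) * ψ x) x
        = k * Real.exp (k * x) * ψ x + Real.exp (k * x) * deriv ψ x := fun x => by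
      have h3 : HasDerivAt (fun x => Real.exp (k * x)) (Real.exp (k * x) * (k * 1)) x :=
        ((hasDerivAt_id x).const_mul k).exp
      have h4 := (h3.mul (hψ.differentiable (by simp) x).hasDerivAt).deriv
      rw [Pi.mul_def] at h4
      rw [h4]
      ring
    simp_rw [hd] at h1
    have i1 := h.left.integrable_mul_of_hasCompactSupport
      (ψ := fun x => k * Real.exp (k * x) * ψ x) (by have := hψ.continuous; fun_prop) hc.mul_left
    have i2 := h.left.integrable_mul_of_hasCompactSupport
      (ψ := fun x => Real.exp (k * x) * deriv ψ x)
      (by have := hψ.continuous_deriv (by simp); fun_prop) hc.deriv.mul_left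
    have i3 := h.right.integrable_mul_of_hasCompactSupport
      (ψ := fun x => Real.exp (k * x) * ψ x) (by have := hψ.continuous; fun_prop) hc.mul_left
    simp_rw [mul_add] at h1
    rw [integral_add i1 i2] at h1
    have e1 : ∀ x, u x * Real.exp (k * x) * deriv ψ x = u x * (Real.exp (k * x) * deriv ψ x) :=
      fun x => by ring
    have e2 : ∀ x, (v x + k * u x) * Real.exp (k * x) * ψ x
      = v x * (Real.exp (k * x) * ψ x) + u x * (k * Real.exp (k * x) * ψ x) := fun x => by ring
    simp_rw [e1, e2]
    rw [integral_add i3 i1]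
    linarith

lemma add (h : HasWeakDerivIoi a u v) (h' : HasWeakDerivIoi a u' v') :
    HasWeakDerivIoi a (fun x => u x + u' x) (fun x => v x + v' x) where
  left := h.left.add h'.left
  right := h.right.add h'.right
  weak ψ hψ hc hs := by
    have hdc := hψ.continuous_deriv (by simp)
    simp_rw [add_mul]
    rw [integral_add (h.left.integrable_mul_of_hasCompactSupport hdc hc.deriv)
        (h'.left.integrable_mul_of_hasCompactSupport hdc hc.deriv),
      integral_add (h.right.integrable_mul_of_hasCompactSupport hψ.continuous hc)
        (h'.right.integrable_mul_of_hasCompactSupport hψ.continuous hc),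
      h.weak ψ hψ hc hs, h'.weak ψ hψ hc hs]
    ring

lemma const_mul (h : HasWeakDerivIoi a u v) (k : ℝ) :
    HasWeakDerivIoi a (fun x => k * u x) (fun x => k * v x) where
  left := h.left.smul k
  right := h.right.smul k
  weak ψ hψ hc hs := by
    simp_rw [mul_assoc]
    rw [integral_const_mul, integral_const_mul, h.weak ψ hψ hc hs]
    ring

end HasWeakDerivIoi

end WeakDerivative

/-! ### Cauchy–Schwarz and the one-dimensional trace inequality -/

section Inequalities

open Set

lemma lintegral_sq_le_measure_mul {α : Type*} [MeasurableSpace α] {μ : Measure α}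
    {f : α → ENNReal} (hf : AEMeasurable f μ) :
    (∫⁻ a, f a ∂μ) ^ 2 ≤ μ univ * ∫⁻ a, f a ^ 2 ∂μ := by
  have h := ENNReal.lintegral_mul_le_Lp_mul_Lq μ (p := 2) (q := 2) Real.HolderConjugate.two_two
    hf (aemeasurable_const (b := (1 : ENNReal)))
  simp only [Pi.mul_apply, mul_one, ENNReal.rpow_ofNat, one_pow, lintegral_one] at h
  calc (∫⁻ a, f a ∂μ) ^ 2
      ≤ ((∫⁻ a, f a ^ 2 ∂μ) ^ (1 / 2 : ℝ) * μ univ ^ (1 / 2 : ℝ)) ^ 2 := by gcongr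
    _ = μ univ * ∫⁻ a, f a ^ 2 ∂μ := by
        rw [mul_pow, ← ENNReal.rpow_natCast, ← ENNReal.rpow_mul, ← ENNReal.rpow_natCast,
          ← ENNReal.rpow_mul]
        norm_num
        rw [mul_comm]

lemma ENNReal_add_sq_le (a b : ENNReal) : (a + b) ^ 2 ≤ 2 * a ^ 2 + 2 * b ^ 2 := by
  have := ENNReal.rpow_add_le_mul_rpow_add_rpow a b (p := 2) (by norm_num)
  norm_num at this
  rwa [mul_add] at this

/-- A one-dimensional trace inequality. -/
lemma sq_enorm_le_trace {u v : ℝ → ℝ} {b c Y : ℝ} (hc : -b ≤ c) (hY : c ≤ Y)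
    (hY0 : Y ≤ 0) (hv : Measurable v) (hu : ∀ x y, u y - u x = ∫ s in x..y, v s) :
    ‖u Y‖ₑ ^ 2 ≤ 2 * (∫⁻ t in Ioo 0 1, ‖u t‖ₑ ^ 2)
      + ENNReal.ofReal (2 * (b + 1)) * ∫⁻ s in Ioi c, ‖v s‖ₑ ^ 2 := by
  have hb : 0 ≤ b := by linarith
  -- The point `Y` is joined to each t in (0, 1) along a segment of length at most b + 1, the factor
  -- in Cauchy–Schwarz. Averaging over t then replaces the point value by an L² norm on (0, 1).
  have key : ∀ t ∈ Ioo (0 : ℝ) 1, ‖u Y‖ₑ ^ 2 ≤ 2 * ‖u t‖ₑ ^ 2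
      + ENNReal.ofReal (2 * (b + 1)) * ∫⁻ s in Ioi c, ‖v s‖ₑ ^ 2 := by
    intro t ht
    have hYt : Y ≤ t := hY0.trans ht.1.le
    have h1 : ‖u Y‖ₑ ≤ ‖u t‖ₑ + ∫⁻ s in Ioc Y t, ‖v s‖ₑ := by
      have e : u Y = u t - ∫ s in Ioc Y t, v s := by
        rw [← intervalIntegral.integral_of_le hYt, ← hu]; ring
      rw [e]
      refine (enorm_sub_le).trans ?_
      gcongr
      exact enorm_integral_le_lintegral_enorm _
    calc ‖u Y‖ₑ ^ 2 ≤ (‖u t‖ₑ + ∫⁻ s in Ioc Y t, ‖v s‖ₑ) ^ 2 := by gcongr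
      _ ≤ 2 * ‖u t‖ₑ ^ 2 + 2 * (∫⁻ s in Ioc Y t, ‖v s‖ₑ) ^ 2 := ENNReal_add_sq_le _ _
      _ ≤ 2 * ‖u t‖ₑ ^ 2
          + 2 * (ENNReal.ofReal (b + 1) * ∫⁻ s in Ioi c, ‖v s‖ₑ ^ 2) := by
          gcongr
          refine (lintegral_sq_le_measure_mul hv.enorm.aemeasurable).trans ?_
          gcongr
          · rw [Measure.restrict_apply_univ, Real.volume_Ioc]
            exact ENNReal.ofReal_le_ofReal (by linarith [ht.2])
          · exact fun s hs => lt_of_le_of_lt hY hs.1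
      _ = _ := by
          rw [ENNReal.ofReal_mul (by norm_num), mul_assoc]; norm_num
  calc ‖u Y‖ₑ ^ 2 = ∫⁻ t in Ioo (0 : ℝ) 1, ‖u Y‖ₑ ^ 2 := by simp
    _ ≤ ∫⁻ t in Ioo (0 : ℝ) 1, (2 * ‖u t‖ₑ ^ 2
      + ENNReal.ofReal (2 * (b + 1)) * ∫⁻ s in Ioi c, ‖v s‖ₑ ^ 2) :=
        setLIntegral_mono' measurableSet_Ioo key
    _ = _ := by
        rw [lintegral_add_right _ measurable_const, lintegral_const_mul' _ _ (by norm_num)]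
        simp

lemma lintegral_enorm_sq_eq {α : Type*} [MeasurableSpace α] {μ : Measure α} {f : α → ℝ}
    (hf : MemLp f 2 μ) : ∫⁻ a, ‖f a‖ₑ ^ 2 ∂μ = ENNReal.ofReal (∫ a, f a ^ 2 ∂μ) := by
  rw [ofReal_integral_eq_lintegral_ofReal hf.integrable_sq
    (Filter.Eventually.of_forall fun a => sq_nonneg _)]
  refine lintegral_congr fun a => ?_
  rw [Real.enorm_eq_ofReal_abs, ← ENNReal.ofReal_pow (abs_nonneg _), sq_abs]

end Inequalities

/-! ### The measure of the layer -/

section LayerMeasure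

open Set

variable {d : ℕ} {H : UnitAddTorus (Fin d) → ℝ}

lemma SmoothOnTorus.continuous (hH : SmoothOnTorus H) : Continuous H :=
  isOpenQuotientMap_toTorus.continuous_comp_iff.1 (ContDiff.continuous hH)

lemma measurableSet_layerDomain (hH : Continuous H) : MeasurableSet (layerDomain H) :=
  (isOpen_lt (hH.comp continuous_fst).neg continuous_snd).measurableSet

lemma lintegral_layerMeasure (hH : Continuous H) {f : UnitAddTorus (Fin d) × ℝ → ENNReal}
    (hf : Measurable f) :
    ∫⁻ p, f p ∂layerMeasure H = ∫⁻ X, ∫⁻ Y in Ioi (-H X), f (X, Y) := by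
  rw [layerMeasure, ← lintegral_indicator (measurableSet_layerDomain hH), Measure.volume_eq_prod,
    lintegral_prod _ (hf.indicator (measurableSet_layerDomain hH)).aemeasurable]
  refine lintegral_congr fun X => ?_
  rw [← lintegral_indicator measurableSet_Ioi]
  rfl

lemma layerMeasure_strip_lt_top (hH : Continuous H) (R : ℝ) :
    layerMeasure H {p | p.2 ≤ R} < ⊤ := by
  obtain ⟨b, hb⟩ := (isCompact_range hH).bddAbove
  rw [layerMeasure, Measure.restrict_apply (measurableSet_le measurable_snd measurable_const)]
  refine lt_of_le_of_lt (measure_mono (t := univ ×ˢ Icc (-b) R) ?_) ?_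
  · rintro ⟨X, Y⟩ ⟨h1, h2⟩
    have h3 : H X ≤ b := hb ⟨X, rfl⟩
    have h4 : -H X < Y := h2
    exact ⟨mem_univ _, by linarith, h1⟩
  · rw [Measure.volume_eq_prod, Measure.prod_prod]
    exact ENNReal.mul_lt_top (measure_lt_top _ _) measure_Icc_lt_top

/-- Bounded functions supported in a strip are square integrable. -/
lemma memLp_layerMeasure_of_bound (hH : Continuous H) {f : UnitAddTorus (Fin d) × ℝ → ℝ}
    (hf : Measurable f) {C R : ℝ} (hC : ∀ p, |f p| ≤ C) (hR : ∀ p, R < p.2 → f p = 0)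
    (q : ENNReal) : MemLp f q (layerMeasure H) := by
  have hs : MeasurableSet {p : UnitAddTorus (Fin d) × ℝ | p.2 ≤ R} :=
    measurableSet_le measurable_snd measurable_const
  have : f = {p : UnitAddTorus (Fin d) × ℝ | p.2 ≤ R}.indicator f := by
    ext p
    by_cases hp : p.2 ≤ R
    · simp [hp]
    · simp [hp, hR p (not_le.1 hp)]
  rw [this, memLp_indicator_iff_restrict hs]
  have : IsFiniteMeasure ((layerMeasure H).restrict {p | p.2 ≤ R}) :=
    ⟨by rw [Measure.restrict_apply_univ]; exact layerMeasure_strip_lt_top hH R⟩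
  exact MemLp.of_bound hf.aestronglyMeasurable C (Filter.Eventually.of_forall hC)

lemma IsTest.memLp_layerMeasure {φ : UnitAddTorus (Fin d) × ℝ → ℝ} (h : IsTest φ)
    (hH : Continuous H) (q : ENNReal) : MemLp φ q (layerMeasure H) := by
  obtain ⟨C, -, hC⟩ := h.exists_bound
  obtain ⟨R, -, hR⟩ := h.exists_strip
  refine memLp_layerMeasure_of_bound hH h.continuous.measurable hC (R := R) (fun p hp => ?_) q
  by_contra hn
  exact absurd ((le_abs_self _).trans (hR p hn)) (not_le.2 hp)

end LayerMeasure

/-! ### Removal of the slice means -/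

section Reduced

open Set

variable {d : ℕ} {φ ψ : UnitAddTorus (Fin d) × ℝ → ℝ}

lemma continuous_sliceMean (h : Continuous φ) : Continuous (sliceMean φ) := by
  have h2 : Continuous (Function.uncurry fun (Y : ℝ) (X : UnitAddTorus (Fin d)) => φ (X, Y)) :=
    h.comp (continuous_snd.prodMk continuous_fst)
  exact continuous_parametric_integral_of_continuous (μ := volume) (s := univ) h2 isCompact_univ
    |>.congr fun Y => by simp [sliceMean]

lemma sliceMean_sub_eq (h : SmoothLift φ) (a b : ℝ) :
    sliceMean φ b - sliceMean φ a = ∫ s in a..b, sliceMean (partialY φ) s := by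
  have hc := h.partialY.continuous
  have h1 : ∀ X, φ (X, b) - φ (X, a) = ∫ s in a..b, partialY φ (X, s) := fun X =>
    (intervalIntegral.integral_eq_sub_of_hasDerivAt (fun t _ => h.hasDerivAt_snd X t)
      (Continuous.intervalIntegrable (by fun_prop) _ _)).symm
  unfold sliceMean
  rw [← integral_sub (h.integrable_slice b) (h.integrable_slice a)]
  simp_rw [h1]
  rw [intervalIntegral_integral_swap]
  have : IsCompact (uIcc a b ×ˢ (Set.univ : Set (UnitAddTorus (Fin d)))) :=
    isCompact_uIcc.prod isCompact_univ
  have h2 : Continuous (Function.uncurry fun (s : ℝ) (X : UnitAddTorus (Fin d)) =>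
      partialY φ (X, s)) := hc.comp (continuous_snd.prodMk continuous_fst)
  have h3 := h2.continuousOn.integrableOn_compact (μ := volume.prod volume) this
  rw [IntegrableOn, ← Measure.prod_restrict, Measure.restrict_univ] at h3
  exact h3.mono_measure (Measure.prod_mono (Measure.restrict_mono uIoc_subset_uIcc le_rfl) le_rfl)

lemma hasDerivAt_sliceMean (h : SmoothLift φ) (Y : ℝ) :
    HasDerivAt (sliceMean φ) (sliceMean (partialY φ) Y) Y := by
  have hc := continuous_sliceMean h.partialY.continuous
  have h1 := ((hc.integral_hasStrictDerivAt 0 Y).hasDerivAt).const_add (sliceMean φ 0)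
  have : sliceMean φ = fun Y => sliceMean φ 0 + ∫ s in (0 : ℝ)..Y, sliceMean (partialY φ) s := by
    ext Y; rw [← sliceMean_sub_eq h]; ring
  rw [this]
  exact h1

/-- A test function minus its slice means, extended by a constant to `Y < 0`. -/
def reduced (φ : UnitAddTorus (Fin d) × ℝ → ℝ) (p : UnitAddTorus (Fin d) × ℝ) : ℝ :=
  φ p - sliceMean φ (max p.2 0)

/-- The vertical derivative of `reduced φ`. -/
def reducedY (φ : UnitAddTorus (Fin d) × ℝ → ℝ) (p : UnitAddTorus (Fin d) × ℝ) : ℝ :=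
  partialY φ p - (Ioi (0 : ℝ)).indicator (sliceMean (partialY φ)) p.2

lemma continuous_reduced (h : Continuous φ) : Continuous (reduced φ) := by
  have := continuous_sliceMean h
  unfold reduced; fun_prop

lemma measurable_reducedY (h : SmoothLift φ) : Measurable (reducedY φ) :=
  h.partialY.continuous.measurable.sub
    (((continuous_sliceMean h.partialY.continuous).measurable.indicator measurableSet_Ioi).comp
      measurable_snd)

/-- Freezing the mean below zero creates a kink at Y = 0 only, and one exceptional point does not
affect the fundamental theorem of calculus. -/
lemma reduced_sub_eq (h : SmoothLift φ) (X : UnitAddTorus (Fin d)) (a b : ℝ) :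
    reduced φ (X, b) - reduced φ (X, a) = ∫ s in a..b, reducedY φ (X, s) := by
  have hc := continuous_sliceMean h.partialY.continuous
  have hcp := h.partialY.continuous
  have hr := continuous_reduced h.continuous
  symm
  refine integral_eq_of_hasDerivAt_off_countable (fun s => reduced φ (X, s)) _
    (s := {0}) (countable_singleton 0) (by fun_prop) (fun s hs => ?_) ?_
  · have h0 : s ≠ 0 := hs.2
    have h1 := h.hasDerivAt_snd X s
    refine h1.sub ?_
    rcases lt_or_gt_of_ne h0 with hlt | hgt
    · rw [indicator_of_notMem (by simpa using hlt.le)]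
      refine (hasDerivAt_const s (sliceMean φ 0)).congr_of_eventuallyEq ?_
      filter_upwards [Iio_mem_nhds hlt] with t ht
      rw [max_eq_right (le_of_lt ht)]
    · rw [indicator_of_mem (by simpa using hgt)]
      refine (hasDerivAt_sliceMean h s).congr_of_eventuallyEq ?_
      filter_upwards [Ioi_mem_nhds hgt] with t ht
      rw [max_eq_left (le_of_lt ht)]
  · refine (Continuous.intervalIntegrable (by fun_prop) _ _).sub ?_
    rw [intervalIntegrable_iff]
    exact (intervalIntegrable_iff.1 (hc.intervalIntegrable a b)).indicator measurableSet_Ioi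

lemma sliceMean_eq_zero_of_strip {R : ℝ} (hR : ∀ p, φ p ≠ 0 → |p.2| ≤ R) {Y : ℝ} (hY : R < |Y|) :
    sliceMean φ Y = 0 := by
  have : ∀ X, φ (X, Y) = 0 := fun X => by
    by_contra hn
    exact absurd (hR _ hn) (not_le.2 hY)
  simp [sliceMean, this]

lemma abs_sliceMean_le {C : ℝ} (hC : ∀ p, |φ p| ≤ C) (Y : ℝ) : |sliceMean φ Y| ≤ C := by
  have := norm_integral_le_of_norm_le_const (μ := (volume : Measure (UnitAddTorus (Fin d))))
    (f := fun X => φ (X, Y)) (C := C) (Filter.Eventually.of_forall fun X => hC _)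
  simpa [sliceMean] using this

lemma hasCompactSupport_sliceMean (h : IsTest φ) : HasCompactSupport (sliceMean φ) := by
  obtain ⟨R, -, hR⟩ := h.exists_strip
  refine HasCompactSupport.intro (isCompact_Icc (a := -R) (b := R)) fun Y hY => ?_
  refine sliceMean_eq_zero_of_strip hR ?_
  by_contra hn
  exact hY (abs_le.1 (not_lt.1 hn))

end Reduced

/-! ### Poincaré and trace estimates for reduced functions -/

section Energy

open Set

variable {d : ℕ} {H : UnitAddTorus (Fin d) → ℝ} {φ ψ : UnitAddTorus (Fin d) × ℝ → ℝ}

/-- The Dirichlet energy of `reduced φ`. -/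
def reducedEnergy (H : UnitAddTorus (Fin d) → ℝ) (φ : UnitAddTorus (Fin d) × ℝ → ℝ) : ENNReal :=
  ∑ l, (∫⁻ p, ‖partialX l φ p‖ₑ ^ 2 ∂layerMeasure H)
    + ∫⁻ p, ‖reducedY φ p‖ₑ ^ 2 ∂layerMeasure H

/-- Wirtinger's inequality on each slice Y > 0, where `reduced φ` has mean zero. These slices lie
entirely in the layer because H > 0. -/
lemma lintegral_reduced_upper_le (hH : Continuous H) (hpos : ∀ X, 0 < H X) (h : SmoothLift φ) :
    ∫⁻ X, ∫⁻ Y in Ioi (0 : ℝ), ‖reduced φ (X, Y)‖ₑ ^ 2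
      ≤ ∑ l, ∫⁻ p, ‖partialX l φ p‖ₑ ^ 2 ∂layerMeasure H := by
  have hr := continuous_reduced h.continuous
  have hp := fun l => (h.partialX l).continuous
  have hmr : Measurable fun p => ‖reduced φ p‖ₑ ^ 2 := by
    have := hr.measurable; fun_prop
  have hmp : ∀ l, Measurable fun p => ‖partialX l φ p‖ₑ ^ 2 := fun l => by
    have := (hp l).measurable; fun_prop
  rw [lintegral_lintegral_swap hmr.aemeasurable]
  calc ∫⁻ Y in Ioi (0 : ℝ), ∫⁻ X, ‖reduced φ (X, Y)‖ₑ ^ 2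
      ≤ ∫⁻ Y in Ioi (0 : ℝ), ∑ l, ∫⁻ X, ‖partialX l φ (X, Y)‖ₑ ^ 2 := by
        refine setLIntegral_mono' measurableSet_Ioi fun Y hY => ?_
        have hY' : max Y 0 = Y := max_eq_left (le_of_lt hY)
        have hs : SmoothLift (fun p => φ p - sliceMean φ Y) := h.sub (SmoothLift.const _)
        have e : ∀ X, reduced φ (X, Y) = (fun p => φ p - sliceMean φ Y) (X, Y) := fun X => by
          simp [reduced, hY']
        simp_rw [e]
        rw [lintegral_enorm_sq_eq (hs.memLp_slice Y)]
        simp_rw [fun l => lintegral_enorm_sq_eq ((h.partialX l).memLp_slice Y)]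
        rw [← ENNReal.ofReal_sum_of_nonneg fun l _ => integral_nonneg fun X => sq_nonneg _]
        exact ENNReal.ofReal_le_ofReal (integral_sub_sliceMean_sq_le h Y)
    _ = ∑ l, ∫⁻ X, ∫⁻ Y in Ioi (0 : ℝ), ‖partialX l φ (X, Y)‖ₑ ^ 2 := by
        rw [lintegral_finsetSum' _ fun l _ =>
          (Measurable.lintegral_prod_left' (f := fun p : UnitAddTorus (Fin d) × ℝ =>
            ‖partialX l φ p‖ₑ ^ 2) (hmp l)).aemeasurable]
        refine Finset.sum_congr rfl fun l _ => ?_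
        rw [lintegral_lintegral_swap]
        exact ((hmp l).comp measurable_swap).aemeasurable
    _ ≤ _ := by
        gcongr with l
        rw [lintegral_layerMeasure hH (hmp l)]
        gcongr with X
        linarith [hpos X]

/-- The integrand is the right-hand side of `sq_enorm_le_trace`. Its first term lives on 0 < t < 1
and is controlled by Wirtinger, its second is already part of the energy. -/
lemma lintegral_trace_majorant_le (hH : Continuous H) (hpos : ∀ X, 0 < H X) (h : SmoothLift φ)
    {b : ℝ} (hb : ∀ X, H X ≤ b) :
    ∫⁻ X, (2 * (∫⁻ t in Ioo (0 : ℝ) 1, ‖reduced φ (X, t)‖ₑ ^ 2)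
      + ENNReal.ofReal (2 * (b + 1)) * ∫⁻ s in Ioi (-H X), ‖reducedY φ (X, s)‖ₑ ^ 2)
      ≤ ENNReal.ofReal (2 * (b + 1)) * reducedEnergy H φ := by
  have hb0 : 0 ≤ b := (hpos 0).le.trans (hb 0)
  have hr := continuous_reduced h.continuous
  have hmr : Measurable fun p => ‖reduced φ p‖ₑ ^ 2 := by
    have := hr.measurable; fun_prop
  have hmY : Measurable fun p => ‖reducedY φ p‖ₑ ^ 2 := by
    have := measurable_reducedY h; fun_prop
  have h2 : (2 : ENNReal) ≤ ENNReal.ofReal (2 * (b + 1)) := by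
    rw [show (2 : ENNReal) = ENNReal.ofReal 2 by simp]
    exact ENNReal.ofReal_le_ofReal (by linarith)
  have hm1 : Measurable fun X : UnitAddTorus (Fin d) =>
      2 * (∫⁻ t in Ioo (0 : ℝ) 1, ‖reduced φ (X, t)‖ₑ ^ 2) :=
    (Measurable.lintegral_prod_right' (f := fun p : UnitAddTorus (Fin d) × ℝ =>
      ‖reduced φ p‖ₑ ^ 2) hmr).const_mul 2
  rw [lintegral_add_left hm1, lintegral_const_mul' _ _ (by norm_num),
    lintegral_const_mul' _ _ ENNReal.ofReal_ne_top, ← lintegral_layerMeasure hH hmY,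
    reducedEnergy, mul_add (ENNReal.ofReal _)]
  refine add_le_add (mul_le_mul' h2 ?_) le_rfl
  refine le_trans ?_ (lintegral_reduced_upper_le hH hpos h)
  exact lintegral_mono fun X => lintegral_mono_set Ioo_subset_Ioi_self

lemma lintegral_trace_le (hH : Continuous H) (hpos : ∀ X, 0 < H X) (h : SmoothLift φ)
    {b : ℝ} (hb : ∀ X, H X ≤ b) :
    ∫⁻ X, ‖reduced φ (X, -H X)‖ₑ ^ 2 ≤ ENNReal.ofReal (2 * (b + 1)) * reducedEnergy H φ := by
  refine le_trans (lintegral_mono fun X => ?_) (lintegral_trace_majorant_le hH hpos h hb)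
  exact sq_enorm_le_trace (u := fun s => reduced φ (X, s)) (v := fun s => reducedY φ (X, s))
    (neg_le_neg (hb X)) le_rfl (by linarith [hpos X])
    ((measurable_reducedY h).comp measurable_prodMk_left) (reduced_sub_eq h X)

/-- Below Y = 0 each vertical segment has length at most `b` and each of its points obeys the trace
majorant; above Y = 0 Wirtinger applies with constant 1. -/
lemma lintegral_reduced_le (hH : Continuous H) (hpos : ∀ X, 0 < H X) (h : SmoothLift φ)
    {b : ℝ} (hb : ∀ X, H X ≤ b) :
    ∫⁻ p, ‖reduced φ p‖ₑ ^ 2 ∂layerMeasure H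
      ≤ ENNReal.ofReal (b * (2 * (b + 1)) + 1) * reducedEnergy H φ := by
  have hb0 : 0 ≤ b := (hpos 0).le.trans (hb 0)
  have hr := continuous_reduced h.continuous
  have hmr : Measurable fun p => ‖reduced φ p‖ₑ ^ 2 := by
    have := hr.measurable; fun_prop
  have hsplit : ∀ X, ∫⁻ Y in Ioi (-H X), ‖reduced φ (X, Y)‖ₑ ^ 2
      ≤ ENNReal.ofReal b * (2 * (∫⁻ t in Ioo (0 : ℝ) 1, ‖reduced φ (X, t)‖ₑ ^ 2)
      + ENNReal.ofReal (2 * (b + 1)) * ∫⁻ s in Ioi (-H X), ‖reducedY φ (X, s)‖ₑ ^ 2)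
      + ∫⁻ Y in Ioi (0 : ℝ), ‖reduced φ (X, Y)‖ₑ ^ 2 := by
    intro X
    rw [← Ioc_union_Ioi_eq_Ioi (show -H X ≤ 0 by linarith [hpos X])]
    refine (lintegral_union_le _ _ _).trans ?_
    gcongr ?_ + _
    calc ∫⁻ Y in Ioc (-H X) 0, ‖reduced φ (X, Y)‖ₑ ^ 2
        ≤ ∫⁻ Y in Ioc (-H X) 0, (2 * (∫⁻ t in Ioo (0 : ℝ) 1, ‖reduced φ (X, t)‖ₑ ^ 2)
      + ENNReal.ofReal (2 * (b + 1)) * ∫⁻ s in Ioi (-H X), ‖reducedY φ (X, s)‖ₑ ^ 2) := by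
          refine setLIntegral_mono' measurableSet_Ioc fun Y hY => ?_
          exact sq_enorm_le_trace (u := fun s => reduced φ (X, s))
            (v := fun s => reducedY φ (X, s)) (neg_le_neg (hb X)) hY.1.le hY.2
            ((measurable_reducedY h).comp measurable_prodMk_left) (reduced_sub_eq h X)
      _ ≤ _ := by
          rw [lintegral_const, Measure.restrict_apply_univ, Real.volume_Ioc, mul_comm,
            Ioc_union_Ioi_eq_Ioi (show -H X ≤ 0 by linarith [hpos X])]
          gcongr
          linarith [hb X]
  rw [lintegral_layerMeasure hH hmr]
  refine (lintegral_mono hsplit).trans ?_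
  have hm2 : Measurable fun X : UnitAddTorus (Fin d) =>
      ∫⁻ Y in Ioi (0 : ℝ), ‖reduced φ (X, Y)‖ₑ ^ 2 :=
    Measurable.lintegral_prod_right' (f := fun p : UnitAddTorus (Fin d) × ℝ =>
      ‖reduced φ p‖ₑ ^ 2) hmr
  rw [lintegral_add_right _ hm2, lintegral_const_mul' _ _ ENNReal.ofReal_ne_top,
    ENNReal.ofReal_add (by positivity) zero_le_one, add_mul, ENNReal.ofReal_mul hb0, mul_assoc]
  gcongr
  · exact lintegral_trace_majorant_le hH hpos h hb
  · rw [ENNReal.ofReal_one, one_mul]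
    exact (lintegral_reduced_upper_le hH hpos h).trans le_self_add

lemma memLp_reduced (hH : Continuous H) (h : IsTest φ) :
    MemLp (reduced φ) 2 (layerMeasure H) := by
  obtain ⟨C, -, hC⟩ := h.exists_bound
  obtain ⟨R, hR0, hR⟩ := h.exists_strip
  refine memLp_layerMeasure_of_bound hH (continuous_reduced h.continuous).measurable
    (C := C + C) (R := R) (fun p => ?_) (fun p hp => ?_) 2
  · exact (abs_sub _ _).trans (add_le_add (hC _) (abs_sliceMean_le hC _))
  · have hp0 : 0 < p.2 := hR0.trans hp
    have h1 : φ p = 0 := by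
      by_contra hn
      exact absurd ((le_abs_self _).trans (hR p hn)) (not_le.2 hp)
    rw [reduced, h1, sliceMean_eq_zero_of_strip hR, sub_zero]
    rwa [max_eq_left hp0.le, abs_of_pos hp0]

lemma memLp_reducedY (hH : Continuous H) (h : IsTest φ) :
    MemLp (reducedY φ) 2 (layerMeasure H) := by
  obtain ⟨C, hC0, hC⟩ := h.partialY.exists_bound
  obtain ⟨R, hR0, hR⟩ := h.partialY.exists_strip
  refine memLp_layerMeasure_of_bound hH (measurable_reducedY h.lift)
    (C := C + C) (R := R) (fun p => ?_) (fun p hp => ?_) 2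
  · refine (abs_sub _ _).trans (add_le_add (hC _) ?_)
    by_cases hp : p.2 ∈ Ioi (0 : ℝ)
    · rw [indicator_of_mem hp]; exact abs_sliceMean_le hC _
    · rw [indicator_of_notMem hp, abs_zero]; exact hC0
  · have hp0 : 0 < p.2 := hR0.trans hp
    have h1 : partialY φ p = 0 := by
      by_contra hn
      exact absurd ((le_abs_self _).trans (hR p hn)) (not_le.2 hp)
    rw [reducedY, h1, indicator_of_mem (mem_Ioi.2 hp0), sliceMean_eq_zero_of_strip hR, sub_zero]
    rwa [abs_of_pos hp0]

lemma memLp_reduced_trace (hH : Continuous H) (h : IsTest φ) :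
    MemLp (fun X => reduced φ (X, -H X)) 2 volume :=
  Continuous.memLp_of_hasCompactSupport
    ((continuous_reduced h.continuous).comp (continuous_id.prodMk hH.neg))
    (HasCompactSupport.of_compactSpace _)

/-- `reduced φ` has the weak gradient `(∂_X φ, reducedY φ)`. -/
lemma integral_reduced_mul_partialX (hφ : IsTest φ) (hψ : IsTest ψ) (l : Fin d) :
    ∫ p, reduced φ p * partialX l ψ p = -∫ p, partialX l φ p * ψ p := by
  have i1 : Integrable (fun p => reduced φ p * partialX l ψ p) (volume.prod volume) :=
    Continuous.integrable_of_hasCompactSupport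
      ((continuous_reduced hφ.continuous).mul (hψ.partialX l).continuous)
      (hψ.partialX l).compact.mul_left
  have i2 : Integrable (fun p => partialX l φ p * ψ p) (volume.prod volume) :=
    ((hψ.mul_left (hφ.partialX l).lift)).integrable
  rw [Measure.volume_eq_prod, integral_prod_symm _ i1, integral_prod_symm _ i2, ← integral_neg]
  refine integral_congr_ae (Filter.Eventually.of_forall fun Y => ?_)
  have hs : SmoothLift (fun p => φ p - sliceMean φ (max Y 0)) := hφ.lift.sub (SmoothLift.const _)
  have h1 := integral_partialX_slice (hs.mul hψ.lift) l Y
  simp_rw [hs.partialX_mul hψ.lift] at h1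
  have e : partialX l (fun p => φ p - sliceMean φ (max Y 0)) = partialX l φ := by
    ext p; simp [partialX]
  rw [e] at h1
  have h2 := integral_add (((hφ.partialX l).lift.mul hψ.lift).integrable_slice Y)
    ((hs.mul (hψ.partialX l).lift).integrable_slice Y)
  simp only [Pi.mul_apply] at h2
  rw [h2] at h1
  change ∫ X, (φ (X, Y) - sliceMean φ (max Y 0)) * partialX l ψ (X, Y)
    = -∫ X, partialX l φ (X, Y) * ψ (X, Y)
  linarith

lemma IsTest.slice_snd (hψ : IsTest ψ) (X : UnitAddTorus (Fin d)) :
    ContDiff ℝ ∞ (fun s => ψ (X, s)) ∧ HasCompactSupport (fun s => ψ (X, s)) := by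
  constructor
  · obtain ⟨x, rfl⟩ := isOpenQuotientMap_toTorus.surjective X
    exact ContDiff.comp (g := fun q : (Fin d → ℝ) × ℝ => ψ (toTorus q.1, q.2)) hψ.smooth ((contDiff_const (c := x)).prodMk contDiff_id)
  · obtain ⟨R, -, hR⟩ := hψ.exists_strip
    refine HasCompactSupport.intro (isCompact_Icc (a := -R) (b := R)) fun Y hY => ?_
    by_contra hn
    exact hY (abs_le.1 (hR _ hn))

lemma integrable_reducedY_mul (hφ : SmoothLift φ) (hψ : IsTest ψ) :
    Integrable (fun p => reducedY φ p * ψ p) (volume.prod volume) := by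
  have i1 : Integrable (fun p => partialY φ p * ψ p) (volume.prod volume) :=
    (hψ.mul_left hφ.partialY).integrable
  have i2 : Integrable (fun p => sliceMean (partialY φ) p.2 * ψ p)
      ((volume : Measure (UnitAddTorus (Fin d))).prod volume) :=
    Continuous.integrable_of_hasCompactSupport
      (((continuous_sliceMean hφ.partialY.continuous).comp continuous_snd).mul hψ.continuous)
      hψ.compact.mul_left
  have hm : MeasurableSet {p : UnitAddTorus (Fin d) × ℝ | 0 < p.2} :=
    measurableSet_lt measurable_const measurable_snd
  refine (i1.sub (i2.indicator hm)).congr (Filter.Eventually.of_forall fun p => ?_)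
  by_cases hp : 0 < p.2
  · simp [reducedY, indicator, hp]; ring
  · simp [reducedY, indicator, hp]

/-- Fubini reduces to vertical lines, on which `reduced φ` is a primitive of `reducedY φ`, so the
kink at Y = 0 does no harm. -/
lemma integral_reduced_mul_partialY (hφ : IsTest φ) (hψ : IsTest ψ) :
    ∫ p, reduced φ p * partialY ψ p = -∫ p, reducedY φ p * ψ p := by
  have i1 : Integrable (fun p => reduced φ p * partialY ψ p) (volume.prod volume) :=
    Continuous.integrable_of_hasCompactSupport
      ((continuous_reduced hφ.continuous).mul hψ.partialY.continuous)
      hψ.partialY.compact.mul_left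
  rw [Measure.volume_eq_prod, integral_prod _ i1, integral_prod _ (integrable_reducedY_mul hφ.lift hψ),
    ← integral_neg]
  refine integral_congr_ae (Filter.Eventually.of_forall fun X => ?_)
  have hv : LocallyIntegrable fun s => reducedY φ (X, s) := by
    have hc := continuous_sliceMean hφ.partialY.continuous
    have h1 : Continuous fun s => partialY φ (X, s) :=
      hφ.partialY.continuous.comp (by fun_prop)
    exact h1.locallyIntegrable.sub (hc.locallyIntegrable.indicator measurableSet_Ioi)
  exact integral_primitive_mul_deriv hv (fun a b => reduced_sub_eq hφ.lift X a b)
    ((hψ.slice_snd X).1.of_le (by simp)) (hψ.slice_snd X).2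

end Energy

/-! ### The variational solution without mean mode -/

section Existence

open Set

variable {d : ℕ}

/-- The space of test functions. -/
def testSpace (d : ℕ) : Submodule ℝ (UnitAddTorus (Fin d) × ℝ → ℝ) where
  carrier := {φ | IsTest φ}
  add_mem' := fun h h' => IsTest.add h h'
  zero_mem' := IsTest.zero
  smul_mem' := fun c _ h => IsTest.const_smul c h

variable {φ ψ : UnitAddTorus (Fin d) × ℝ → ℝ}

lemma sliceMean_add (h : SmoothLift φ) (h' : SmoothLift ψ) (Y : ℝ) :
    sliceMean (φ + ψ) Y = sliceMean φ Y + sliceMean ψ Y :=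
  integral_add (h.integrable_slice Y) (h'.integrable_slice Y)

lemma sliceMean_const_smul (c : ℝ) (Y : ℝ) : sliceMean (c • φ) Y = c * sliceMean φ Y :=
  integral_const_mul _ _

lemma reduced_add (h : SmoothLift φ) (h' : SmoothLift ψ) :
    reduced (φ + ψ) = reduced φ + reduced ψ := by
  ext p; simp only [reduced, sliceMean_add h h', Pi.add_apply]; ring

lemma reduced_const_smul (c : ℝ) : reduced (c • φ) = c • reduced φ := by
  ext p; simp only [reduced, sliceMean_const_smul, Pi.smul_apply, smul_eq_mul]; ring

lemma reducedY_add (h : SmoothLift φ) (h' : SmoothLift ψ) :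
    reducedY (φ + ψ) = reducedY φ + reducedY ψ := by
  ext p
  by_cases hp : p.2 ∈ Ioi (0 : ℝ)
  · simp only [reducedY, h.partialY_add h', sliceMean_add h.partialY h'.partialY, Pi.add_apply,
      indicator_of_mem hp]; ring
  · simp only [reducedY, h.partialY_add h', Pi.add_apply, indicator_of_notMem hp]; ring

lemma reducedY_const_smul (h : SmoothLift φ) (c : ℝ) : reducedY (c • φ) = c • reducedY φ := by
  ext p
  by_cases hp : p.2 ∈ Ioi (0 : ℝ)
  · simp only [reducedY, h.partialY_const_smul, sliceMean_const_smul, Pi.smul_apply, smul_eq_mul,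
      indicator_of_mem hp]; ring
  · simp only [reducedY, h.partialY_const_smul, Pi.smul_apply, smul_eq_mul,
      indicator_of_notMem hp]; ring

variable {H : UnitAddTorus (Fin d) → ℝ}

/-- The linear map `φ ↦ reduced φ` into `L²`. -/
def reducedL (hH : Continuous H) : testSpace d →ₗ[ℝ] Lp ℝ 2 (layerMeasure H) where
  toFun φ := (memLp_reduced hH φ.2).toLp
  map_add' φ ψ := by
    rw [← MemLp.toLp_add]
    congr 1
    exact reduced_add φ.2.lift ψ.2.lift
  map_smul' c φ := by
    rw [RingHom.id_apply, ← MemLp.toLp_const_smul]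
    congr 1
    exact reduced_const_smul c

/-- The components of the gradient of `reduced φ`; `none` is the vertical one. -/
def reducedGradFun (φ : UnitAddTorus (Fin d) × ℝ → ℝ) :
    Option (Fin d) → UnitAddTorus (Fin d) × ℝ → ℝ
  | none => reducedY φ
  | some l => partialX l φ

lemma memLp_reducedGradFun (hH : Continuous H) (h : IsTest φ) (i : Option (Fin d)) :
    MemLp (reducedGradFun φ i) 2 (layerMeasure H) := by
  cases i with
  | none => exact memLp_reducedY hH h
  | some l => exact (h.partialX l).memLp_layerMeasure hH 2

/-- The linear map from a test function to the gradient of `reduced φ` in `L²`. -/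
def reducedGradL (hH : Continuous H) :
    testSpace d →ₗ[ℝ] PiLp 2 fun _ : Option (Fin d) => Lp ℝ 2 (layerMeasure H) where
  toFun φ := WithLp.toLp 2 fun i => (memLp_reducedGradFun hH φ.2 i).toLp
  map_add' φ ψ := by
    ext1 i
    rw [PiLp.add_apply]
    change (memLp_reducedGradFun hH (φ + ψ).2 i).toLp = (memLp_reducedGradFun hH φ.2 i).toLp
      + (memLp_reducedGradFun hH ψ.2 i).toLp
    rw [← MemLp.toLp_add]
    congr 1
    cases i with
    | none => exact reducedY_add φ.2.lift ψ.2.lift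
    | some l => exact φ.2.lift.partialX_add ψ.2.lift l
  map_smul' c φ := by
    ext1 i
    rw [RingHom.id_apply, PiLp.smul_apply]
    change (memLp_reducedGradFun hH (c • φ).2 i).toLp = c • (memLp_reducedGradFun hH φ.2 i).toLp
    rw [← MemLp.toLp_const_smul]
    congr 1
    cases i with
    | none => exact reducedY_const_smul φ.2.lift c
    | some l => exact φ.2.lift.partialX_const_smul c l

/-- The linear map from a test function to the trace of `reduced φ` in `L²`. -/
def reducedTraceL (hH : Continuous H) :
    testSpace d →ₗ[ℝ] Lp ℝ 2 (volume : Measure (UnitAddTorus (Fin d))) where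
  toFun φ := (memLp_reduced_trace hH φ.2).toLp
  map_add' φ ψ := by
    rw [← MemLp.toLp_add]
    congr 1
    ext X
    exact congrFun (reduced_add φ.2.lift ψ.2.lift) (X, -H X)
  map_smul' c φ := by
    rw [RingHom.id_apply, ← MemLp.toLp_const_smul]
    congr 1
    ext X
    exact congrFun (reduced_const_smul (φ := (φ : UnitAddTorus (Fin d) × ℝ → ℝ)) c) (X, -H X)

lemma enorm_toLp_sq {α : Type*} [MeasurableSpace α] {μ : Measure α} {f : α → ℝ}
    (hf : MemLp f 2 μ) : ‖hf.toLp‖ₑ ^ 2 = ∫⁻ a, ‖f a‖ₑ ^ 2 ∂μ := by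
  rw [Lp.enorm_toLp, eLpNorm_eq_lintegral_rpow_enorm_toReal (by norm_num) (by norm_num)]
  rw [← ENNReal.rpow_natCast, ← ENNReal.rpow_mul]
  norm_num

lemma inner_toLp_left {α : Type*} [MeasurableSpace α] {μ : Measure α} {f : α → ℝ}
    (hf : MemLp f 2 μ) (g : Lp ℝ 2 μ) : inner ℝ hf.toLp g = ∫ a, g a * f a ∂μ := by
  rw [L2.inner_def]
  refine integral_congr_ae ?_
  filter_upwards [hf.coeFn_toLp] with a h1
  rw [h1]; simp

lemma inner_toLp_toLp {α : Type*} [MeasurableSpace α] {μ : Measure α} {f g : α → ℝ}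
    (hf : MemLp f 2 μ) (hg : MemLp g 2 μ) :
    inner ℝ hf.toLp hg.toLp = ∫ a, f a * g a ∂μ := by
  rw [L2.inner_def]
  refine integral_congr_ae ?_
  filter_upwards [hf.coeFn_toLp, hg.coeFn_toLp] with a h1 h2
  rw [h1, h2]; simp [mul_comm]

lemma enorm_reducedGradL_sq (hH : Continuous H) (φ : testSpace d) :
    ‖reducedGradL hH φ‖ₑ ^ 2 = reducedEnergy H φ := by
  have h1 : ‖reducedGradL hH φ‖ ^ 2
      = ∑ i, ‖(memLp_reducedGradFun hH φ.2 i).toLp‖ ^ 2 := PiLp.norm_sq_eq_of_L2 _ _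
  rw [← ofReal_norm, ← ENNReal.ofReal_pow (norm_nonneg _), h1,
    ENNReal.ofReal_sum_of_nonneg fun i _ => by positivity]
  have h2 : ∀ i, ENNReal.ofReal (‖(memLp_reducedGradFun hH φ.2 i).toLp‖ ^ 2)
      = ∫⁻ p, ‖reducedGradFun φ i p‖ₑ ^ 2 ∂layerMeasure H := fun i => by
    rw [ENNReal.ofReal_pow (norm_nonneg _), ofReal_norm, enorm_toLp_sq]
  simp_rw [h2]
  rw [Fintype.sum_option, add_comm]
  rfl

lemma norm_le_sqrt_mul_of_enorm_sq_le {E F : Type*} [SeminormedAddCommGroup E]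
    [SeminormedAddCommGroup F] {x : E} {y : F} {K : ℝ} (hK : 0 ≤ K)
    (h : ‖x‖ₑ ^ 2 ≤ ENNReal.ofReal K * ‖y‖ₑ ^ 2) : ‖x‖ ≤ Real.sqrt K * ‖y‖ := by
  rw [← ofReal_norm, ← ofReal_norm, ← ENNReal.ofReal_pow (norm_nonneg _),
    ← ENNReal.ofReal_pow (norm_nonneg _), ← ENNReal.ofReal_mul hK,
    ENNReal.ofReal_le_ofReal_iff (by positivity)] at h
  rw [← sq_le_sq₀ (norm_nonneg _) (by positivity), mul_pow, Real.sq_sqrt hK]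
  exact h

lemma integral_layerMeasure_eq {f : UnitAddTorus (Fin d) × ℝ → ℝ}
    (hf : ∀ p, p ∉ layerDomain H → f p = 0) : ∫ p, f p ∂layerMeasure H = ∫ p, f p :=
  setIntegral_eq_integral_of_forall_compl_eq_zero hf

lemma measurable_indicator_snd {η : ℝ → ℝ} (hη : Continuous η) :
    Measurable fun p : UnitAddTorus (Fin d) × ℝ => (Ioi (0 : ℝ)).indicator η p.2 :=
  (hη.measurable.indicator measurableSet_Ioi).comp measurable_snd

lemma memLp_indicator_snd (hH : Continuous H) {η : ℝ → ℝ} (hη : Continuous η)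
    (hc : HasCompactSupport η) (q : ENNReal) :
    MemLp (fun p : UnitAddTorus (Fin d) × ℝ => (Ioi (0 : ℝ)).indicator η p.2) q
      (layerMeasure H) := by
  obtain ⟨C, hC⟩ := hc.exists_bound_of_continuous hη
  obtain ⟨R, hR⟩ := hc.isCompact.isBounded.exists_norm_le
  refine memLp_layerMeasure_of_bound hH (measurable_indicator_snd hη) (C := C) (R := R)
    (fun p => ?_) (fun p hp => ?_) q
  · refine (norm_indicator_le_norm_self η p.2).trans (hC _)
  · refine indicator_apply_eq_zero.2 fun _ => image_eq_zero_of_notMem_tsupport fun h => ?_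
    exact absurd ((le_abs_self _).trans (hR p.2 h)) (not_le.2 hp)

/-- Horizontal oscillation is orthogonal to functions of Y alone. As a continuous linear condition
this passes to the closure and gives the vanishing slice means of the variational solution. -/
lemma integral_mul_indicator_snd_eq_zero (hpos : ∀ X, 0 < H X) {η : ℝ → ℝ}
    (hη : Continuous η) (hc : HasCompactSupport η) {f : UnitAddTorus (Fin d) × ℝ → ℝ}
    (hf : Continuous f) :
    ∫ p, (f p - sliceMean f p.2) * (Ioi (0 : ℝ)).indicator η p.2 ∂layerMeasure H = 0 := by
  have hcm := continuous_sliceMean hf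
  rw [integral_layerMeasure_eq]
  swap
  · intro p hp
    rw [indicator_of_notMem, mul_zero]
    exact fun h => hp (show -H p.1 < p.2 by linarith [hpos p.1, mem_Ioi.1 h])
  have hcs : HasCompactSupport fun p : UnitAddTorus (Fin d) × ℝ => η p.2 :=
    HasCompactSupport.intro (isCompact_univ.prod hc.isCompact) fun p hp =>
      image_eq_zero_of_notMem_tsupport fun h => hp ⟨mem_univ _, h⟩
  have i1 : Integrable (fun p => (f p - sliceMean f p.2) * η p.2)
      ((volume : Measure (UnitAddTorus (Fin d))).prod volume) :=
    Continuous.integrable_of_hasCompactSupport (by fun_prop) hcs.mul_left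
  have hm : MeasurableSet {p : UnitAddTorus (Fin d) × ℝ | 0 < p.2} :=
    measurableSet_lt measurable_const measurable_snd
  have i2 : Integrable (fun p => (f p - sliceMean f p.2) * (Ioi (0 : ℝ)).indicator η p.2)
      ((volume : Measure (UnitAddTorus (Fin d))).prod volume) := by
    refine (i1.indicator hm).congr (Filter.Eventually.of_forall fun p => ?_)
    by_cases hp : 0 < p.2 <;> simp [indicator, hp]
  rw [Measure.volume_eq_prod, integral_prod_symm _ i2]
  refine integral_eq_zero_of_ae (Filter.Eventually.of_forall fun Y => ?_)
  have hi : Integrable fun X => f (X, Y) :=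
    Continuous.integrable_of_hasCompactSupport (by fun_prop) (HasCompactSupport.of_compactSpace _)
  simp only [Pi.zero_apply]
  rw [integral_mul_const, integral_sub hi (integrable_const _)]
  simp [sliceMean]

/-- A variational solution whose slice means vanish for `Y > 0`. -/
theorem exists_reduced_solution (hH : Continuous H) (hpos : ∀ X, 0 < H X) :
    ∃ C : ℝ, 0 ≤ C ∧ ∀ (G : UnitAddTorus (Fin d) × ℝ → ℝ) (N : UnitAddTorus (Fin d) → ℝ),
      MemLp G 2 (layerMeasure H) → MemLp N 2 volume →
      ∃ (W : UnitAddTorus (Fin d) × ℝ → ℝ) (WX : Fin d → UnitAddTorus (Fin d) × ℝ → ℝ)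
        (WY : UnitAddTorus (Fin d) × ℝ → ℝ),
        MemLp W 2 (layerMeasure H) ∧ (∀ l, MemLp (WX l) 2 (layerMeasure H)) ∧
        MemLp WY 2 (layerMeasure H) ∧ IsWeakGradient H W WX WY ∧
        eLpNorm W 2 (layerMeasure H)
          ≤ ENNReal.ofReal C * (eLpNorm G 2 (layerMeasure H) + eLpNorm N 2 volume) ∧
        (∀ φ, IsTest φ → (∑ l, ∫ p, WX l p * partialX l φ p ∂layerMeasure H)
            + ∫ p, WY p * reducedY φ p ∂layerMeasure H
          = ∫ p, G p * reduced φ p ∂layerMeasure H + ∫ X, N X * reduced φ (X, -H X)) ∧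
        ∀ η : ℝ → ℝ, Continuous η → HasCompactSupport η →
          ∫ p, W p * (Ioi (0 : ℝ)).indicator η p.2 ∂layerMeasure H = 0 ∧
          ∫ p, WY p * (Ioi (0 : ℝ)).indicator η p.2 ∂layerMeasure H = 0 := by
  obtain ⟨b, hb⟩ := (isCompact_range hH).bddAbove
  have hb : ∀ X, H X ≤ b := fun X => hb ⟨X, rfl⟩
  have hb0 : 0 ≤ b := (hpos 0).le.trans (hb 0)
  -- Large enough for both the constant b · 2(b+1) + 1 of the L² bound and the constant 2(b+1) of
  -- the trace bound.
  set K : ℝ := b * (2 * (b + 1)) + 2 * (b + 1) with hK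
  have hK0 : 0 ≤ K := by positivity
  have hu : ∀ φ, ‖reducedL hH φ‖ ≤ Real.sqrt K * ‖reducedGradL hH φ‖ := fun φ => by
    refine norm_le_sqrt_mul_of_enorm_sq_le hK0 ?_
    rw [enorm_reducedGradL_sq]
    refine (enorm_toLp_sq (memLp_reduced hH φ.2)).trans_le
      ((lintegral_reduced_le hH hpos φ.2.lift hb).trans ?_)
    gcongr
    linarith
  have hτ : ∀ φ, ‖reducedTraceL hH φ‖ ≤ Real.sqrt K * ‖reducedGradL hH φ‖ := fun φ => by
    refine norm_le_sqrt_mul_of_enorm_sq_le hK0 ?_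
    rw [enorm_reducedGradL_sq]
    refine (enorm_toLp_sq (memLp_reduced_trace hH φ.2)).trans_le
      ((lintegral_trace_le hH hpos φ.2.lift hb).trans ?_)
    gcongr
    nlinarith
  -- One factor √K bounds `F` by the data, the other bounds `w` by `F`.
  refine ⟨Real.sqrt K * Real.sqrt K, by positivity, fun G N hG hN => ?_⟩
  obtain ⟨w, F, hF, hFn, hwn, hcl⟩ := exists_variational_solution (reducedL hH) (reducedGradL hH)
    (reducedTraceL hH) (Real.sqrt_nonneg K) hu hτ hG.toLp hN.toLp
  -- A linear identity between `reduced φ` and one gradient component, valid for all test functions,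
  -- is inherited by (w, F) through `hcl`. It serves both for the weak gradient and for the
  -- vanishing means.
  have hpair : ∀ (f g : UnitAddTorus (Fin d) × ℝ → ℝ) (hf : MemLp f 2 (layerMeasure H))
      (hg : MemLp g 2 (layerMeasure H)) (i : Option (Fin d)),
      (∀ φ, IsTest φ → ∫ p, reduced φ p * f p ∂layerMeasure H
        = -∫ p, reducedGradFun φ i p * g p ∂layerMeasure H) →
      ∫ p, w p * f p ∂layerMeasure H = -∫ p, F i p * g p ∂layerMeasure H := by
    intro f g hf hg i h
    have h1 := hcl (innerSL ℝ hf.toLp)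
      ((innerSL ℝ hg.toLp).comp (PiLp.proj 2 (fun _ => Lp ℝ 2 (layerMeasure H)) i)) (by
        intro φ
        have e1 : (innerSL ℝ hf.toLp) (reducedL hH φ)
            = ∫ p, f p * reduced φ p ∂layerMeasure H :=
          inner_toLp_toLp hf (memLp_reduced hH φ.2)
        have e2 : ((innerSL ℝ hg.toLp).comp (PiLp.proj 2 (fun _ => Lp ℝ 2 (layerMeasure H)) i))
            (reducedGradL hH φ) = ∫ p, g p * reducedGradFun φ i p ∂layerMeasure H :=
          inner_toLp_toLp hg (memLp_reducedGradFun hH φ.2 i)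
        rw [e1, e2]
        have := h φ φ.2
        simp_rw [mul_comm (f _), mul_comm (g _)]
        linarith)
    have e1 : (innerSL ℝ hf.toLp) w = ∫ p, w p * f p ∂layerMeasure H := inner_toLp_left hf w
    have e2 : ((innerSL ℝ hg.toLp).comp (PiLp.proj 2 (fun _ => Lp ℝ 2 (layerMeasure H)) i)) F
      = ∫ p, F i p * g p ∂layerMeasure H := inner_toLp_left hg (F i)
    rw [e1, e2] at h1
    linarith
  refine ⟨w, fun l => F (some l), F none, Lp.memLp w, fun l => Lp.memLp _, Lp.memLp _,
    ⟨fun l ψ hψ hs => ?_, fun ψ hψ hs => ?_⟩, ?_, fun φ hφ => ?_, fun η hη hηc => ⟨?_, ?_⟩⟩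
  · refine hpair _ _ ((hψ.partialX l).memLp_layerMeasure hH 2) (hψ.memLp_layerMeasure hH 2) _ ?_
    intro φ hφ
    rw [integral_layerMeasure_eq, integral_layerMeasure_eq]
    · exact integral_reduced_mul_partialX hφ hψ l
    · intro p hp
      rw [image_eq_zero_of_notMem_tsupport fun h => hp (hs h), mul_zero]
    · intro p hp
      rw [image_eq_zero_of_notMem_tsupport fun h => hp (hs (tsupport_partialX_subset l ψ h)),
        mul_zero]
  · refine hpair _ _ (hψ.partialY.memLp_layerMeasure hH 2) (hψ.memLp_layerMeasure hH 2) _ ?_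
    intro φ hφ
    rw [integral_layerMeasure_eq, integral_layerMeasure_eq]
    · exact integral_reduced_mul_partialY hφ hψ
    · intro p hp
      rw [image_eq_zero_of_notMem_tsupport fun h => hp (hs h), mul_zero]
    · intro p hp
      rw [image_eq_zero_of_notMem_tsupport fun h => hp (hs (tsupport_partialY_subset ψ h)),
        mul_zero]
  · have h1 : ‖w‖ ≤ Real.sqrt K * Real.sqrt K * (‖hG.toLp‖ + ‖hN.toLp‖) := by
      rw [mul_assoc]
      exact hwn.trans (by gcongr)
    rw [← Lp.enorm_def, ← Lp.enorm_toLp hG, ← Lp.enorm_toLp hN, ← ofReal_norm, ← ofReal_norm,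
      ← ofReal_norm, ← ENNReal.ofReal_add (norm_nonneg _) (norm_nonneg _),
      ← ENNReal.ofReal_mul (by positivity)]
    exact ENNReal.ofReal_le_ofReal h1
  · have h1 := hF ⟨φ, hφ⟩
    have e1 : inner ℝ F (reducedGradL hH ⟨φ, hφ⟩)
        = ∑ i, ∫ p, F i p * reducedGradFun φ i p ∂layerMeasure H := by
      rw [PiLp.inner_apply]
      refine Finset.sum_congr rfl fun i _ => ?_
      rw [real_inner_comm]
      exact inner_toLp_left (memLp_reducedGradFun hH hφ i) (F i)
    have e2 : inner ℝ hG.toLp (reducedL hH ⟨φ, hφ⟩)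
        = ∫ p, G p * reduced φ p ∂layerMeasure H := inner_toLp_toLp hG (memLp_reduced hH hφ)
    have e3 : inner ℝ hN.toLp (reducedTraceL hH ⟨φ, hφ⟩)
        = ∫ X, N X * reduced φ (X, -H X) := inner_toLp_toLp hN (memLp_reduced_trace hH hφ)
    rw [e1, e2, e3, Fintype.sum_option, add_comm] at h1
    exact h1
  · have := hpair _ _ (memLp_indicator_snd hH hη hηc 2) (MemLp.zero' (p := 2)) none (fun φ hφ => by
      have h1 := integral_mul_indicator_snd_eq_zero hpos hη hηc hφ.continuous
      simp only [mul_zero, integral_zero, neg_zero]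
      refine Eq.trans ?_ h1
      refine integral_congr_ae (Filter.Eventually.of_forall fun p => ?_)
      by_cases hp : 0 < p.2
      · simp [reduced, max_eq_left hp.le]
      · simp [indicator, hp])
    simpa using this
  · have := hpair _ _ (MemLp.zero' (p := 2)) (memLp_indicator_snd hH hη hηc 2) none (fun φ hφ => by
      have h1 := integral_mul_indicator_snd_eq_zero hpos hη hηc hφ.partialY.continuous
      simp only [mul_zero, integral_zero]
      symm
      rw [neg_eq_zero]
      refine Eq.trans ?_ h1
      refine integral_congr_ae (Filter.Eventually.of_forall fun p => ?_)
      by_cases hp : 0 < p.2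
      · simp [reducedGradFun, reducedY, hp]
      · simp [indicator, hp])
    simpa using this.symm

end Existence

/-! ### Summability over frequencies -/

section Frequencies

variable {d : ℕ}

/-- The decay rate attached to a frequency. -/
def freqRate (j : Fin d → ℤ) : ℝ := max 1 (freqNorm j)

lemma one_le_freqRate (j : Fin d → ℤ) : 1 ≤ freqRate j := le_max_left _ _

lemma abs_le_freqNorm (j : Fin d → ℤ) (l : Fin d) : |(j l : ℝ)| ≤ freqNorm j := by
  rw [freqNorm, ← Real.sqrt_sq_eq_abs]
  exact Real.sqrt_le_sqrt (Finset.single_le_sum (f := fun l => (j l : ℝ) ^ 2)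
    (fun i _ => sq_nonneg _) (Finset.mem_univ l))

lemma freqNorm_nonneg (j : Fin d → ℤ) : 0 ≤ freqNorm j := Real.sqrt_nonneg _

lemma one_le_freqNorm {j : Fin d → ℤ} (hj : j ≠ 0) : 1 ≤ freqNorm j := by
  obtain ⟨l, hl⟩ := Function.ne_iff.1 hj
  refine le_trans ?_ (abs_le_freqNorm j l)
  exact_mod_cast Int.one_le_abs hl

lemma freqRate_of_ne_zero {j : Fin d → ℤ} (hj : j ≠ 0) : freqRate j = freqNorm j :=
  max_eq_right (one_le_freqNorm hj)

lemma freqRate_zero : freqRate (0 : Fin d → ℤ) = 1 := by simp [freqRate, freqNorm]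

/-- The frequencies embed into ℤ² with sup norm at most the Euclidean norm, and the exponent 3
exceeds the dimension 2, as for Eisenstein series. -/
lemma summable_freqRate_inv_cube (hd : d = 1 ∨ d = 2) :
    Summable fun j : Fin d → ℤ => (freqRate j ^ 3)⁻¹ := by
  have h2 := EisensteinSeries.summable_one_div_norm_rpow (k := 3) (by norm_num)
  obtain ⟨ι, hinj, hle⟩ : ∃ ι : (Fin d → ℤ) → (Fin 2 → ℤ), Function.Injective ι ∧
      ∀ j, j ≠ 0 → 0 < ‖ι j‖ ∧ ‖ι j‖ ≤ freqNorm j := by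
    rcases hd with rfl | rfl
    · refine ⟨fun j => ![j 0, 0], fun j k h => ?_, fun j hj => ⟨?_, ?_⟩⟩
      · ext i
        rw [Subsingleton.elim i 0]
        exact congrFun h 0
      · rw [norm_pos_iff]
        intro h
        apply hj
        ext i
        rw [Subsingleton.elim i 0]
        exact congrFun h 0
      · rw [pi_norm_le_iff_of_nonneg (freqNorm_nonneg j)]
        intro i
        fin_cases i
        · simpa [Int.norm_eq_abs] using abs_le_freqNorm j 0
        · simpa using freqNorm_nonneg j
    · refine ⟨id, Function.injective_id, fun j hj => ⟨norm_pos_iff.2 hj, ?_⟩⟩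
      rw [id, pi_norm_le_iff_of_nonneg (freqNorm_nonneg j)]
      intro i
      simpa [Int.norm_eq_abs] using abs_le_freqNorm j i
  -- The second summand accounts for j = 0, where the rate is 1 although the norm vanishes.
  have h3 := (h2.comp_injective hinj).add
    (summable_of_ne_finset_zero (s := {0}) (f := fun j : Fin d → ℤ => if j = 0 then (1 : ℝ) else 0)
      (fun j hj => by simpa using hj))
  refine Summable.of_nonneg_of_le (fun j => ?_) (fun j => ?_) h3
  · have := one_le_freqRate j
    positivity
  · by_cases hj : j = 0
    · subst hj
      simp only [freqRate_zero, Function.comp, if_true]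
      have : 0 ≤ ‖ι 0‖ ^ (-3 : ℝ) := by positivity
      norm_num
    · obtain ⟨h4, h5⟩ := hle j hj
      simp only [Function.comp, hj, if_false, add_zero, freqRate_of_ne_zero hj]
      rw [Real.rpow_neg (norm_nonneg _)]
      norm_cast
      gcongr

lemma exp_neg_le_inv_cube {x : ℝ} (hx : 0 < x) : Real.exp (-x) ≤ 6 * (x ^ 3)⁻¹ := by
  have h := Real.pow_div_factorial_le_exp x hx.le 3
  rw [Real.exp_neg]
  have h3 : (Nat.factorial 3 : ℝ) = 6 := by norm_num [Nat.factorial]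
  rw [h3] at h
  calc (Real.exp x)⁻¹ ≤ (x ^ 3 / 6)⁻¹ := inv_anti₀ (by positivity) h
    _ = _ := by rw [inv_div]; ring

lemma summable_exp_freqRate (hd : d = 1 ∨ d = 2) {c : ℝ} (hc : 0 < c) :
    Summable fun j : Fin d → ℤ => Real.exp (-(c * freqRate j)) := by
  refine Summable.of_nonneg_of_le (fun j => (Real.exp_pos _).le) (fun j => ?_)
    ((summable_freqRate_inv_cube hd).mul_left (6 * (c ^ 3)⁻¹))
  have := one_le_freqRate j
  refine (exp_neg_le_inv_cube (by positivity)).trans_eq ?_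
  rw [mul_pow, mul_inv]; ring

end Frequencies

/-! ### Fourier coefficients of L² functions on slices -/

section Slices

open Set Filter

variable {d : ℕ} {ν : Measure ℝ} [SFinite ν] {f : UnitAddTorus (Fin d) × ℝ → ℝ}

lemma ae_memLp_slice (hf : MemLp f 2 ((volume : Measure (UnitAddTorus (Fin d))).prod ν)) :
    ∀ᵐ Y ∂ν, MemLp (fun X => f (X, Y)) 2 volume := by
  have h1 := hf.aestronglyMeasurable.prod_swap.prodMk_left
  have h2 := hf.integrable_sq.prod_left_ae
  filter_upwards [h1, h2] with Y h3 h4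
  exact (memLp_two_iff_integrable_sq h3).2 h4

lemma aestronglyMeasurable_layerCoeff
    (hf : MemLp f 2 ((volume : Measure (UnitAddTorus (Fin d))).prod ν)) (j : Fin d → ℤ) :
    AEStronglyMeasurable (layerCoeff f j) ν := by
  have h1 : AEStronglyMeasurable (fun q : ℝ × UnitAddTorus (Fin d) =>
      UnitAddTorus.mFourier (-j) q.2 * (f (q.2, q.1) : ℂ)) (ν.prod volume) := by
    refine AEStronglyMeasurable.mul ?_ ?_
    · exact ((UnitAddTorus.mFourier (-j)).continuous.comp continuous_snd).aestronglyMeasurable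
    · exact Complex.continuous_ofReal.comp_aestronglyMeasurable
        hf.aestronglyMeasurable.prod_swap
  have h2 := h1.integral_prod_right'
  refine h2.congr (Eventually.of_forall fun Y => ?_)
  rw [layerCoeff, mFourierCoeff_eq_integral_volume]

lemma ae_hasSum_layerCoeff (hf : MemLp f 2 ((volume : Measure (UnitAddTorus (Fin d))).prod ν)) :
    ∀ᵐ Y ∂ν, HasSum (fun j => ‖layerCoeff f j Y‖ ^ 2) (∫ X, f (X, Y) ^ 2) := by
  filter_upwards [ae_memLp_slice hf] with Y hY
  simpa [layerCoeff] using hasSum_sq_mFourierCoeff_of_memLp hY.ofReal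

lemma integrable_norm_layerCoeff_sq
    (hf : MemLp f 2 ((volume : Measure (UnitAddTorus (Fin d))).prod ν)) (j : Fin d → ℤ) :
    Integrable (fun Y => ‖layerCoeff f j Y‖ ^ 2) ν := by
  refine hf.integrable_sq.integral_prod_right.mono
    ((aestronglyMeasurable_layerCoeff hf j).norm.pow 2) ?_
  filter_upwards [ae_hasSum_layerCoeff hf] with Y hY
  rw [Real.norm_of_nonneg (by positivity), Real.norm_of_nonneg (integral_nonneg fun X => sq_nonneg _)]
  exact le_hasSum hY j fun i _ => by positivity

/-- Parseval on almost every slice, integrated in Y. Finite sets of frequencies avoid exchanging an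
infinite sum with the integral. -/
lemma sum_integral_layerCoeff_le
    (hf : MemLp f 2 ((volume : Measure (UnitAddTorus (Fin d))).prod ν))
    (s : Finset (Fin d → ℤ)) :
    ∑ j ∈ s, ∫ Y, ‖layerCoeff f j Y‖ ^ 2 ∂ν ≤ ∫ p, f p ^ 2 ∂(volume.prod ν) := by
  rw [← integral_finsetSum _ fun j _ => integrable_norm_layerCoeff_sq hf j,
    integral_prod_symm _ hf.integrable_sq]
  refine integral_mono_ae (integrable_finsetSum _ fun j _ => integrable_norm_layerCoeff_sq hf j)
    hf.integrable_sq.integral_prod_right ?_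
  filter_upwards [ae_hasSum_layerCoeff hf] with Y hY
  exact sum_le_hasSum s (fun i _ => by positivity) hY

end Slices

/-! ### Half-cylinders inside the layer -/

section Strip

open Set

variable {d : ℕ} {H : UnitAddTorus (Fin d) → ℝ} {a : ℝ} {f : UnitAddTorus (Fin d) × ℝ → ℝ}

/-- A half-cylinder above the boundary has product structure, so slices and their Fourier
coefficients are available there. -/
lemma prod_restrict_Ioi_le (ha : ∀ X, -H X ≤ a) :
    (volume : Measure (UnitAddTorus (Fin d))).prod (volume.restrict (Ioi a)) ≤ layerMeasure H := by
  have : (volume : Measure (UnitAddTorus (Fin d))).prod ((volume : Measure ℝ).restrict (Ioi a))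
      = volume.restrict (univ ×ˢ Ioi a) := by
    rw [Measure.volume_eq_prod, ← Measure.prod_restrict, Measure.restrict_univ]
  rw [this, layerMeasure]
  exact Measure.restrict_mono (fun p hp => lt_of_le_of_lt (ha p.1) (mem_Ioi.1 (mem_prod.1 hp).2)) le_rfl

lemma MeasureTheory.MemLp.strip {q : ENNReal} (hf : MemLp f q (layerMeasure H))
    (ha : ∀ X, -H X ≤ a) :
    MemLp f q ((volume : Measure (UnitAddTorus (Fin d))).prod (volume.restrict (Ioi a))) :=
  hf.mono_measure (prod_restrict_Ioi_le ha)

lemma integral_layerMeasure_eq_strip (ha : ∀ X, -H X ≤ a) (hf : ∀ p, p.2 ≤ a → f p = 0) :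
    ∫ p, f p ∂layerMeasure H = ∫ p, f p ∂(volume.prod (volume.restrict (Ioi a))) := by
  have : (volume : Measure (UnitAddTorus (Fin d))).prod ((volume : Measure ℝ).restrict (Ioi a))
      = volume.restrict (univ ×ˢ Ioi a) := by
    rw [Measure.volume_eq_prod, ← Measure.prod_restrict, Measure.restrict_univ]
  rw [this, integral_layerMeasure_eq fun p hp => hf p ?_,
    setIntegral_eq_integral_of_forall_compl_eq_zero fun p hp => hf p ?_]
  · by_contra hn
    exact hp ⟨mem_univ _, not_le.1 hn⟩
  · by_contra hn
    exact hp (lt_of_le_of_lt (ha p.1) (not_le.1 hn))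

end Strip

/-! ### Integrals with polynomial-exponential decay -/

section Decay

open Set Filter

/-- The majorant C (1 + t)^n replaces the polynomial from here on: it is increasing for t ≥ 0 and
factors through 1 + t ≤ (1 + Y)(1 + (t - Y)). -/
lemma exists_abs_eval_le (Q : Polynomial ℝ) :
    ∃ C : ℝ, 0 ≤ C ∧ ∃ n : ℕ, ∀ t, 0 ≤ t → |Q.eval t| ≤ C * (1 + t) ^ n := by
  refine ⟨∑ i ∈ Finset.range (Q.natDegree + 1), |Q.coeff i|, by positivity, Q.natDegree,
    fun t ht => ?_⟩
  rw [Polynomial.eval_eq_sum_range, Finset.sum_mul]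
  refine (Finset.abs_sum_le_sum_abs _ _).trans (Finset.sum_le_sum fun i hi => ?_)
  rw [abs_mul, abs_pow, abs_of_nonneg ht]
  gcongr
  calc t ^ i ≤ (1 + t) ^ i := by gcongr; linarith
    _ ≤ (1 + t) ^ Q.natDegree :=
        pow_le_pow_right₀ (by linarith) (Nat.lt_succ_iff.1 (Finset.mem_range.1 hi))

/-- The constant in the bounds on exponential moments. -/
def momentConst (n : ℕ) : ℝ := 2 * (n.factorial * 2 ^ n * Real.exp (1 / 2))

lemma momentConst_nonneg (n : ℕ) : 0 ≤ momentConst n := by unfold momentConst; positivity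

/-- Uses 1 + t ≤ (1 + Y)(1 + (t - Y)) and s^n ≤ n! e^s with s = (1 + t - Y)/2. Half of the unit rate
absorbs the polynomial; the remaining e^{-(t-Y)/2} is integrable with a constant independent of `c`.
-/
lemma one_add_pow_mul_exp_le {n : ℕ} {c Y t : ℝ} (hc : 1 ≤ c) (hY : 0 ≤ Y) (ht : Y ≤ t) :
    (1 + t) ^ n * Real.exp (-(c * t))
      ≤ (n.factorial * 2 ^ n * Real.exp (1 / 2)) * ((1 + Y) ^ n * Real.exp (-(c * Y)))
        * Real.exp (-(1 / 2) * (t - Y)) := by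
  have h1 : (1 + t) ^ n ≤ (1 + Y) ^ n * (1 + (t - Y)) ^ n := by
    rw [← mul_pow]
    have : 0 ≤ t - Y := by linarith
    exact pow_le_pow_left₀ (by linarith) (by nlinarith [mul_nonneg hY this]) n
  have h2 : (1 + (t - Y)) ^ n ≤ n.factorial * 2 ^ n * Real.exp (1 / 2)
      * Real.exp (1 / 2 * (t - Y)) := by
    have h := Real.pow_div_factorial_le_exp ((1 + (t - Y)) / 2) (by linarith) n
    have e : Real.exp ((1 + (t - Y)) / 2) = Real.exp (1 / 2) * Real.exp (1 / 2 * (t - Y)) := by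
      rw [← Real.exp_add]; congr 1; ring
    rw [e, div_pow, div_div, div_le_iff₀ (by positivity)] at h
    calc _ ≤ _ := h
      _ = _ := by ring
  have h3 : Real.exp (-(c * t)) ≤ Real.exp (-(c * Y)) * Real.exp (-(t - Y)) := by
    rw [← Real.exp_add]
    apply Real.exp_le_exp.2
    nlinarith
  calc (1 + t) ^ n * Real.exp (-(c * t))
      ≤ ((1 + Y) ^ n * (n.factorial * 2 ^ n * Real.exp (1 / 2) * Real.exp (1 / 2 * (t - Y))))
        * (Real.exp (-(c * Y)) * Real.exp (-(t - Y))) := by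
        gcongr
        exact h1.trans (by gcongr)
    _ = (n.factorial * 2 ^ n * Real.exp (1 / 2)) * ((1 + Y) ^ n * Real.exp (-(c * Y)))
        * (Real.exp (1 / 2 * (t - Y)) * Real.exp (-(t - Y))) := by ring
    _ = _ := by rw [← Real.exp_add]; congr 2; ring

lemma integrableOn_exp_half (Y : ℝ) :
    IntegrableOn (fun t => Real.exp (-(1 / 2) * (t - Y))) (Ioi Y) := by
  have := (integrableOn_exp_mul_Ioi (a := -(1 / 2)) (by norm_num) Y).mul_const
    (Real.exp (1 / 2 * Y))
  refine this.congr (Eventually.of_forall fun t => ?_)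
  simp only
  rw [← Real.exp_add]; congr 1; ring

lemma integral_exp_half (Y : ℝ) : ∫ t in Ioi Y, Real.exp (-(1 / 2) * (t - Y)) = 2 := by
  have e : ∀ t, Real.exp (-(1 / 2) * (t - Y)) = Real.exp (-(1 / 2) * t) * Real.exp (1 / 2 * Y) :=
    fun t => by rw [← Real.exp_add]; congr 1; ring
  simp_rw [e]
  rw [integral_mul_const, integral_exp_mul_Ioi (by norm_num)]
  have : Real.exp (-(1 / 2) * Y) * Real.exp (1 / 2 * Y) = 1 := by
    rw [← Real.exp_add]; simp
  rw [neg_div, neg_mul, div_mul_eq_mul_div, this]; norm_num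

/-- Integrals over `(Y, ∞)` of functions with polynomial-exponential decay. -/
lemma integrableOn_and_abs_integral_le_of_decay {h : ℝ → ℝ} {C c Y : ℝ} {n : ℕ} (hc : 1 ≤ c)
    (hY : 0 ≤ Y) (hC : 0 ≤ C) (hm : AEStronglyMeasurable h (volume.restrict (Ioi Y)))
    (hb : ∀ᵐ t, Y < t → |h t| ≤ C * (1 + t) ^ n * Real.exp (-(c * t))) :
    IntegrableOn h (Ioi Y) ∧
      |∫ t in Ioi Y, h t| ≤ C * momentConst n * (1 + Y) ^ n * Real.exp (-(c * Y)) := by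
  set K := C * (n.factorial * 2 ^ n * Real.exp (1 / 2)) * ((1 + Y) ^ n * Real.exp (-(c * Y)))
  have hb' : ∀ᵐ t ∂volume.restrict (Ioi Y), ‖h t‖ ≤ K * Real.exp (-(1 / 2) * (t - Y)) := by
    rw [ae_restrict_iff' measurableSet_Ioi]
    filter_upwards [hb] with t ht hYt
    refine (ht hYt).trans ?_
    have := mul_le_mul_of_nonneg_left
      (one_add_pow_mul_exp_le (n := n) hc hY (le_of_lt hYt)) hC
    simp only [K]
    linarith
  have hi := (integrableOn_exp_half Y).const_mul K
  refine ⟨Integrable.mono' hi hm hb', ?_⟩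
  refine (norm_integral_le_of_norm_le hi hb').trans_eq ?_
  rw [integral_const_mul, integral_exp_half]
  simp only [K, momentConst]; ring

lemma one_add_pow_mul_exp_le_exp_half {n : ℕ} {t : ℝ} (ht : 0 ≤ t) :
    (1 + t) ^ n * Real.exp (-t)
      ≤ (n.factorial * 2 ^ n * Real.exp (1 / 2)) * Real.exp (-(1 / 2) * t) := by
  have := one_add_pow_mul_exp_le (n := n) le_rfl le_rfl ht
  simpa using this

end Decay

/-! ### Integrability of the source term -/

section Integrability

open Set Filter

variable {d : ℕ} {H : UnitAddTorus (Fin d) → ℝ} {G : UnitAddTorus (Fin d) × ℝ → ℝ}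

/-- The Fourier coefficients of `G` decay like `C (1 + Y)^n e^{-max(1, ‖j‖) Y}`. -/
def HasFourierDecay (G : UnitAddTorus (Fin d) × ℝ → ℝ) (C : ℝ) (n : ℕ) : Prop :=
  ∀ j : Fin d → ℤ, ∀ᵐ Y ∂(volume : Measure ℝ), 0 < Y →
    ‖layerCoeff G j Y‖ ≤ C * (1 + Y) ^ n * Real.exp (-(freqRate j * Y))

/-- By Parseval the slice norms of G decay almost like e^{-2Y}. The weight e^Y uses up part of this
decay and later upgrades L² to L¹. -/
lemma integrable_mul_exp_of_decay (hd : d = 1 ∨ d = 2) {C : ℝ} {n : ℕ}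
    (hG : MemLp G 2 ((volume : Measure (UnitAddTorus (Fin d))).prod (volume.restrict (Ioi 1))))
    (hdec : HasFourierDecay G C n) :
    Integrable (fun p => Real.exp p.2 * G p ^ 2)
      ((volume : Measure (UnitAddTorus (Fin d))).prod (volume.restrict (Ioi 1))) := by
  have hs := summable_exp_freqRate hd (c := 2) (by norm_num)
  set B := Real.exp 2 * ∑' j : Fin d → ℤ, Real.exp (-(2 * freqRate j)) with hB
  have hB0 : 0 ≤ B := mul_nonneg (Real.exp_pos _).le (tsum_nonneg fun j => (Real.exp_pos _).le)
  have hm : AEStronglyMeasurable (fun p : UnitAddTorus (Fin d) × ℝ => Real.exp p.2 * G p ^ 2)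
      ((volume : Measure (UnitAddTorus (Fin d))).prod (volume.restrict (Ioi 1))) :=
    (Real.continuous_exp.comp continuous_snd).aestronglyMeasurable.mul
      (hG.aestronglyMeasurable.pow 2)
  have hbound : ∀ᵐ Y ∂volume.restrict (Ioi (1 : ℝ)), Real.exp Y * ∫ X, G (X, Y) ^ 2
      ≤ C ^ 2 * B * ((1 + Y) ^ (2 * n) * Real.exp (-Y)) := by
    have h1 : ∀ᵐ Y ∂volume.restrict (Ioi (1 : ℝ)), ∀ j, 0 < Y → ‖layerCoeff G j Y‖
        ≤ C * (1 + Y) ^ n * Real.exp (-(freqRate j * Y)) :=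
      ae_restrict_of_ae (ae_all_iff.2 hdec)
    filter_upwards [h1, ae_hasSum_layerCoeff hG, ae_restrict_mem measurableSet_Ioi]
      with Y hY hsum hY1
    have hY1 : 1 < Y := hY1
    -- With ν the rate of j, (ν - 1)(Y - 1) ≥ 0 gives e^{-2νY} ≤ e^{2-2Y} e^{-2ν}, so the sum over
    -- frequencies separates from Y. This is why the region starts at Y = 1.
    have h2 : ∫ X, G (X, Y) ^ 2 ≤ ∑' j : Fin d → ℤ,
        (C * (1 + Y) ^ n) ^ 2 * Real.exp (2 - 2 * Y) * Real.exp (-(2 * freqRate j)) := by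
      refine hasSum_le (fun j => ?_) hsum (hs.mul_left _).hasSum
      calc ‖layerCoeff G j Y‖ ^ 2
          ≤ (C * (1 + Y) ^ n * Real.exp (-(freqRate j * Y))) ^ 2 := by
            gcongr; exact hY j (by linarith)
        _ = (C * (1 + Y) ^ n) ^ 2 * Real.exp (-(2 * (freqRate j * Y))) := by
            rw [mul_pow, ← Real.exp_nat_mul]; congr 2; push_cast; ring
        _ ≤ (C * (1 + Y) ^ n) ^ 2 * Real.exp (2 - 2 * Y + -(2 * freqRate j)) := by
            gcongr
            have := one_le_freqRate j
            nlinarith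
        _ = _ := by rw [Real.exp_add]; ring
    rw [tsum_mul_left] at h2
    calc Real.exp Y * ∫ X, G (X, Y) ^ 2
        ≤ Real.exp Y * ((C * (1 + Y) ^ n) ^ 2 * Real.exp (2 - 2 * Y)
          * ∑' j : Fin d → ℤ, Real.exp (-(2 * freqRate j))) := by gcongr
      _ = C ^ 2 * (1 + Y) ^ (2 * n) * (Real.exp Y * Real.exp (2 - 2 * Y))
          * ∑' j : Fin d → ℤ, Real.exp (-(2 * freqRate j)) := by ring
      _ = C ^ 2 * (1 + Y) ^ (2 * n) * (Real.exp 2 * Real.exp (-Y))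
          * ∑' j : Fin d → ℤ, Real.exp (-(2 * freqRate j)) := by
          rw [← Real.exp_add, ← Real.exp_add]; congr 3; ring
      _ = _ := by rw [hB]; ring
  rw [integrable_prod_iff' hm]
  constructor
  · filter_upwards [ae_memLp_slice hG] with Y hY
    exact hY.integrable_sq.const_mul _
  · have hi : Integrable (fun Y : ℝ => C ^ 2 * B * ((1 + Y) ^ (2 * n) * Real.exp (-Y)))
        (volume.restrict (Ioi 1)) := by
      refine Integrable.const_mul ?_ _
      have := (integrableOn_and_abs_integral_le_of_decay (C := 1) (c := 1) (Y := 1) (n := 2 * n)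
        (h := fun Y => (1 + Y) ^ (2 * n) * Real.exp (-Y)) le_rfl zero_le_one zero_le_one
        (by fun_prop) (Eventually.of_forall fun t ht => ?_)).1
      · exact this
      · rw [abs_of_nonneg (by have : (0 : ℝ) ≤ 1 + t := by linarith
                              positivity)]
        simp
    refine hi.mono' hm.prod_swap.norm.integral_prod_right' ?_
    filter_upwards [hbound] with Y hY
    rw [Real.norm_of_nonneg (integral_nonneg fun X => norm_nonneg _)]
    refine le_trans (le_of_eq ?_) hY
    rw [← integral_const_mul]
    refine integral_congr_ae (Eventually.of_forall fun X => ?_)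
    exact Real.norm_of_nonneg (by positivity)

/-- The decay of the Fourier coefficients makes `G` integrable. -/
lemma integrable_of_decay (hd : d = 1 ∨ d = 2) (hH : Continuous H) (hpos : ∀ X, 0 < H X)
    {C : ℝ} {n : ℕ} (hG : MemLp G 2 (layerMeasure H)) (hdec : HasFourierDecay G C n) :
    Integrable G (layerMeasure H) := by
  have ha : ∀ X, -H X ≤ (1 : ℝ) := fun X => by linarith [hpos X]
  have hms : MeasurableSet {p : UnitAddTorus (Fin d) × ℝ | p.2 ≤ 1} :=
    measurableSet_le measurable_snd measurable_const
  have h1 : IntegrableOn G {p | p.2 ≤ 1} (layerMeasure H) := by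
    have : IsFiniteMeasure ((layerMeasure H).restrict {p | p.2 ≤ 1}) :=
      ⟨by rw [Measure.restrict_apply_univ]; exact layerMeasure_strip_lt_top hH 1⟩
    exact (hG.restrict _).integrable (by norm_num)
  have h2 : IntegrableOn G {p | p.2 ≤ 1}ᶜ (layerMeasure H) := by
    have hle : (layerMeasure H).restrict {p | p.2 ≤ 1}ᶜ
        ≤ (volume : Measure (UnitAddTorus (Fin d))).prod (volume.restrict (Ioi 1)) := by
      have : (volume : Measure (UnitAddTorus (Fin d))).prod ((volume : Measure ℝ).restrict (Ioi 1))
          = volume.restrict (univ ×ˢ Ioi 1) := by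
        rw [Measure.volume_eq_prod, ← Measure.prod_restrict, Measure.restrict_univ]
      rw [this, layerMeasure, Measure.restrict_restrict hms.compl]
      refine Measure.restrict_mono (fun p hp => ?_) le_rfl
      have h1 : ¬ p.2 ≤ 1 := hp.1
      exact mem_prod.2 ⟨mem_univ _, not_le.1 h1⟩
    have hs := hG.strip ha
    have hexp : Integrable (fun p : UnitAddTorus (Fin d) × ℝ => Real.exp (-p.2))
        ((volume : Measure (UnitAddTorus (Fin d))).prod (volume.restrict (Ioi 1))) := by
      have : Integrable (fun Y : ℝ => Real.exp (-Y)) (volume.restrict (Ioi 1)) :=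
        integrableOn_exp_neg_Ioi 1
      exact this.comp_snd volume
    refine Integrable.mono_measure ?_ hle
    refine ((integrable_mul_exp_of_decay hd hs hdec).add hexp).mono' hs.aestronglyMeasurable
      (Eventually.of_forall fun p => ?_)
    have e1 : Real.exp p.2 * Real.exp (-p.2) = 1 := by rw [← Real.exp_add]; simp
    have e2 := Real.exp_pos p.2
    have e3 := Real.exp_pos (-p.2)
    simp only [Real.norm_eq_abs, Pi.add_apply]
    have h5 : |G p| = Real.exp (-p.2) * (Real.exp p.2 * |G p|) := by
      rw [← mul_assoc, mul_comm (Real.exp (-p.2)), e1, one_mul]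
    -- Here x ≤ x² + 1 with x = e^Y |G|; multiplied by e^{-Y} it reads |G| ≤ e^Y G² + e^{-Y}, a sum
    -- of two integrable functions.
    have h4 : Real.exp p.2 * |G p| ≤ (Real.exp p.2 * |G p|) ^ 2 + 1 := by
      nlinarith [sq_nonneg (Real.exp p.2 * |G p| - 1), sq_nonneg (Real.exp p.2 * |G p|)]
    calc |G p| = Real.exp (-p.2) * (Real.exp p.2 * |G p|) := h5
      _ ≤ Real.exp (-p.2) * ((Real.exp p.2 * |G p|) ^ 2 + 1) := by gcongr
      _ = (Real.exp p.2 * Real.exp (-p.2)) * (Real.exp p.2 * G p ^ 2) + Real.exp (-p.2) := by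
          rw [mul_pow, sq_abs]; ring
      _ = _ := by rw [e1, one_mul]
  have := h1.union h2
  rwa [union_compl_self, integrableOn_univ] at this

end Integrability

/-! ### Integration from infinity -/

section Tail

open Set Filter

/-- The integral of `f` over `(Y, ∞)`. -/
def tailIntegral (f : ℝ → ℝ) (Y : ℝ) : ℝ := ∫ t in Ioi Y, f t

lemma tailIntegral_sub {f : ℝ → ℝ} (hf : Integrable f) (a b : ℝ) :
    tailIntegral f b - tailIntegral f a = ∫ x in a..b, -f x := by
  rw [intervalIntegral.integral_neg, ← intervalIntegral.integral_Ioi_sub_Ioi' hf.integrableOn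
    hf.integrableOn, neg_sub]
  rfl

lemma continuous_tailIntegral {f : ℝ → ℝ} (hf : Integrable f) : Continuous (tailIntegral f) := by
  have : tailIntegral f = fun Y => tailIntegral f 0 + ∫ x in (0 : ℝ)..Y, -f x := by
    ext Y; rw [← tailIntegral_sub hf]; ring
  rw [this]
  exact continuous_const.add (intervalIntegral.continuous_primitive
    (fun a b => hf.neg.intervalIntegrable) 0)

lemma tailIntegral_indicator_of_nonpos (f : ℝ → ℝ) {Y : ℝ} (hY : Y ≤ 0) :
    tailIntegral ((Ioi (0 : ℝ)).indicator f) Y = ∫ t in Ioi (0 : ℝ), f t := by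
  rw [tailIntegral, setIntegral_indicator measurableSet_Ioi, Ioi_inter_Ioi, max_eq_right hY]

/-- The decay rate of the zeroth Fourier mode. -/
def meanDecay (n : ℕ) (Y : ℝ) : ℝ := (1 + max Y 0) ^ n * Real.exp (-max Y 0)

lemma meanDecay_nonneg (n : ℕ) (Y : ℝ) : 0 ≤ meanDecay n Y := by
  have := le_max_right Y 0
  unfold meanDecay; positivity

lemma continuous_meanDecay (n : ℕ) : Continuous (meanDecay n) := by unfold meanDecay; fun_prop

lemma meanDecay_of_pos (n : ℕ) {Y : ℝ} (hY : 0 < Y) :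
    meanDecay n Y = (1 + Y) ^ n * Real.exp (-Y) := by rw [meanDecay, max_eq_left hY.le]

lemma meanDecay_of_nonpos (n : ℕ) {Y : ℝ} (hY : Y ≤ 0) : meanDecay n Y = 1 := by
  rw [meanDecay, max_eq_right hY]; simp

/-- Tail integration preserves this decay class without raising the degree, so it can be iterated.
Extension by zero below 0 makes the tail constant there, in accordance with `meanDecay`. -/
lemma integrable_and_tailIntegral_le {f : ℝ → ℝ} {C : ℝ} {n : ℕ} (hC : 0 ≤ C)
    (hm : AEStronglyMeasurable f (volume.restrict (Ioi 0)))
    (hb : ∀ᵐ t, 0 < t → |f t| ≤ C * meanDecay n t) :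
    Integrable ((Ioi (0 : ℝ)).indicator f) ∧
      ∀ Y, |tailIntegral ((Ioi (0 : ℝ)).indicator f) Y| ≤ C * momentConst n * meanDecay n Y := by
  have hb' : ∀ Y, 0 ≤ Y → ∀ᵐ t, Y < t → |f t| ≤ C * (1 + t) ^ n * Real.exp (-(1 * t)) := by
    intro Y hY
    filter_upwards [hb] with t ht hYt
    have h0 : 0 < t := lt_of_le_of_lt hY hYt
    rw [one_mul, mul_assoc, ← meanDecay_of_pos n h0]
    exact ht h0
  have key := fun (Y : ℝ) (hY : 0 ≤ Y) => integrableOn_and_abs_integral_le_of_decay le_rfl hY hC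
    (hm.mono_set (Ioi_subset_Ioi hY)) (hb' Y hY)
  refine ⟨(integrable_indicator_iff measurableSet_Ioi).2 (key 0 le_rfl).1, fun Y => ?_⟩
  rcases le_or_gt Y 0 with hY | hY
  · rw [tailIntegral_indicator_of_nonpos f hY, meanDecay_of_nonpos n hY]
    simpa using (key 0 le_rfl).2
  · have : tailIntegral ((Ioi (0 : ℝ)).indicator f) Y = ∫ t in Ioi Y, f t := by
      rw [tailIntegral, setIntegral_indicator measurableSet_Ioi, Ioi_inter_Ioi, max_eq_left hY.le]
    rw [this, meanDecay_of_pos n hY, ← mul_assoc]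
    simpa using (key Y hY.le).2

lemma memLp_meanDecay (n : ℕ) (b : ℝ) :
    MemLp (meanDecay n) 2 (volume.restrict (Ioi (-b))) := by
  refine (memLp_two_iff_integrable_sq (continuous_meanDecay n).aestronglyMeasurable).2 ?_
  have h1 : IntegrableOn (fun Y => meanDecay n Y ^ 2) (Ioi 0) := by
    refine (integrableOn_and_abs_integral_le_of_decay (C := 1) (c := 2) (n := 2 * n)
      one_le_two le_rfl zero_le_one ((continuous_meanDecay n).pow 2).aestronglyMeasurable
      (Eventually.of_forall fun t ht => ?_)).1
    rw [Pi.pow_apply, abs_of_nonneg (sq_nonneg _), meanDecay_of_pos n ht, mul_pow, one_mul, ← pow_mul,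
      mul_comm n 2, ← Real.exp_nat_mul]
    apply le_of_eq; congr 2; push_cast; ring
  have h2 : IntegrableOn (fun Y => meanDecay n Y ^ 2) (Icc (-b) 0) :=
    ((continuous_meanDecay n).pow 2).continuousOn.integrableOn_compact isCompact_Icc
  refine (h2.union h1).mono_set fun Y hY => ?_
  rcases le_or_gt Y 0 with h | h
  · exact Or.inl ⟨le_of_lt hY, h⟩
  · exact Or.inr h

end Tail

/-! ### Functions of the vertical coordinate -/

section MeanMode

open Set Filter

variable {d : ℕ} {H : UnitAddTorus (Fin d) → ℝ} {φ : UnitAddTorus (Fin d) × ℝ → ℝ}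

lemma layerMeasure_le_prod {b : ℝ} (hb : ∀ X, H X ≤ b) :
    layerMeasure H ≤ (volume : Measure (UnitAddTorus (Fin d))).prod
      (volume.restrict (Ioi (-b))) := by
  have : (volume : Measure (UnitAddTorus (Fin d))).prod ((volume : Measure ℝ).restrict (Ioi (-b)))
      = volume.restrict (univ ×ˢ Ioi (-b)) := by
    rw [Measure.volume_eq_prod, ← Measure.prod_restrict, Measure.restrict_univ]
  rw [this, layerMeasure]
  refine Measure.restrict_mono (fun p hp => mem_prod.2 ⟨mem_univ _, ?_⟩) le_rfl
  have h1 : -H p.1 < p.2 := hp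
  exact lt_of_le_of_lt (neg_le_neg (hb p.1)) h1

lemma memLp_meanDecay_snd (hH : Continuous H) (n : ℕ) :
    MemLp (fun p : UnitAddTorus (Fin d) × ℝ => meanDecay n p.2) 2 (layerMeasure H) := by
  obtain ⟨b, hb⟩ := (isCompact_range hH).bddAbove
  exact ((memLp_meanDecay n b).comp_snd volume).mono_measure
    (layerMeasure_le_prod fun X => hb ⟨X, rfl⟩)

lemma memLp_snd_of_le_meanDecay (hH : Continuous H) {n : ℕ} {f : ℝ → ℝ} {C : ℝ}
    (hf : Measurable f) (hb : ∀ Y, |f Y| ≤ C * meanDecay n Y) :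
    MemLp (fun p : UnitAddTorus (Fin d) × ℝ => f p.2) 2 (layerMeasure H) := by
  refine ((memLp_meanDecay_snd hH n).const_mul C).of_le
    (hf.comp measurable_snd).aestronglyMeasurable (Eventually.of_forall fun p => ?_)
  exact (hb p.2).trans (le_abs_self _)

/-- The weak gradient of a function of the vertical coordinate. -/
lemma isWeakGradient_snd {u v : ℝ → ℝ} (hv : LocallyIntegrable v) (hu : Continuous u)
    (huv : ∀ a b, u b - u a = ∫ x in a..b, v x) (hvm : Measurable v) {C : ℝ}
    (hC : ∀ x, |v x| ≤ C) :
    IsWeakGradient H (fun p => u p.2) (fun _ _ => 0) (fun p => v p.2) where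
  weakX l φ hφ hs := by
    rw [integral_layerMeasure_eq fun p hp => by
      rw [image_eq_zero_of_notMem_tsupport fun h => hp (hs (tsupport_partialX_subset l φ h)),
        mul_zero]]
    have i1 : Integrable (fun p => u p.2 * partialX l φ p)
        ((volume : Measure (UnitAddTorus (Fin d))).prod volume) :=
      Continuous.integrable_of_hasCompactSupport
        ((hu.comp continuous_snd).mul (hφ.partialX l).continuous) (hφ.partialX l).compact.mul_left
    rw [Measure.volume_eq_prod, integral_prod_symm _ i1]
    simp [integral_const_mul, integral_partialX_slice hφ.lift]
  weakY φ hφ hs := by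
    rw [integral_layerMeasure_eq fun p hp => by
      rw [image_eq_zero_of_notMem_tsupport fun h => hp (hs (tsupport_partialY_subset φ h)),
        mul_zero], integral_layerMeasure_eq fun p hp => by
      rw [image_eq_zero_of_notMem_tsupport fun h => hp (hs h), mul_zero]]
    have i1 : Integrable (fun p => u p.2 * partialY φ p)
        ((volume : Measure (UnitAddTorus (Fin d))).prod volume) :=
      Continuous.integrable_of_hasCompactSupport
        ((hu.comp continuous_snd).mul hφ.partialY.continuous) hφ.partialY.compact.mul_left
    have i2 : Integrable (fun p => v p.2 * φ p)
        ((volume : Measure (UnitAddTorus (Fin d))).prod volume) :=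
      hφ.integrable.bdd_mul (c := C) (hvm.comp measurable_snd).aestronglyMeasurable
        (Eventually.of_forall fun p => hC p.2)
    rw [Measure.volume_eq_prod, integral_prod _ i1, integral_prod _ i2, ← integral_neg]
    refine integral_congr_ae (Eventually.of_forall fun X => ?_)
    exact integral_primitive_mul_deriv hv huv ((hφ.slice_snd X).1.of_le (by simp))
      (hφ.slice_snd X).2

/-- The identity that the zeroth Fourier mode has to satisfy. -/
lemma setIntegral_tailIntegral_mul_deriv {γ ψ : ℝ → ℝ} (hγ : IntegrableOn γ (Ioi 0))
    (hψ : ContDiff ℝ 1 ψ) (hc : HasCompactSupport ψ) :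
    ∫ Y in Ioi (0 : ℝ), tailIntegral ((Ioi (0 : ℝ)).indicator γ) Y * deriv ψ Y
      = ∫ Y in Ioi (0 : ℝ), γ Y * (ψ Y - ψ 0) := by
  set γ' := (Ioi (0 : ℝ)).indicator γ with hγ'
  have hi : Integrable γ' := (integrable_indicator_iff measurableSet_Ioi).2 hγ
  have hg := continuous_tailIntegral hi
  have hdc := hψ.continuous_deriv le_rfl
  have h1 := integral_primitive_mul_deriv hi.neg.locallyIntegrable
    (fun a b => tailIntegral_sub hi a b) hψ hc
  have i1 : Integrable fun Y => tailIntegral γ' Y * deriv ψ Y :=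
    Continuous.integrable_of_hasCompactSupport (hg.mul hdc) hc.deriv.mul_left
  have h2 := integral_add_compl (measurableSet_Ioi (a := (0 : ℝ))) i1
  rw [compl_Ioi] at h2
  -- Below zero the tail is constant, so this half contributes ψ(0) times the total integral of γ.
  have h3 : ∫ Y in Iic (0 : ℝ), tailIntegral γ' Y * deriv ψ Y
      = (∫ t in Ioi (0 : ℝ), γ t) * ψ 0 := by
    rw [← hc.integral_Iic_deriv_eq hψ, ← integral_const_mul]
    refine setIntegral_congr_fun measurableSet_Iic fun Y hY => ?_
    rw [hγ', tailIntegral_indicator_of_nonpos γ hY]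
  obtain ⟨K, hK⟩ := hc.exists_bound_of_continuous hψ.continuous
  have i2 : IntegrableOn (fun Y => γ Y * ψ Y) (Ioi 0) :=
    hγ.mul_bdd (c := K) hψ.continuous.aestronglyMeasurable (Eventually.of_forall hK)
  have h4 : ∫ Y, γ' Y * ψ Y = ∫ Y in Ioi (0 : ℝ), γ Y * ψ Y := by
    rw [← integral_indicator measurableSet_Ioi]
    refine integral_congr_ae (Eventually.of_forall fun Y => ?_)
    by_cases hY : Y ∈ Ioi (0 : ℝ)
    · simp only [hγ', indicator_of_mem hY]
    · simp only [hγ', indicator_of_notMem hY, zero_mul]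
  simp_rw [mul_sub]
  rw [integral_sub i2 (hγ.mul_const _), integral_mul_const, ← h4]
  simp only [Pi.neg_apply, neg_mul, integral_neg, neg_neg] at h1
  linarith

lemma layerCoeff_zero_re {G : UnitAddTorus (Fin d) × ℝ → ℝ} {Y : ℝ}
    (h : Integrable fun X => G (X, Y)) : (layerCoeff G 0 Y).re = ∫ X, G (X, Y) := by
  rw [layerCoeff, mFourierCoeff_ofReal h 0 Y]
  simp [cosMode, UnitAddTorus.mFourier_zero]

lemma contDiff_sliceMean (h : IsTest φ) : ContDiff ℝ 1 (sliceMean φ) := by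
  rw [contDiff_one_iff_deriv]
  refine ⟨fun Y => (hasDerivAt_sliceMean h.lift Y).differentiableAt, ?_⟩
  rw [funext fun Y => (hasDerivAt_sliceMean h.lift Y).deriv]
  exact continuous_sliceMean h.partialY.continuous

end MeanMode

/-! ### The weak solution as variational part plus mean mode -/

section WeakSolution

open Set Filter

variable {d : ℕ} {H : UnitAddTorus (Fin d) → ℝ} {φ : UnitAddTorus (Fin d) × ℝ → ℝ}

lemma MeasureTheory.MemLp.integrable_fun_mul {α : Type*} [MeasurableSpace α] {μ : Measure α}
    {f g : α → ℝ} (hf : MemLp f 2 μ) (hg : MemLp g 2 μ) : Integrable (fun a => f a * g a) μ :=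
  hf.integrable_mul hg

lemma IsWeakGradient.add {S T : UnitAddTorus (Fin d) × ℝ → ℝ}
    {SX TX : Fin d → UnitAddTorus (Fin d) × ℝ → ℝ} {SY TY : UnitAddTorus (Fin d) × ℝ → ℝ}
    (hH : Continuous H) (h : IsWeakGradient H S SX SY) (h' : IsWeakGradient H T TX TY)
    (hS : MemLp S 2 (layerMeasure H)) (hSX : ∀ l, MemLp (SX l) 2 (layerMeasure H))
    (hSY : MemLp SY 2 (layerMeasure H)) (hT : MemLp T 2 (layerMeasure H))
    (hTX : ∀ l, MemLp (TX l) 2 (layerMeasure H)) (hTY : MemLp TY 2 (layerMeasure H)) :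
    IsWeakGradient H (S + T) (fun l => SX l + TX l) (SY + TY) where
  weakX l φ hφ hs := by
    have m := hφ.memLp_layerMeasure hH 2
    have mX := (hφ.partialX l).memLp_layerMeasure hH 2
    simp only [Pi.add_apply, add_mul]
    rw [integral_add (hS.integrable_fun_mul mX) (hT.integrable_fun_mul mX),
      integral_add ((hSX l).integrable_fun_mul m) ((hTX l).integrable_fun_mul m),
      h.weakX l φ hφ hs, h'.weakX l φ hφ hs]
    ring
  weakY φ hφ hs := by
    have m := hφ.memLp_layerMeasure hH 2
    have mY := hφ.partialY.memLp_layerMeasure hH 2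
    simp only [Pi.add_apply, add_mul]
    rw [integral_add (hS.integrable_fun_mul mY) (hT.integrable_fun_mul mY),
      integral_add (hSY.integrable_fun_mul m) (hTY.integrable_fun_mul m),
      h.weakY φ hφ hs, h'.weakY φ hφ hs]
    ring

/-- Because H > 0 the half-space Y > 0 lies in the layer, whose measure is a product there; Fubini
replaces `f` by its slice mean. -/
lemma integral_layerMeasure_indicator_snd {f : UnitAddTorus (Fin d) × ℝ → ℝ}
    (hpos : ∀ X, 0 < H X) {u : ℝ → ℝ}
    (hi : IntegrableOn (fun p => f p * u p.2) {p | 0 < p.2} (layerMeasure H)) :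
    ∫ p, f p * (Ioi (0 : ℝ)).indicator u p.2 ∂layerMeasure H
      = ∫ Y in Ioi (0 : ℝ), sliceMean f Y * u Y := by
  have hsub : {p : UnitAddTorus (Fin d) × ℝ | 0 < p.2} = univ ×ˢ Ioi 0 := by ext p; simp
  have hms : MeasurableSet {p : UnitAddTorus (Fin d) × ℝ | 0 < p.2} :=
    measurableSet_lt measurable_const measurable_snd
  have hr : (layerMeasure H).restrict {p | 0 < p.2}
      = (volume : Measure (UnitAddTorus (Fin d))).prod (volume.restrict (Ioi 0)) := by
    rw [layerMeasure, Measure.restrict_restrict hms, inter_eq_left.2, hsub,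
      Measure.volume_eq_prod, ← Measure.prod_restrict, Measure.restrict_univ]
    exact fun p hp => show -H p.1 < p.2 by linarith [hpos p.1, show (0 : ℝ) < p.2 from hp]
  have e : ∀ p, f p * (Ioi (0 : ℝ)).indicator u p.2
      = {p : UnitAddTorus (Fin d) × ℝ | 0 < p.2}.indicator (fun p => f p * u p.2) p := by
    intro p
    by_cases hp : 0 < p.2 <;> simp [indicator, hp]
  rw [IntegrableOn, hr] at hi
  simp_rw [e]
  rw [integral_indicator hms, hr, integral_prod_symm _ hi]
  simp only [integral_mul_const]
  rfl

/-- Existence of a weak solution, together with a bound depending only on the data and with an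
explicit decay of its horizontal means. -/
theorem exists_weak_solution (hd : d = 1 ∨ d = 2) (hH : Continuous H) (hpos : ∀ X, 0 < H X)
    {C : ℝ} (hC : 0 ≤ C) (n : ℕ) (M : NNReal) :
    ∃ K : ℝ, 0 ≤ K ∧ ∀ (G : UnitAddTorus (Fin d) × ℝ → ℝ) (N : UnitAddTorus (Fin d) → ℝ),
      MemLp G 2 (layerMeasure H) → MemLp N 2 volume →
      eLpNorm G 2 (layerMeasure H) ≤ M → eLpNorm N 2 volume ≤ M →
      (∫ p, G p ∂layerMeasure H) + ∫ X, N X = 0 → HasFourierDecay G C n →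
      ∃ (S : UnitAddTorus (Fin d) × ℝ → ℝ) (SX : Fin d → UnitAddTorus (Fin d) × ℝ → ℝ)
        (SY : UnitAddTorus (Fin d) × ℝ → ℝ) (A : ℝ → ℝ),
        MemLp S 2 (layerMeasure H) ∧ (∀ l, MemLp (SX l) 2 (layerMeasure H)) ∧
        MemLp SY 2 (layerMeasure H) ∧ IsWeakGradient H S SX SY ∧
        (∀ φ, IsTest φ →
          ∫ p, ((∑ l, SX l p * partialX l φ p) + SY p * partialY φ p) ∂layerMeasure H
            = (∫ p, G p * φ p ∂layerMeasure H) + ∫ X, N X * φ (X, -H X)) ∧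
        eLpNorm S 2 (layerMeasure H) ≤ ENNReal.ofReal K ∧ Continuous A ∧
        (∀ Y, |A Y| ≤ K * meanDecay n Y) ∧
        ∀ η : ℝ → ℝ, Continuous η → HasCompactSupport η →
          ∫ p, S p * (Ioi (0 : ℝ)).indicator η p.2 ∂layerMeasure H
            = ∫ Y in Ioi (0 : ℝ), A Y * η Y := by
  obtain ⟨C₀, hC₀, hsol⟩ := exists_reduced_solution hH hpos
  -- One factor `momentConst n` for each of the two integrations from infinity that lead from the
  -- mean of G to `A`.
  set C₁ := C * momentConst n
  set C₂ := C₁ * momentConst n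
  have hm0 := momentConst_nonneg n
  have hC₁ : 0 ≤ C₁ := by positivity
  have hC₂ : 0 ≤ C₂ := by positivity
  set B := eLpNorm (fun p : UnitAddTorus (Fin d) × ℝ => C₂ * meanDecay n p.2) 2 (layerMeasure H)
  have hB : B ≠ ⊤ := ((memLp_meanDecay_snd hH n).const_mul C₂).eLpNorm_ne_top
  refine ⟨max C₂ (C₀ * (M + M) + B.toReal), le_max_of_le_left hC₂,
    fun G N hG hN hGM hNM hcomp hdec => ?_⟩
  obtain ⟨W, WX, WY, hW, hWX, hWY, hWg, hWn, hWe, hW0⟩ := hsol G N hG hN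
  have h0 : ∀ X, -H X ≤ (0 : ℝ) := fun X => by linarith [hpos X]
  have hGs := hG.strip h0
  have hGi := integrable_of_decay hd hH hpos hG hdec
  set γ : ℝ → ℝ := fun t => (layerCoeff G 0 t).re with hγ
  have hγb : ∀ᵐ t, 0 < t → |γ t| ≤ C * meanDecay n t := by
    filter_upwards [hdec 0] with t ht h0t
    refine (Complex.abs_re_le_norm _).trans ((ht h0t).trans_eq ?_)
    rw [freqRate_zero, one_mul, mul_assoc, meanDecay_of_pos n h0t]
  obtain ⟨hγi, hγt⟩ := integrable_and_tailIntegral_le hC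
    (Complex.continuous_re.comp_aestronglyMeasurable (aestronglyMeasurable_layerCoeff hGs 0)) hγb
  have hγI : IntegrableOn γ (Ioi 0) := (integrable_indicator_iff measurableSet_Ioi).1 hγi
  set g := tailIntegral ((Ioi (0 : ℝ)).indicator γ) with hg
  have hgc : Continuous g := continuous_tailIntegral hγi
  obtain ⟨hAi, hAt⟩ := integrable_and_tailIntegral_le hC₁ (f := g) (n := n)
    hgc.aestronglyMeasurable (Eventually.of_forall fun t _ => hγt t)
  set A' := (Ioi (0 : ℝ)).indicator g with hA'
  -- The mean mode: A' = g and g' = -γ for Y > 0, hence -A'' = γ there, and `A` is constant for Y ≤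
  -- 0. The primitive that vanishes at infinity is the square integrable one.
  set A : ℝ → ℝ := fun Y => -tailIntegral A' Y with hA
  have hAc : Continuous A := (continuous_tailIntegral hAi).neg
  have hAA' : ∀ a b, A b - A a = ∫ x in a..b, A' x := fun a b => by
    have := tailIntegral_sub hAi a b
    rw [intervalIntegral.integral_neg] at this
    simp only [hA]; linarith
  have hAb : ∀ Y, |A Y| ≤ C₂ * meanDecay n Y := fun Y => by
    rw [hA, abs_neg]; exact hAt Y
  have hA'm : Measurable A' := hgc.measurable.indicator measurableSet_Ioi
  have hA'b : ∀ Y, |A' Y| ≤ C₁ * meanDecay n Y := fun Y =>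
    (norm_indicator_le_norm_self g Y).trans (hγt Y)
  have hmd : ∀ Y, meanDecay n Y ≤ (n.factorial * 2 ^ n * Real.exp (1 / 2)) := fun Y => by
    refine (one_add_pow_mul_exp_le_exp_half (le_max_right Y 0)).trans ?_
    refine mul_le_of_le_one_right (by positivity) (Real.exp_le_one_iff.2 ?_)
    have := le_max_right Y 0
    linarith
  have mA := memLp_snd_of_le_meanDecay hH hAc.measurable hAb
  have mA' := memLp_snd_of_le_meanDecay hH hA'm hA'b
  have hAg : IsWeakGradient H (fun p => A p.2) (fun _ _ => 0) (fun p => A' p.2) :=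
    isWeakGradient_snd hAi.locallyIntegrable hAc hAA' hA'm
      (fun Y => (hA'b Y).trans (mul_le_mul_of_nonneg_left (hmd Y) hC₁))
  refine ⟨fun p => W p + A p.2, fun l p => WX l p + 0, fun p => WY p + A' p.2, A, hW.add mA,
    fun l => by simpa using hWX l, hWY.add mA',
    hWg.add hH hAg hW hWX hWY mA (fun l => MemLp.zero') mA', fun φ hφ => ?_, ?_, hAc,
    fun Y => (hAb Y).trans (mul_le_mul_of_nonneg_right (le_max_left _ _) (meanDecay_nonneg n Y)),
    fun η hη hηc => ?_⟩
  · have mφ := hφ.memLp_layerMeasure hH 2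
    have mφX := fun l => (hφ.partialX l).memLp_layerMeasure hH 2
    have mφY := hφ.partialY.memLp_layerMeasure hH 2
    have hψ := contDiff_sliceMean hφ
    have hψc := hasCompactSupport_sliceMean hφ
    set ψ := sliceMean φ with hψdef
    have hdψ : deriv ψ = sliceMean (partialY φ) :=
      funext fun Y => (hasDerivAt_sliceMean hφ.lift Y).deriv
    -- ∂_Y φ and `reducedY φ` differ by a function of Y supported in Y > 0, to which `WY` is
    -- orthogonal.
    have e1 : ∫ p, WY p * partialY φ p ∂layerMeasure H
        = ∫ p, WY p * reducedY φ p ∂layerMeasure H := by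
      have h1 := (hW0 _ (continuous_sliceMean hφ.partialY.continuous)
        (hasCompactSupport_sliceMean hφ.partialY)).2
      rw [← add_zero (∫ p, WY p * reducedY φ p ∂layerMeasure H), ← h1,
        ← integral_add (hWY.integrable_fun_mul (memLp_reducedY hH hφ))
        (hWY.integrable_fun_mul (memLp_indicator_snd hH
          (continuous_sliceMean hφ.partialY.continuous)
          (hasCompactSupport_sliceMean hφ.partialY) 2))]
      refine integral_congr_ae (Eventually.of_forall fun p => ?_)
      simp only [reducedY]; ring
    have e2 : ∫ p, A' p.2 * partialY φ p ∂layerMeasure H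
        = ∫ Y in Ioi (0 : ℝ), γ Y * (ψ Y - ψ 0) := by
      have h1 := integral_layerMeasure_indicator_snd (f := partialY φ) (u := g) hpos (by
        refine (mφY.integrable_fun_mul mA').integrableOn.congr_fun (fun p hp => ?_)
          (measurableSet_lt measurable_const measurable_snd)
        simp only [hA']
        rw [indicator_of_mem (show p.2 ∈ Ioi (0 : ℝ) from hp)])
      rw [← setIntegral_tailIntegral_mul_deriv hγI hψ hψc, hdψ]
      simp_rw [mul_comm (A' _), mul_comm (tailIntegral _ _)]
      exact h1
    have hψb : ∀ Y, |ψ Y| ≤ Classical.choose hφ.exists_bound := fun Y =>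
      abs_sliceMean_le (Classical.choose_spec hφ.exists_bound).2 Y
    set Kφ := Classical.choose hφ.exists_bound
    have iGψ : Integrable (fun p => G p * ψ (max p.2 0)) (layerMeasure H) := by
      refine hGi.mul_bdd (c := Kφ) ?_ (Eventually.of_forall fun p => hψb _)
      exact (hψ.continuous.comp (by fun_prop : Continuous fun p : UnitAddTorus (Fin d) × ℝ =>
        max p.2 0)).aestronglyMeasurable
    -- The mean part of φ is ψ(max Y 0). Only its deviation from ψ(0) is matched by the mean mode;
    -- the remainder ψ(0) ∫ G is left for the compatibility condition.
    have e3 : ∫ p, G p * ψ (max p.2 0) ∂layerMeasure H - ψ 0 * ∫ p, G p ∂layerMeasure H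
        = ∫ Y in Ioi (0 : ℝ), γ Y * (ψ Y - ψ 0) := by
      rw [← integral_const_mul, ← integral_sub iGψ (hGi.const_mul _)]
      have iG2 : Integrable (fun p => G p * (ψ (max p.2 0) - ψ 0)) (layerMeasure H) := by
        refine (iGψ.sub (hGi.const_mul (ψ 0))).congr (Eventually.of_forall fun p => ?_)
        simp only [Pi.sub_apply]; ring
      have h1 := integral_layerMeasure_indicator_snd (f := G) (u := fun Y => ψ Y - ψ 0) hpos (by
        refine iG2.integrableOn.congr_fun (fun p hp => ?_)
          (measurableSet_lt measurable_const measurable_snd)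
        simp only [max_eq_left (le_of_lt (show (0 : ℝ) < p.2 from hp))])
      have h2 : ∀ p, G p * ψ (max p.2 0) - ψ 0 * G p
          = G p * (Ioi (0 : ℝ)).indicator (fun Y => ψ Y - ψ 0) p.2 := by
        intro p
        rcases le_or_gt p.2 0 with hp | hp
        · rw [indicator_of_notMem (s := Ioi (0 : ℝ)) (fun h => absurd hp (not_le.2 h)), max_eq_right hp]; ring
        · rw [indicator_of_mem (mem_Ioi.2 hp), max_eq_left hp.le]; ring
      simp_rw [h2]
      rw [h1]
      refine integral_congr_ae ?_
      filter_upwards [ae_memLp_slice hGs] with Y hY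
      rw [hγ]
      simp only
      rw [layerCoeff_zero_re (hY.integrable (by norm_num))]
      rfl
    have e4 : ∫ p, G p * φ p ∂layerMeasure H = ∫ p, G p * reduced φ p ∂layerMeasure H
        + ∫ p, G p * ψ (max p.2 0) ∂layerMeasure H := by
      rw [← integral_add (hG.integrable_fun_mul (memLp_reduced hH hφ)) iGψ]
      refine integral_congr_ae (Eventually.of_forall fun p => ?_)
      simp only [reduced]; ring
    have e5 : ∫ X, N X * φ (X, -H X) = (∫ X, N X * reduced φ (X, -H X)) + ψ 0 * ∫ X, N X := by
      have i1 : Integrable fun X => N X * reduced φ (X, -H X) :=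
        hN.integrable_fun_mul (memLp_reduced_trace hH hφ)
      have i2 : Integrable fun X => ψ 0 * N X := (hN.integrable (by norm_num)).const_mul _
      rw [← integral_const_mul]
      refine Eq.trans ?_ (integral_add i1 i2)
      refine integral_congr_ae (Eventually.of_forall fun X => ?_)
      simp only [reduced, max_eq_right (h0 X)]; ring
    have iX : ∀ l, Integrable (fun p => WX l p * partialX l φ p) (layerMeasure H) :=
      fun l => (hWX l).integrable_fun_mul (mφX l)
    have iY1 : Integrable (fun p => WY p * partialY φ p) (layerMeasure H) :=
      hWY.integrable_fun_mul mφY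
    have iY2 : Integrable (fun p => A' p.2 * partialY φ p) (layerMeasure H) :=
      mA'.integrable_fun_mul mφY
    have iY : Integrable (fun p => WY p * partialY φ p + A' p.2 * partialY φ p)
      (layerMeasure H) := iY1.add iY2
    simp only [add_zero, add_mul]
    rw [integral_add (integrable_finsetSum _ fun l _ => iX l) iY,
      integral_finsetSum _ fun l _ => iX l, integral_add iY1 iY2, e1, e2, e4, e5, ← add_assoc,
      hWe φ hφ, ← e3]
    -- Compatibility cancels the two remaining multiples of ψ(0).
    have : ∫ X, N X = -∫ p, G p ∂layerMeasure H := by linarith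
    rw [this]; ring
  · have h1 : eLpNorm (fun p : UnitAddTorus (Fin d) × ℝ => A p.2) 2 (layerMeasure H) ≤ B :=
      eLpNorm_mono_real fun p => hAb p.2
    refine (eLpNorm_add_le hW.aestronglyMeasurable mA.aestronglyMeasurable one_le_two).trans ?_
    refine le_trans ?_ (ENNReal.ofReal_le_ofReal (le_max_right _ _))
    rw [ENNReal.ofReal_add (by positivity) ENNReal.toReal_nonneg, ENNReal.ofReal_toReal hB,
      ENNReal.ofReal_mul hC₀, ENNReal.ofReal_add (by positivity) (by positivity),
      ENNReal.ofReal_coe_nnreal]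
    exact add_le_add (hWn.trans (by gcongr)) h1
  · have mη := memLp_indicator_snd (d := d) hH hη hηc 2
    simp only [add_mul]
    have i1 : Integrable (fun p => W p * (Ioi (0 : ℝ)).indicator η p.2) (layerMeasure H) :=
      hW.integrable_fun_mul mη
    have i2 : Integrable (fun p => A p.2 * (Ioi (0 : ℝ)).indicator η p.2) (layerMeasure H) :=
      mA.integrable_fun_mul mη
    rw [integral_add i1 i2, (hW0 η hη hηc).1, zero_add]
    have h1 := integral_layerMeasure_indicator_snd (d := d) (f := fun p => A p.2) (u := η) hpos (by
        refine i2.integrableOn.congr_fun (fun p hp => ?_)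
          (measurableSet_lt measurable_const measurable_snd)
        simp only [indicator_of_mem (show p.2 ∈ Ioi (0 : ℝ) from hp)])
    rw [h1]
    simp [sliceMean]

end WeakSolution

/-! ### The ordinary differential equation of a single mode -/

section ModeEquation

open Set Filter

lemma integrableOn_exp_shift {k : ℝ} (hk : 0 < k) (x : ℝ) :
    IntegrableOn (fun t => Real.exp (-(k * (t - x)))) (Ioi x) := by
  have := (integrableOn_exp_mul_Ioi (a := -k) (by linarith) x).mul_const (Real.exp (k * x))
  refine this.congr (Eventually.of_forall fun t => ?_)
  simp only
  rw [← Real.exp_add]; congr 1; ring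

lemma integral_exp_shift {k : ℝ} (hk : 0 < k) (x : ℝ) :
    ∫ t in Ioi x, Real.exp (-(k * (t - x))) = k⁻¹ := by
  have e : ∀ t, Real.exp (-(k * (t - x))) = Real.exp (-k * t) * Real.exp (k * x) :=
    fun t => by rw [← Real.exp_add]; congr 1; ring
  simp_rw [e]
  rw [integral_mul_const, integral_exp_mul_Ioi (by linarith)]
  have : Real.exp (-k * x) * Real.exp (k * x) = 1 := by
    rw [← Real.exp_add]; simp
  rw [neg_div, div_neg, neg_neg, div_mul_eq_mul_div, this, one_div]

lemma memLp_exp_shift {k : ℝ} (hk : 0 < k) (x : ℝ) :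
    MemLp (fun t => Real.exp (-(k * (t - x)))) 2 (volume.restrict (Ioi x)) := by
  refine (memLp_two_iff_integrable_sq (by fun_prop)).2 ?_
  refine (integrableOn_exp_shift (k := 2 * k) (by positivity) x).congr
    (Eventually.of_forall fun t => ?_)
  simp only
  rw [← Real.exp_nat_mul]; congr 1; push_cast; ring

variable {γ : ℝ → ℝ} {k : ℝ}

lemma integrableOn_exp_shift_mul (hk : 0 < k) (hγ : MemLp γ 2) (x : ℝ) :
    IntegrableOn (fun t => Real.exp (-(k * (t - x))) * γ t) (Ioi x) :=
  (memLp_exp_shift hk x).integrable_fun_mul (hγ.restrict _)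

/-- Young's inequality, with weights chosen so that after one more division by k the bound is k⁻³ +
∫γ². Both terms can be summed over frequencies. -/
lemma abs_integral_exp_shift_mul_le (hk : 0 < k) (hγ : MemLp γ 2) (x : ℝ) :
    |∫ t in Ioi x, Real.exp (-(k * (t - x))) * γ t| ≤ (k ^ 2)⁻¹ + k * ∫ t, γ t ^ 2 := by
  have i1 := (integrableOn_exp_shift (k := 2 * k) (by positivity) x).const_mul (k⁻¹ / 2)
  have i2 : IntegrableOn (fun t => k / 2 * γ t ^ 2) (Ioi x) :=
    (hγ.integrable_sq.const_mul _).integrableOn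
  have hb : ∀ t, ‖Real.exp (-(k * (t - x))) * γ t‖
      ≤ k⁻¹ / 2 * Real.exp (-(2 * k * (t - x))) + k / 2 * γ t ^ 2 := by
    intro t
    rw [norm_mul, Real.norm_of_nonneg (Real.exp_pos _).le, Real.norm_eq_abs]
    have e1 : Real.exp (-(2 * k * (t - x))) = Real.exp (-(k * (t - x))) ^ 2 := by
      rw [← Real.exp_nat_mul]; congr 1; push_cast; ring
    rw [e1, ← sq_abs (γ t)]
    set y := Real.exp (-(k * (t - x)))
    have h1 : k⁻¹ / 2 * y ^ 2 + k / 2 * |γ t| ^ 2 - y * |γ t|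
        = k⁻¹ / 2 * (y - k * |γ t|) ^ 2 := by field_simp; ring
    have h2 : 0 ≤ k⁻¹ / 2 * (y - k * |γ t|) ^ 2 := by positivity
    linarith
  refine (norm_integral_le_of_norm_le (i1.add i2) (Eventually.of_forall hb)).trans ?_
  simp only [Pi.add_apply]
  rw [integral_add i1 i2, integral_const_mul, integral_const_mul,
    integral_exp_shift (by positivity)]
  have h3 : ∫ t in Ioi x, γ t ^ 2 ≤ ∫ t, γ t ^ 2 :=
    setIntegral_le_integral hγ.integrable_sq (Eventually.of_forall fun t => sq_nonneg _)
  have h4 : 0 ≤ ∫ t, γ t ^ 2 := integral_nonneg fun t => sq_nonneg _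
  have h5 : k⁻¹ / 2 * (2 * k)⁻¹ = (k ^ 2)⁻¹ / 4 := by field_simp; ring
  have h6 : 0 ≤ (k ^ 2)⁻¹ := by positivity
  rw [h5]
  nlinarith [mul_le_mul_of_nonneg_left h3 hk.le, mul_nonneg hk.le h4]

/-- Square integrable solutions of `s'' = k² s - γ` on a half line. -/
theorem exists_mode_representative {a : ℝ} {s r : ℝ → ℝ} (hk : 0 < k)
    (hs : HasWeakDerivIoi a s r) (hr : HasWeakDerivIoi a r (fun x => k ^ 2 * s x - γ x))
    (hs2 : MemLp s 2) (hr2 : MemLp r 2) (hγ : MemLp γ 2) :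
    ∃ u m : ℝ → ℝ, Continuous u ∧ (∀ᵐ x, x ∈ Ioi a → s x = u x) ∧
      (∀ x, a ≤ x → m x = ∫ t in Ioi x, Real.exp (-(k * (t - x))) * γ t) ∧
      ∀ Y₁ Y, u Y = Real.exp (-(k * (Y - Y₁))) * u Y₁
        + ∫ t in Y₁..Y, Real.exp (-(k * (Y - t))) * m t := by
  set δ : ℝ → ℝ := (Ioi a).indicator fun t => Real.exp (-(k * t)) * γ t with hδ
  have hδi : Integrable δ := by
    refine (integrable_indicator_iff measurableSet_Ioi).2 ?_
    refine ((integrableOn_exp_shift_mul hk hγ a).const_mul (Real.exp (-(k * a)))).congr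
      (Eventually.of_forall fun t => ?_)
    simp only
    rw [← mul_assoc, ← Real.exp_add]; congr 2; ring
  set P := tailIntegral δ with hP
  have hPc : Continuous P := continuous_tailIntegral hδi
  set m : ℝ → ℝ := fun x => Real.exp (k * x) * P x with hm
  have hmc : Continuous m := by fun_prop
  have hmeq : ∀ x, a ≤ x → m x = ∫ t in Ioi x, Real.exp (-(k * (t - x))) * γ t := by
    intro x hx
    rw [hm, hP]
    simp only [tailIntegral]
    rw [hδ, setIntegral_indicator measurableSet_Ioi, Ioi_inter_Ioi, max_eq_left hx,
      ← integral_const_mul]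
    refine integral_congr_ae (Eventually.of_forall fun t => ?_)
    simp only
    rw [← mul_assoc, ← Real.exp_add]; congr 2; ring
  -- For y = r + k s the equation is first order, y' = k y - γ, and e^{-kx} is its integrating
  -- factor.
  have h1 := (hr.add (hs.const_mul k)).mul_exp (-k)
  obtain ⟨c, hc⟩ := h1.exists_ae_eq
  have hc' : ∀ᵐ x, x ∈ Ioi a → r x + k * s x = (c - P a) * Real.exp (k * x) + m x := by
    filter_upwards [hc] with x hx hxa
    have h2 := hx hxa
    have h3 : ∫ t in a..x, (k ^ 2 * s t - γ t + k * r t + -k * (r t + k * s t))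
        * Real.exp (-k * t) = P x - P a := by
      rw [hP, tailIntegral_sub hδi]
      refine intervalIntegral.integral_congr_ae ?_
      refine Eventually.of_forall fun t ht => ?_
      rw [uIoc_of_le (le_of_lt hxa)] at ht
      rw [hδ, indicator_of_mem (mem_Ioi.2 ht.1), neg_mul]; ring
    rw [h3] at h2
    have h4 : Real.exp (-k * x) * Real.exp (k * x) = 1 := by rw [← Real.exp_add]; simp
    calc r x + k * s x = (r x + k * s x) * (Real.exp (-k * x) * Real.exp (k * x)) := by
          rw [h4, mul_one]
      _ = ((r x + k * s x) * Real.exp (-k * x)) * Real.exp (k * x) := by ring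
      _ = _ := by rw [h2, hm]; ring
  -- Otherwise the term in e^{kx} eventually exceeds the bounded function `m` by at least 1, so r +
  -- k s would not be square integrable.
  have hc0 : c - P a = 0 := by
    by_contra hne
    set B := (k ^ 2)⁻¹ + k * ∫ t, γ t ^ 2
    have hev : ∀ᶠ x in atTop, B + 1 ≤ |c - P a| * Real.exp (k * x) :=
      (Tendsto.const_mul_atTop (abs_pos.2 hne) (Real.tendsto_exp_atTop.comp
        (tendsto_id.const_mul_atTop hk))).eventually_ge_atTop _
    obtain ⟨R, hR⟩ := eventually_atTop.1 hev
    set R' := max R a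
    have hsq := (hr2.add (hs2.const_mul k)).integrable_sq.integrableOn (s := Ioi R')
    have hone : IntegrableOn (fun _ : ℝ => (1 : ℝ)) (Ioi R') := by
      refine hsq.mono' aestronglyMeasurable_const ?_
      rw [ae_restrict_iff' measurableSet_Ioi]
      filter_upwards [hc'] with x hx hxR
      have hxR' : R' < x := hxR
      have hxa : a < x := (le_max_right R a).trans_lt hxR'
      have h5 := hR x ((le_max_left R a).trans hxR'.le)
      have h6 : |m x| ≤ B := by rw [hmeq x hxa.le]; exact abs_integral_exp_shift_mul_le hk hγ x
      have h7 : 1 ≤ |r x + k * s x| := by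
        rw [hx hxa]
        have h8 := abs_sub_abs_le_abs_sub ((c - P a) * Real.exp (k * x)) (-m x)
        rw [abs_mul, abs_of_pos (Real.exp_pos _), abs_neg, sub_neg_eq_add] at h8
        linarith
      simp only [norm_one, Pi.add_apply]
      rw [← sq_abs]
      exact one_le_pow₀ h7
    rw [integrableOn_const_iff (by simp)] at hone
    simp at hone
  have hms : ∀ᵐ x, x ∈ Ioi a → r x + k * s x = m x := by
    filter_upwards [hc'] with x hx hxa
    rw [hx hxa, hc0]; ring
  -- What remains is s' + k s = m, with integrating factor e^{kx}; solving it defines the continuous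
  -- representative and gives variation of constants between any two heights.
  have h2 := hs.mul_exp k
  obtain ⟨c₂, hc₂⟩ := h2.exists_ae_eq
  have hmi : ∀ x y, IntervalIntegrable (fun t => Real.exp (k * t) * m t) volume x y := fun x y =>
    Continuous.intervalIntegrable (by fun_prop) _ _
  refine ⟨fun x => Real.exp (-(k * x)) * (c₂ + ∫ t in a..x, Real.exp (k * t) * m t), m, ?_,
    ?_, hmeq, fun Y₁ Y => ?_⟩
  · have := intervalIntegral.continuous_primitive hmi a
    fun_prop
  · filter_upwards [hc₂] with x hx hxa
    have h3 := hx hxa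
    have h4 : ∫ t in a..x, (r t + k * s t) * Real.exp (k * t)
        = ∫ t in a..x, Real.exp (k * t) * m t := by
      refine intervalIntegral.integral_congr_ae ?_
      filter_upwards [hms] with t ht hta
      rw [uIoc_of_le (le_of_lt hxa)] at hta
      rw [ht hta.1, mul_comm]
    rw [h4] at h3
    rw [← h3, mul_left_comm, ← Real.exp_add]; simp
  · have h3 := intervalIntegral.integral_add_adjacent_intervals (hmi a Y₁) (hmi Y₁ Y)
    have h4 : ∫ t in Y₁..Y, Real.exp (-(k * (Y - t))) * m t
        = Real.exp (-(k * Y)) * ∫ t in Y₁..Y, Real.exp (k * t) * m t := by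
      rw [← intervalIntegral.integral_const_mul]
      refine intervalIntegral.integral_congr fun t _ => ?_
      have : -(k * (Y - t)) = -(k * Y) + k * t := by ring
      rw [this, Real.exp_add, mul_assoc]
    beta_reduce
    rw [h4, ← h3, ← mul_assoc, ← Real.exp_add]
    have : -(k * (Y - Y₁)) + -(k * Y₁) = -(k * Y) := by ring
    rw [this]; ring

/-- Bounds for the representative of a mode. -/
theorem abs_mode_le {a h : ℝ} {s u m : ℝ → ℝ} (hk : 0 < k) (hγ : MemLp γ 2) (hs2 : MemLp s 2)
    (hh : 0 < h) (hah : a = -h) (hu : Continuous u)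
    (hsu : ∀ᵐ x, x ∈ Ioi a → s x = u x)
    (hm : ∀ x, a ≤ x → m x = ∫ t in Ioi x, Real.exp (-(k * (t - x))) * γ t)
    (hvar : ∀ Y₁ Y, u Y = Real.exp (-(k * (Y - Y₁))) * u Y₁
        + ∫ t in Y₁..Y, Real.exp (-(k * (Y - t))) * m t) {Y : ℝ} (hY : 0 ≤ Y) :
    |u Y| ≤ Real.exp (-(k * (h / 2))) * (1 + 2 / h * ∫ x, s x ^ 2) + (k ^ 3)⁻¹
      + ∫ t, γ t ^ 2 := by
  set B := (k ^ 2)⁻¹ + k * ∫ t, γ t ^ 2 with hB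
  have hB0 : 0 ≤ B := by
    have : 0 ≤ ∫ t, γ t ^ 2 := integral_nonneg fun t => sq_nonneg _
    positivity
  -- Start from a height in the lower half of (-h, 0): by the time Y ≥ 0 is reached the starting
  -- value is damped by e^{-kh/2}. It is controlled only in mean square, so |x| ≤ 1 + x² prepares an
  -- average over `Y₁`.
  have hstep : ∀ Y₁ ∈ Ioc a (-(h / 2)), |u Y| ≤ Real.exp (-(k * (h / 2))) * (1 + u Y₁ ^ 2)
      + k⁻¹ * B := by
    intro Y₁ hY₁
    have hle : Y₁ ≤ Y := by linarith [hY₁.2]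
    have h1 : |∫ t in Y₁..Y, Real.exp (-(k * (Y - t))) * m t| ≤ k⁻¹ * B := by
      have h2 : ∀ t ∈ Ioc Y₁ Y, ‖Real.exp (-(k * (Y - t))) * m t‖
          ≤ Real.exp (-(k * (Y - t))) * B := fun t ht => by
        rw [norm_mul, Real.norm_of_nonneg (Real.exp_pos _).le]
        gcongr
        have hta : a ≤ t := by linarith [hY₁.1, ht.1]
        rw [hm t hta]
        exact abs_integral_exp_shift_mul_le hk hγ t
      have h3 := intervalIntegral.norm_integral_le_of_norm_le (μ := volume) hle
        (Eventually.of_forall fun t ht => h2 t ht)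
        (Continuous.intervalIntegrable (by fun_prop) _ _)
      refine h3.trans ?_
      rw [intervalIntegral.integral_mul_const]
      gcongr
      have h4 : ∀ t ∈ uIcc Y₁ Y, HasDerivAt (fun t => k⁻¹ * Real.exp (-(k * (Y - t))))
          (Real.exp (-(k * (Y - t)))) t := fun t _ => by
        have h5 : HasDerivAt (fun t => -(k * (Y - t))) k t := by
          have := ((hasDerivAt_id' t).const_mul k).sub_const (k * Y)
          rw [mul_one] at this
          exact this.congr_of_eventuallyEq (Eventually.of_forall fun t => by ring)
        have h6 := (h5.exp).const_mul k⁻¹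
        rwa [mul_comm (Real.exp _) k, inv_mul_cancel_left₀ hk.ne'] at h6
      rw [intervalIntegral.integral_eq_sub_of_hasDerivAt h4
        (Continuous.intervalIntegrable (by fun_prop) _ _)]
      have : 0 ≤ k⁻¹ * Real.exp (-(k * (Y - Y₁))) := by positivity
      simp only [sub_self, mul_zero, neg_zero, Real.exp_zero, mul_one]
      linarith
    rw [hvar Y₁ Y]
    refine (abs_add_le _ _).trans (add_le_add ?_ h1)
    rw [abs_mul, abs_of_pos (Real.exp_pos _)]
    refine mul_le_mul (Real.exp_le_exp.2 ?_) ?_ (abs_nonneg _) (Real.exp_pos _).le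
    · have : h / 2 ≤ Y - Y₁ := by linarith [hY₁.2]
      nlinarith
    · nlinarith [sq_nonneg (|u Y₁| - 1), sq_abs (u Y₁)]
  have hle : a ≤ -(h / 2) := by linarith
  have hlen : -(h / 2) - a = h / 2 := by rw [hah]; ring
  have hint : ∫ Y₁ in a..(-(h / 2)), |u Y| ≤ ∫ Y₁ in a..(-(h / 2)),
      (Real.exp (-(k * (h / 2))) * (1 + u Y₁ ^ 2) + k⁻¹ * B) := by
    rw [intervalIntegral.integral_of_le hle, intervalIntegral.integral_of_le hle]
    refine setIntegral_mono_on (by simp) ?_ measurableSet_Ioc hstep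
    exact (Continuous.intervalIntegrable (by fun_prop) _ _).1
  have hus : ∫ Y₁ in a..(-(h / 2)), u Y₁ ^ 2 ≤ ∫ x, s x ^ 2 := by
    rw [intervalIntegral.integral_of_le hle]
    calc ∫ x in Ioc a (-(h / 2)), u x ^ 2 = ∫ x in Ioc a (-(h / 2)), s x ^ 2 := by
          refine setIntegral_congr_ae measurableSet_Ioc ?_
          filter_upwards [hsu] with x hx hxa
          rw [hx hxa.1]
      _ ≤ _ := setIntegral_le_integral hs2.integrable_sq
          (Eventually.of_forall fun t => sq_nonneg _)
  have hcu2 : IntervalIntegrable (fun x => u x ^ 2) volume a (-(h / 2)) :=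
    Continuous.intervalIntegrable (by fun_prop) _ _
  rw [intervalIntegral.integral_const, intervalIntegral.integral_add
    ((intervalIntegrable_const.add hcu2).const_mul _) intervalIntegrable_const,
    intervalIntegral.integral_const_mul, intervalIntegral.integral_add intervalIntegrable_const
    hcu2, intervalIntegral.integral_const, intervalIntegral.integral_const, hlen,
    smul_eq_mul, smul_eq_mul, smul_eq_mul, mul_one] at hint
  have h7 : h / 2 * |u Y| ≤ Real.exp (-(k * (h / 2))) * (h / 2 + ∫ x, s x ^ 2)
      + h / 2 * (k⁻¹ * B) := by
    refine hint.trans ?_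
    gcongr
  have h8 : |u Y| ≤ 2 / h * (Real.exp (-(k * (h / 2))) * (h / 2 + ∫ x, s x ^ 2)
      + h / 2 * (k⁻¹ * B)) := by
    calc |u Y| = 2 / h * (h / 2 * |u Y|) := by field_simp
      _ ≤ _ := by gcongr
  refine h8.trans_eq ?_
  rw [hB]
  field_simp
  ring

/-- Exponential decay of the representative of a mode. -/
theorem abs_mode_le_of_decay {a ν C : ℝ} {n : ℕ} {u m : ℝ → ℝ} (ha : a ≤ 0) (hν : 1 ≤ ν)
    (hνk : ν ≤ k) (hC : 0 ≤ C) (hγm : AEStronglyMeasurable γ)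
    (hγ : ∀ᵐ t, 0 < t → |γ t| ≤ C * (1 + t) ^ n * Real.exp (-(ν * t)))
    (hm : ∀ x, a ≤ x → m x = ∫ t in Ioi x, Real.exp (-(k * (t - x))) * γ t)
    (hvar : ∀ Y₁ Y, u Y = Real.exp (-(k * (Y - Y₁))) * u Y₁
        + ∫ t in Y₁..Y, Real.exp (-(k * (Y - t))) * m t) {Y : ℝ} (hY : 0 ≤ Y) :
    |u Y| ≤ (|u 0| + C * momentConst n) * (1 + Y) ^ (n + 1) * Real.exp (-(ν * Y)) := by
  have hk : 0 < k := by linarith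
  -- The kernel is at most 1 for t > x, so `m` is dominated by the tail integral of |γ| and keeps
  -- its rate ν.
  have hmb : ∀ x, 0 ≤ x → |m x| ≤ C * momentConst n * (1 + x) ^ n * Real.exp (-(ν * x)) := by
    intro x hx
    rw [hm x (ha.trans hx)]
    have hcont : Continuous fun t : ℝ => Real.exp (-(k * (t - x))) := by fun_prop
    have h := integrableOn_and_abs_integral_le_of_decay (Y := x) (n := n)
      (h := (Ioi x).indicator fun t => Real.exp (-(k * (t - x))) * γ t) hν hx hC
      (((hcont.aestronglyMeasurable).mul hγm).indicator measurableSet_Ioi).restrict (by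
        filter_upwards [hγ] with t ht hxt
        rw [indicator_of_mem (mem_Ioi.2 hxt), abs_mul, abs_of_pos (Real.exp_pos _)]
        refine le_trans (mul_le_of_le_one_left (abs_nonneg _) (Real.exp_le_one_iff.2 ?_))
          (ht (lt_of_le_of_lt hx hxt))
        nlinarith)
    refine le_trans (le_of_eq ?_) h.2
    rw [setIntegral_indicator measurableSet_Ioi, inter_self]
  have hK0 : 0 ≤ C * momentConst n := mul_nonneg hC (momentConst_nonneg n)
  -- Since e^{-ν(Y-t)} e^{-νt} = e^{-νY}, the integrand has a bound independent of t; the length Y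
  -- of the interval costs the extra power of 1 + Y.
  have hint : ‖∫ t in (0 : ℝ)..Y, Real.exp (-(k * (Y - t))) * m t‖
      ≤ C * momentConst n * (1 + Y) ^ n * Real.exp (-(ν * Y)) * |Y - 0| := by
    refine intervalIntegral.norm_integral_le_of_norm_le_const fun t ht => ?_
    rw [uIoc_of_le hY] at ht
    rw [norm_mul, Real.norm_of_nonneg (Real.exp_pos _).le]
    calc Real.exp (-(k * (Y - t))) * ‖m t‖
        ≤ Real.exp (-(ν * (Y - t))) * (C * momentConst n * (1 + Y) ^ n * Real.exp (-(ν * t))) := by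
          have h0 : 0 ≤ Y - t := by linarith [ht.2]
          have h1 : 0 ≤ 1 + t := by linarith [ht.1]
          refine mul_le_mul (Real.exp_le_exp.2 (by nlinarith)) ((hmb t ht.1.le).trans ?_)
            (norm_nonneg _) (Real.exp_pos _).le
          gcongr
          exact ht.2
      _ = C * momentConst n * (1 + Y) ^ n * (Real.exp (-(ν * (Y - t))) * Real.exp (-(ν * t))) := by
          ring
      _ = _ := by rw [← Real.exp_add]; congr 2; ring
  rw [sub_zero, abs_of_nonneg hY] at hint
  have h0 : |Real.exp (-(k * (Y - 0))) * u 0| ≤ Real.exp (-(ν * Y)) * |u 0| := by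
    rw [abs_mul, abs_of_pos (Real.exp_pos _), sub_zero]
    gcongr
  have h1 : (1 : ℝ) ≤ (1 + Y) ^ (n + 1) := one_le_pow₀ (by linarith)
  have h2 : (1 + Y) ^ n * Y ≤ (1 + Y) ^ (n + 1) := by
    rw [pow_succ]; gcongr; linarith
  calc |u Y| ≤ Real.exp (-(ν * Y)) * |u 0|
        + C * momentConst n * (1 + Y) ^ n * Real.exp (-(ν * Y)) * Y := by
        rw [hvar 0 Y]
        exact (abs_add_le _ _).trans (add_le_add h0 hint)
    _ = Real.exp (-(ν * Y)) * |u 0| * 1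
        + C * momentConst n * Real.exp (-(ν * Y)) * ((1 + Y) ^ n * Y) := by ring
    _ ≤ Real.exp (-(ν * Y)) * |u 0| * (1 + Y) ^ (n + 1)
        + C * momentConst n * Real.exp (-(ν * Y)) * (1 + Y) ^ (n + 1) := by gcongr
    _ = _ := by ring

end ModeEquation

/-! ### From the weak formulation to the mode equations -/

section FourierModes

open Set Filter

variable {d : ℕ} {H : UnitAddTorus (Fin d) → ℝ} {j : Fin d → ℤ}
  {e e' : UnitAddTorus (Fin d) × ℝ → ℝ}

/-- A real Fourier mode `e` of frequency `j` with its conjugate mode `e'`. -/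
structure IsFourierMode (j : Fin d → ℤ) (e e' : UnitAddTorus (Fin d) × ℝ → ℝ) : Prop where
  smooth : SmoothLift e
  smooth' : SmoothLift e'
  partialX : ∀ l p, partialX l e p = 2 * Real.pi * j l * e' p
  partialX' : ∀ l p, _root_.partialX l e' p = -(2 * Real.pi * j l) * e p
  const : ∀ X Y Z, e (X, Y) = e (X, Z)
  abs_le : ∀ p, |e p| ≤ 1

lemma isFourierMode_cosMode (j : Fin d → ℤ) :
    IsFourierMode j (cosMode j) (fun p => -sinMode j p) where
  smooth := smoothLift_cosMode j
  smooth' := by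
    have := (smoothLift_sinMode j).const_smul (-1)
    convert this using 1
    ext p; simp
  partialX l p := by rw [partialX_cosMode]; ring
  partialX' l p := by
    have : (fun p => -sinMode j p) = (-1 : ℝ) • sinMode j := by ext p; simp
    rw [this, (smoothLift_sinMode j).partialX_const_smul, Pi.smul_apply, partialX_sinMode,
      smul_eq_mul]
    ring
  const X Y Z := rfl
  abs_le := abs_cosMode_le j

lemma isFourierMode_sinMode (j : Fin d → ℤ) : IsFourierMode j (sinMode j) (cosMode j) where
  smooth := smoothLift_sinMode j
  smooth' := smoothLift_cosMode j
  partialX l p := by rw [partialX_sinMode]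
  partialX' l p := by rw [partialX_cosMode]; try ring
  const X Y Z := rfl
  abs_le := abs_sinMode_le j

lemma isTest_snd_mul {ψ : ℝ → ℝ} (hψ : ContDiff ℝ ∞ ψ) (hc : HasCompactSupport ψ)
    (he : SmoothLift e) : IsTest (fun p => ψ p.2 * e p) where
  smooth := (SmoothLift.of_snd hψ).mul he
  compact := HasCompactSupport.intro (isCompact_univ.prod hc.isCompact) fun p hp => by
    rw [image_eq_zero_of_notMem_tsupport fun h => hp ⟨mem_univ _, h⟩, zero_mul]

lemma tsupport_snd_mul_subset {ψ : ℝ → ℝ} {a : ℝ} (ha : ∀ X, -H X ≤ a) (hs : tsupport ψ ⊆ Ioi a) :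
    tsupport (fun p : UnitAddTorus (Fin d) × ℝ => ψ p.2 * e p) ⊆ layerDomain H := by
  have h1 : tsupport (fun p : UnitAddTorus (Fin d) × ℝ => ψ p.2 * e p)
      ⊆ Prod.snd ⁻¹' tsupport ψ := by
    refine closure_minimal (fun p hp => subset_tsupport ψ fun h => hp ?_)
      ((isClosed_tsupport ψ).preimage continuous_snd)
    simp only; rw [h, zero_mul]
  intro p hp
  exact lt_of_le_of_lt (ha p.1) (hs (h1 hp))

lemma partialX_snd_mul (ψ : ℝ → ℝ) (l : Fin d) (p : UnitAddTorus (Fin d) × ℝ) :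
    partialX l (fun p => ψ p.2 * e p) p = ψ p.2 * partialX l e p := by
  simp only [partialX]
  exact deriv_const_mul_field _

lemma IsFourierMode.partialY_snd_mul (h : IsFourierMode j e e') (ψ : ℝ → ℝ)
    (p : UnitAddTorus (Fin d) × ℝ) :
    _root_.partialY (fun p => ψ p.2 * e p) p = deriv ψ p.2 * e p := by
  simp only [_root_.partialY]
  simp_rw [fun t => h.const p.1 t p.2]
  exact deriv_mul_const_field _

/-- The coefficient of `u` with respect to the mode `e`, extended by zero below `a`. -/
def modeCoeff (a : ℝ) (e u : UnitAddTorus (Fin d) × ℝ → ℝ) : ℝ → ℝ :=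
  (Ioi a).indicator fun Y => ∫ X, u (X, Y) * e (X, Y)

variable {a : ℝ} {u : UnitAddTorus (Fin d) × ℝ → ℝ}

/-- Jensen's inequality on the probability space 𝕋^d together with |e| ≤ 1. Extension by zero below
`a` gives functions on the whole line, as the one-dimensional results require. -/
lemma memLp_modeCoeff (ha : ∀ X, -H X ≤ a) (hu : MemLp u 2 (layerMeasure H))
    (he : IsFourierMode j e e') : MemLp (modeCoeff a e u) 2 ∧
      ∫ Y, modeCoeff a e u Y ^ 2 ≤ ∫ p, u p ^ 2 ∂layerMeasure H := by
  have hs := hu.strip ha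
  have hm : MemLp (fun p => u p * e p) 2
      ((volume : Measure (UnitAddTorus (Fin d))).prod (volume.restrict (Ioi a))) := by
    refine hs.of_le (hs.aestronglyMeasurable.mul he.smooth.continuous.aestronglyMeasurable)
      (Eventually.of_forall fun p => ?_)
    rw [norm_mul]
    exact mul_le_of_le_one_right (norm_nonneg _) (he.abs_le p)
  have hmeas : AEStronglyMeasurable (fun Y => ∫ X, u (X, Y) * e (X, Y))
      (volume.restrict (Ioi a)) :=
    hm.aestronglyMeasurable.prod_swap.integral_prod_right'
  have hpt : ∀ᵐ Y ∂volume.restrict (Ioi a), (∫ X, u (X, Y) * e (X, Y)) ^ 2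
      ≤ ∫ X, u (X, Y) ^ 2 := by
    filter_upwards [ae_memLp_slice hm, ae_memLp_slice hs] with Y h1 h2
    have h3 : (∫ X, u (X, Y) * e (X, Y)) ^ 2 ≤ ∫ X, (u (X, Y) * e (X, Y)) ^ 2 := by
      have := ConvexOn.map_integral_le (μ := (volume : Measure (UnitAddTorus (Fin d))))
        (f := fun X => u (X, Y) * e (X, Y)) (even_two.convexOn_pow (𝕜 := ℝ))
        (by fun_prop) isClosed_univ (by simp) (h1.integrable (by norm_num)) h1.integrable_sq
      exact this
    refine h3.trans (integral_mono h1.integrable_sq h2.integrable_sq fun X => ?_)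
    simp only
    rw [mul_pow]
    refine mul_le_of_le_one_right (sq_nonneg _) ?_
    rw [← sq_abs]
    exact pow_le_one₀ (abs_nonneg _) (he.abs_le _)
  have hsq : IntegrableOn (fun Y => (∫ X, u (X, Y) * e (X, Y)) ^ 2) (Ioi a) := by
    refine hs.integrable_sq.integral_prod_right.mono' (hmeas.pow 2) ?_
    filter_upwards [hpt] with Y hY
    rwa [Real.norm_of_nonneg (sq_nonneg _)]
  constructor
  · exact (memLp_indicator_iff_restrict measurableSet_Ioi).2
      ((memLp_two_iff_integrable_sq hmeas).2 hsq)
  · have e1 : ∀ Y, modeCoeff a e u Y ^ 2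
        = (Ioi a).indicator (fun Y => (∫ X, u (X, Y) * e (X, Y)) ^ 2) Y := fun Y => by
      by_cases hY : Y ∈ Ioi a
      · simp only [modeCoeff, indicator_of_mem hY]
      · simp only [modeCoeff, indicator_of_notMem hY]; norm_num
    simp_rw [e1]
    rw [integral_indicator measurableSet_Ioi]
    refine (integral_mono_ae hsq hs.integrable_sq.integral_prod_right hpt).trans ?_
    have h5 := integral_prod_symm _ hs.integrable_sq
    rw [← h5]
    exact integral_mono_measure (prod_restrict_Ioi_le ha)
      (Eventually.of_forall fun p => sq_nonneg _) hu.integrable_sq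

/-- Fubini on the half-cylinder; testing with products η(Y) e(X) turns integrals over the layer into
one-dimensional ones. -/
lemma integral_mul_snd_mode (ha : ∀ X, -H X ≤ a) (hu : MemLp u 2 (layerMeasure H))
    (he : SmoothLift e) (hb : ∀ p, |e p| ≤ 1) {η : ℝ → ℝ} (hη : Continuous η)
    (hc : HasCompactSupport η) (hs : tsupport η ⊆ Ioi a) :
    ∫ p, u p * (η p.2 * e p) ∂layerMeasure H = ∫ Y, modeCoeff a e u Y * η Y := by
  rw [integral_layerMeasure_eq_strip ha]
  · have hm : MemLp (fun p : UnitAddTorus (Fin d) × ℝ => η p.2 * e p) 2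
        ((volume : Measure (UnitAddTorus (Fin d))).prod (volume.restrict (Ioi a))) := by
      have h1 : MemLp η 2 (volume.restrict (Ioi a)) :=
        (hη.memLp_of_hasCompactSupport hc).restrict _
      refine (h1.comp_snd volume).of_le ((h1.comp_snd volume).aestronglyMeasurable.mul
        he.continuous.aestronglyMeasurable) (Eventually.of_forall fun p => ?_)
      rw [norm_mul]
      exact mul_le_of_le_one_right (norm_nonneg _) (hb p)
    rw [integral_prod_symm _ ((hu.strip ha).integrable_fun_mul hm),
      ← integral_indicator measurableSet_Ioi]
    refine integral_congr_ae (Eventually.of_forall fun Y => ?_)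
    simp only [modeCoeff]
    by_cases hY : Y ∈ Ioi a
    · rw [indicator_of_mem hY, indicator_of_mem hY, ← integral_mul_const]
      congr 1; ext X; ring
    · rw [indicator_of_notMem hY, indicator_of_notMem hY, zero_mul]
  · intro p hp
    rw [image_eq_zero_of_notMem_tsupport fun h => absurd hp (not_le.2 (hs h)), zero_mul, mul_zero]

variable {S SY G : UnitAddTorus (Fin d) × ℝ → ℝ} {SX : Fin d → UnitAddTorus (Fin d) × ℝ → ℝ}
  {N : UnitAddTorus (Fin d) → ℝ}

lemma hasWeakDerivIoi_modeCoeff (ha : ∀ X, -H X ≤ a) (he : IsFourierMode j e e')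
    (hS : MemLp S 2 (layerMeasure H)) (hSY : MemLp SY 2 (layerMeasure H))
    (hg : IsWeakGradient H S SX SY) :
    HasWeakDerivIoi a (modeCoeff a e S) (modeCoeff a e SY) where
  left := (memLp_modeCoeff ha hS he).1.locallyIntegrable (by norm_num)
  right := (memLp_modeCoeff ha hSY he).1.locallyIntegrable (by norm_num)
  weak ψ hψ hc hs := by
    have h1 := hg.weakY _ (isTest_snd_mul hψ hc he.smooth) (tsupport_snd_mul_subset ha hs)
    simp_rw [he.partialY_snd_mul] at h1
    rwa [integral_mul_snd_mode ha hS he.smooth he.abs_le (hψ.continuous_deriv (by simp)) hc.deriv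
      ((tsupport_deriv_subset).trans hs),
      integral_mul_snd_mode ha hSY he.smooth he.abs_le hψ.continuous hc hs] at h1

/-- The equation is tested with ψ(Y) e(X). Its horizontal derivatives are 2π j_l ψ e', and testing
the weak gradient with ψ e' brings back S with a second factor 2π j_l; the sum over l gives
(2π‖j‖)². Supports above `a` miss the boundary, so N drops out. -/
lemma hasWeakDerivIoi_modeCoeff_snd (hH : Continuous H) (ha : ∀ X, -H X ≤ a)
    (he : IsFourierMode j e e')
    (hS : MemLp S 2 (layerMeasure H)) (hSX : ∀ l, MemLp (SX l) 2 (layerMeasure H))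
    (hSY : MemLp SY 2 (layerMeasure H)) (hG : MemLp G 2 (layerMeasure H))
    (hg : IsWeakGradient H S SX SY)
    (hw : ∀ φ, IsTest φ →
      ∫ p, ((∑ l, SX l p * partialX l φ p) + SY p * partialY φ p) ∂layerMeasure H
        = (∫ p, G p * φ p ∂layerMeasure H) + ∫ X, N X * φ (X, -H X)) :
    HasWeakDerivIoi a (modeCoeff a e SY)
      (fun Y => (2 * Real.pi * freqNorm j) ^ 2 * modeCoeff a e S Y - modeCoeff a e G Y) where
  left := (memLp_modeCoeff ha hSY he).1.locallyIntegrable (by norm_num)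
  right := (((memLp_modeCoeff ha hS he).1.const_mul _).sub
    (memLp_modeCoeff ha hG he).1).locallyIntegrable (by norm_num)
  weak ψ hψ hc hs := by
    have hdc := hψ.continuous_deriv (by simp)
    have hds : tsupport (deriv ψ) ⊆ Ioi a := (tsupport_deriv_subset).trans hs
    have ht := isTest_snd_mul hψ hc he.smooth
    have ht' := isTest_snd_mul hψ hc he.smooth'
    have hX : ∀ l, ∫ p, SX l p * (ψ p.2 * e' p) ∂layerMeasure H
        = 2 * Real.pi * j l * ∫ Y, modeCoeff a e S Y * ψ Y := fun l => by
      have h1 := hg.weakX l _ ht' (tsupport_snd_mul_subset ha hs)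
      simp_rw [partialX_snd_mul, he.partialX'] at h1
      have h2 : ∀ p : UnitAddTorus (Fin d) × ℝ, S p * (ψ p.2 * (-(2 * Real.pi * j l) * e p))
          = -(2 * Real.pi * j l) * (S p * (ψ p.2 * e p)) := fun p => by ring
      simp_rw [h2] at h1
      rw [integral_const_mul,
        integral_mul_snd_mode ha hS he.smooth he.abs_le hψ.continuous hc hs] at h1
      linarith
    have h1 := hw _ ht
    have hb : ∀ X, ψ (-H X) = 0 := fun X =>
      image_eq_zero_of_notMem_tsupport fun h => absurd (ha X) (not_le.2 (hs h))
    simp_rw [partialX_snd_mul, he.partialX, he.partialY_snd_mul, hb, zero_mul, mul_zero,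
      integral_zero, add_zero] at h1
    have iX : ∀ l, Integrable (fun p => SX l p * (ψ p.2 * (2 * Real.pi * j l * e' p)))
        (layerMeasure H) := fun l => by
      refine (((hSX l).integrable_fun_mul (ht'.memLp_layerMeasure hH 2)).const_mul
        (2 * Real.pi * j l)).congr (Eventually.of_forall fun p => ?_)
      simp only; ring
    have iY : Integrable (fun p => SY p * (deriv ψ p.2 * e p)) (layerMeasure H) := by
      have := hSY.integrable_fun_mul (ht.partialY.memLp_layerMeasure hH 2)
      simpa only [he.partialY_snd_mul] using this
    rw [integral_add (integrable_finsetSum _ fun l _ => iX l) iY,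
      integral_finsetSum _ fun l _ => iX l,
      integral_mul_snd_mode ha hSY he.smooth he.abs_le hdc hc.deriv hds,
      integral_mul_snd_mode ha hG he.smooth he.abs_le hψ.continuous hc hs] at h1
    have h3 : ∀ l, ∫ p, SX l p * (ψ p.2 * (2 * Real.pi * j l * e' p)) ∂layerMeasure H
        = (2 * Real.pi) ^ 2 * (j l : ℝ) ^ 2 * ∫ Y, modeCoeff a e S Y * ψ Y := fun l => by
      have h2 : ∀ p, SX l p * (ψ p.2 * (2 * Real.pi * j l * e' p))
          = 2 * Real.pi * j l * (SX l p * (ψ p.2 * e' p)) := fun p => by ring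
      simp_rw [h2]
      rw [integral_const_mul, hX l]; ring
    simp_rw [h3] at h1
    rw [← Finset.sum_mul, ← Finset.mul_sum] at h1
    have hf : (2 * Real.pi * freqNorm j) ^ 2 = (2 * Real.pi) ^ 2 * ∑ l, (j l : ℝ) ^ 2 := by
      rw [mul_pow, freqNorm, Real.sq_sqrt (Finset.sum_nonneg fun l _ => sq_nonneg _)]
    rw [← hf] at h1
    have mψ : MemLp ψ 2 := hψ.continuous.memLp_of_hasCompactSupport hc
    have i1 := ((memLp_modeCoeff ha hS he).1.integrable_fun_mul mψ).const_mul
      ((2 * Real.pi * freqNorm j) ^ 2)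
    have i2 := (memLp_modeCoeff ha hG he).1.integrable_fun_mul mψ
    simp_rw [sub_mul, mul_assoc ((2 * Real.pi * freqNorm j) ^ 2)]
    rw [integral_sub i1 i2, integral_const_mul]
    linarith

end FourierModes

/-! ### Absolutely convergent Fourier series on slices -/

section FourierSeries

open Set Filter UnitAddTorus

variable {d : ℕ}

lemma mFourierCoeff_mFourier (j k : Fin d → ℤ) :
    mFourierCoeff (fun X => mFourier k X) j = if j = k then 1 else 0 := by
  have h1 := mFourierBasis_repr (mFourierLp (d := Fin d) 2 k) j
  have h2 : mFourierLp (d := Fin d) 2 k = mFourierBasis k := by rw [coe_mFourierBasis]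
  have h3 : mFourierCoeff (mFourierLp (d := Fin d) 2 k) j
      = mFourierCoeff (fun X => mFourier k X) j :=
    integral_congr_ae ((coeFn_mFourierLp 2 k).mono fun X hX => by simp only [hX])
  rw [← h3, ← h1, h2, HilbertBasis.repr_self, lp.single_apply]
  by_cases h : j = k
  · subst h; simp
  · simp [h]

lemma norm_mFourier_apply (j : Fin d → ℤ) (X : UnitAddTorus (Fin d)) : ‖mFourier j X‖ ≤ 1 :=
  ((mFourier j).norm_coe_le_norm X).trans_eq mFourier_norm

/-- The Fourier coefficients of an absolutely convergent Fourier series. -/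
lemma mFourierCoeff_tsum {v : (Fin d → ℤ) → ℂ} (hv : Summable fun k => ‖v k‖) (j : Fin d → ℤ) :
    mFourierCoeff (fun X => ∑' k, v k * mFourier k X) j = v j := by
  have hb : ∀ k X, ‖mFourier (-j) X * (v k * mFourier k X)‖ ≤ ‖v k‖ := fun k X => by
    rw [norm_mul, norm_mul]
    calc _ ≤ 1 * (‖v k‖ * 1) := by
          gcongr
          · exact norm_mFourier_apply _ _
          · exact norm_mFourier_apply _ _
      _ = _ := by ring
  have hc : ∀ k, Continuous fun X => mFourier (-j) X * (v k * mFourier k X) := fun k => by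
    fun_prop
  have hi : ∀ k, Integrable fun X => mFourier (-j) X * (v k * mFourier k X) := fun k =>
    (hc k).integrable_of_hasCompactSupport (HasCompactSupport.of_compactSpace _)
  have hs : Summable fun k => ∫ X, ‖mFourier (-j) X * (v k * mFourier k X)‖ := by
    refine Summable.of_nonneg_of_le (fun k => integral_nonneg fun X => norm_nonneg _)
      (fun k => ?_) hv
    refine (integral_mono (hi k).norm (integrable_const ‖v k‖) (hb k)).trans_eq ?_
    simp
  rw [mFourierCoeff_eq_integral_volume]
  simp_rw [← tsum_mul_left]
  rw [← integral_tsum_of_summable_integral_norm hi hs, tsum_eq_single j]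
  · simp_rw [mul_left_comm _ (v j)]
    rw [integral_const_mul, ← mFourierCoeff_eq_integral_volume, mFourierCoeff_mFourier]
    simp
  · intro k hk
    simp_rw [mul_left_comm _ (v k)]
    rw [integral_const_mul, ← mFourierCoeff_eq_integral_volume, mFourierCoeff_mFourier,
      if_neg hk.symm, mul_zero]

variable {v : (Fin d → ℤ) → ℝ → ℂ} {β : (Fin d → ℤ) → ℝ}

/-- The real part of a Fourier series with coefficients `v j Y`. -/
def seriesFun (v : (Fin d → ℤ) → ℝ → ℂ) (p : UnitAddTorus (Fin d) × ℝ) : ℝ :=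
  (∑' j, v j p.2 * mFourier j p.1).re

lemma norm_mul_mFourier_le (j : Fin d → ℤ) (z : ℂ) (X : UnitAddTorus (Fin d)) :
    ‖z * mFourier j X‖ ≤ ‖z‖ := by
  rw [norm_mul]
  exact mul_le_of_le_one_right (norm_nonneg _) (norm_mFourier_apply j X)

lemma continuousOn_seriesFun (hβ : Summable β) (hv : ∀ j, ContinuousOn (v j) (Ioi 0))
    (hb : ∀ j, ∀ Y, 0 < Y → ‖v j Y‖ ≤ β j) :
    ContinuousOn (seriesFun v) {p : UnitAddTorus (Fin d) × ℝ | 0 < p.2} := by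
  refine Complex.continuous_re.comp_continuousOn (continuousOn_tsum (fun j => ?_) hβ
    fun j p hp => (norm_mul_mFourier_le j _ _).trans (hb j p.2 hp))
  exact ((hv j).comp continuousOn_snd fun p hp => hp).mul
    ((mFourier j).continuous.comp continuous_fst).continuousOn

lemma continuous_series_slice (hβ : Summable β) {Y : ℝ} (hb : ∀ j, ‖v j Y‖ ≤ β j) :
    Continuous fun X => ∑' j, v j Y * mFourier j X :=
  continuous_tsum (fun j => by fun_prop) hβ fun j X => (norm_mul_mFourier_le j _ _).trans (hb j)

lemma abs_seriesFun_le {p : UnitAddTorus (Fin d) × ℝ} {β : (Fin d → ℤ) → ℝ} (hβ : Summable β)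
    (hb : ∀ j, ‖v j p.2‖ ≤ β j) : |seriesFun v p| ≤ ∑' j, β j :=
  (Complex.abs_re_le_norm _).trans (tsum_of_norm_bounded hβ.hasSum fun j =>
    (norm_mul_mFourier_le j _ _).trans (hb j))

lemma freqNorm_neg (j : Fin d → ℤ) : freqNorm (-j) = freqNorm j := by simp [freqNorm]

/-- `seriesFun` is a real part, so its coefficient is the average of v_j and the conjugate of
v_{-j}. No symmetry of `v` is needed, only a bound at both frequencies. -/
lemma norm_layerCoeff_seriesFun_le (hβ : Summable β) {Y : ℝ} (hb : ∀ j, ‖v j Y‖ ≤ β j)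
    {D : ℝ} {j : Fin d → ℤ} (h : ‖v j Y‖ ≤ D) (h' : ‖v (-j) Y‖ ≤ D) :
    ‖layerCoeff (seriesFun v) j Y‖ ≤ D := by
  have hs : Summable fun k => ‖v k Y‖ :=
    Summable.of_nonneg_of_le (fun k => norm_nonneg _) hb hβ
  set F : UnitAddTorus (Fin d) → ℂ := fun X => ∑' j, v j Y * mFourier j X with hF
  have hFc : Continuous F := continuous_series_slice hβ hb
  have h1 : mFourierCoeff F j = v j Y := mFourierCoeff_tsum hs j
  have h2 : mFourierCoeff F (-j) = v (-j) Y := mFourierCoeff_tsum hs (-j)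
  rw [mFourierCoeff_eq_integral_volume] at h1 h2
  have h3 : ∫ X, mFourier (-j) X * (starRingEnd ℂ) (F X) = (starRingEnd ℂ) (v (-j) Y) := by
    rw [← h2, ← integral_conj]
    refine integral_congr_ae (Eventually.of_forall fun X => ?_)
    simp [mFourier_neg]
  have i1 : Integrable fun X => mFourier (-j) X * F X :=
    Continuous.integrable_of_hasCompactSupport (by fun_prop) (HasCompactSupport.of_compactSpace _)
  have i2 : Integrable fun X => mFourier (-j) X * (starRingEnd ℂ) (F X) :=
    Continuous.integrable_of_hasCompactSupport
      ((mFourier (-j)).continuous.mul (Complex.continuous_conj.comp hFc))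
      (HasCompactSupport.of_compactSpace _)
  have h4 : layerCoeff (seriesFun v) j Y = (v j Y + (starRingEnd ℂ) (v (-j) Y)) / 2 := by
    rw [layerCoeff, mFourierCoeff_eq_integral_volume, ← h1, ← h3, ← integral_add i1 i2,
      ← integral_div]
    refine integral_congr_ae (Eventually.of_forall fun X => ?_)
    have : ((seriesFun v (X, Y) : ℝ) : ℂ) = (F X + (starRingEnd ℂ) (F X)) / 2 := by
      rw [Complex.add_conj]; simp [seriesFun, hF]
    simp only [this]; ring
  rw [h4, norm_div, Complex.norm_ofNat]
  have h5 := norm_add_le (v j Y) ((starRingEnd ℂ) (v (-j) Y))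
  rw [RCLike.norm_conj] at h5
  linarith

lemma seriesFun_slice_ae_eq (hβ : Summable β) {Y : ℝ} (hb : ∀ j, ‖v j Y‖ ≤ β j)
    {f : UnitAddTorus (Fin d) × ℝ → ℝ} (hf : MemLp (fun X => f (X, Y)) 2 volume)
    (hfv : ∀ j, layerCoeff f j Y = v j Y) :
    ∀ᵐ X, seriesFun v (X, Y) = f (X, Y) := by
  have hs : Summable fun k => ‖v k Y‖ :=
    Summable.of_nonneg_of_le (fun k => norm_nonneg _) hb hβ
  have hFc : Continuous fun X => ∑' j, v j Y * mFourier j X := continuous_series_slice hβ hb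
  have h1 := ae_eq_of_mFourierCoeff_eq
    (hFc.memLp_of_hasCompactSupport (HasCompactSupport.of_compactSpace _)) hf.ofReal
    (fun j => by rw [mFourierCoeff_tsum hs j, ← hfv j]; rfl)
  filter_upwards [h1] with X hX
  simp [seriesFun, hX]

end FourierSeries

/-! ### Bounds for the coefficients of a weak solution -/

section Representative

open Set Filter UnitAddTorus

variable {d : ℕ} {H : UnitAddTorus (Fin d) → ℝ} {j : Fin d → ℤ}
  {e e' u : UnitAddTorus (Fin d) × ℝ → ℝ} {a : ℝ}

lemma integral_sq_le_of_eLpNorm_le {α : Type*} [MeasurableSpace α] {μ : Measure α} {f : α → ℝ}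
    {K : ℝ} (hf : MemLp f 2 μ) (hK : 0 ≤ K) (h : eLpNorm f 2 μ ≤ ENNReal.ofReal K) :
    ∫ x, f x ^ 2 ∂μ ≤ K ^ 2 := by
  have h1 : eLpNorm f 2 μ ^ 2 = ENNReal.ofReal (∫ x, f x ^ 2 ∂μ) := by
    rw [← lintegral_enorm_sq_eq hf, eLpNorm_eq_lintegral_rpow_enorm_toReal (by norm_num)
      (by norm_num), ← ENNReal.rpow_natCast, ← ENNReal.rpow_mul]
    simp
  have h2 : eLpNorm f 2 μ ^ 2 ≤ ENNReal.ofReal K ^ 2 := by gcongr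
  rw [h1, ← ENNReal.ofReal_pow hK] at h2
  exact (ENNReal.ofReal_le_ofReal_iff (by positivity)).1 h2

lemma ae_modeCoeff_cosMode (ha : ∀ X, -H X ≤ a) (hu : MemLp u 2 (layerMeasure H))
    (j : Fin d → ℤ) : ∀ᵐ Y, Y ∈ Ioi a →
      modeCoeff a (cosMode j) u Y = (layerCoeff u j Y).re ∧
      modeCoeff a (sinMode j) u Y = -(layerCoeff u j Y).im := by
  have h := ae_memLp_slice (hu.strip ha)
  rw [ae_restrict_iff' measurableSet_Ioi] at h
  filter_upwards [h] with Y hY hYa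
  rw [layerCoeff, mFourierCoeff_ofReal ((hY hYa).integrable (by norm_num)) j Y]
  simp [modeCoeff, indicator_of_mem hYa]

lemma freqRate_le_mul_freqNorm (hj : j ≠ 0) : freqRate j ≤ 2 * Real.pi * freqNorm j := by
  rw [freqRate_of_ne_zero hj]
  have := one_le_freqNorm hj
  have := Real.pi_gt_three
  nlinarith

variable {S SY G : UnitAddTorus (Fin d) × ℝ → ℝ} {SX : Fin d → UnitAddTorus (Fin d) × ℝ → ℝ}
  {N : UnitAddTorus (Fin d) → ℝ}

/-- A summable majorant of the Fourier coefficients of a weak solution. -/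
def modeBound (h K : ℝ) (G : UnitAddTorus (Fin d) × ℝ → ℝ) (j : Fin d → ℤ) : ℝ :=
  Real.exp (-(h / 2 * freqRate j)) * (1 + 2 / h * K ^ 2) + (freqRate j ^ 3)⁻¹
    + ∫ Y in Ioi (-h), ‖layerCoeff G j Y‖ ^ 2

lemma modeBound_nonneg {h : ℝ} (hh : 0 < h) (K : ℝ) (G : UnitAddTorus (Fin d) × ℝ → ℝ)
    (j : Fin d → ℤ) : 0 ≤ modeBound h K G j := by
  have h1 := one_le_freqRate j
  have h2 : 0 ≤ ∫ Y in Ioi (-h), ‖layerCoeff G j Y‖ ^ 2 := integral_nonneg fun Y => by positivity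
  unfold modeBound; positivity

/-- The exponentials, the inverse cubes (where d ≤ 2 matters) and the L² terms of G (by Parseval)
are summed separately. G enters the bound only through `M`. -/
lemma exists_summable_modeBound (hd : d = 1 ∨ d = 2) {h : ℝ} (hh : 0 < h) (K : ℝ) (M : NNReal) :
    ∃ B : ℝ, 0 ≤ B ∧ ∀ G : UnitAddTorus (Fin d) × ℝ → ℝ, MemLp G 2 (layerMeasure H) →
      (∀ X, -H X ≤ -h) → eLpNorm G 2 (layerMeasure H) ≤ M →
      Summable (modeBound h K G) ∧ ∑' j, modeBound h K G j ≤ B := by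
  have hs1 := (summable_exp_freqRate hd (half_pos hh)).mul_right (1 + 2 / h * K ^ 2)
  have hs2 := summable_freqRate_inv_cube hd
  refine ⟨∑' j : Fin d → ℤ, (Real.exp (-(h / 2 * freqRate j)) * (1 + 2 / h * K ^ 2)
      + (freqRate j ^ 3)⁻¹) + M ^ 2, ?_, fun G hG ha hM => ?_⟩
  · have : 0 ≤ ∑' j : Fin d → ℤ, (Real.exp (-(h / 2 * freqRate j)) * (1 + 2 / h * K ^ 2)
      + (freqRate j ^ 3)⁻¹) := tsum_nonneg fun j => by
        have := one_le_freqRate j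
        positivity
    positivity
  · have h1 : ∫ p, G p ^ 2 ∂((volume : Measure (UnitAddTorus (Fin d))).prod
        (volume.restrict (Ioi (-h)))) ≤ (M : ℝ) ^ 2 := by
      refine integral_sq_le_of_eLpNorm_le (hG.strip ha) M.2 ?_
      rw [ENNReal.ofReal_coe_nnreal]
      exact (eLpNorm_mono_measure _ (prod_restrict_Ioi_le ha)).trans hM
    have hfin : ∀ s : Finset (Fin d → ℤ),
        ∑ j ∈ s, ∫ Y in Ioi (-h), ‖layerCoeff G j Y‖ ^ 2 ≤ (M : ℝ) ^ 2 := fun s =>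
      (sum_integral_layerCoeff_le (hG.strip ha) s).trans h1
    have hnn : ∀ j, 0 ≤ ∫ Y in Ioi (-h), ‖layerCoeff G j Y‖ ^ 2 := fun j =>
      integral_nonneg fun Y => by positivity
    have hs3 := summable_of_sum_le hnn hfin
    refine ⟨(hs1.add hs2).add hs3, ?_⟩
    unfold modeBound
    rw [(hs1.add hs2).tsum_add hs3]
    gcongr
    exact hs3.tsum_le_of_sum_le hfin

/-- The mode equation with k = 2π‖j‖ gives a bound uniform in Y ≥ 0; its value at Y = 0 is the
initial value for the propagation of decay. Since `freqRate j` ≤ k, passing to this rate only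
weakens the estimates. -/
lemma exists_mode_bound (hH : Continuous H) {h : ℝ} (hh : 0 < h) (ha : ∀ X, -H X ≤ -h)
    {C K : ℝ} {n : ℕ} (hC : 0 ≤ C) (hK : 0 ≤ K) (hj : j ≠ 0) (he : IsFourierMode j e e')
    (hS : MemLp S 2 (layerMeasure H)) (hSX : ∀ l, MemLp (SX l) 2 (layerMeasure H))
    (hSY : MemLp SY 2 (layerMeasure H)) (hG : MemLp G 2 (layerMeasure H))
    (hg : IsWeakGradient H S SX SY)
    (hw : ∀ φ, IsTest φ →
      ∫ p, ((∑ l, SX l p * partialX l φ p) + SY p * partialY φ p) ∂layerMeasure H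
        = (∫ p, G p * φ p ∂layerMeasure H) + ∫ X, N X * φ (X, -H X))
    (hdec : HasFourierDecay G C n) (hSK : eLpNorm S 2 (layerMeasure H) ≤ ENNReal.ofReal K)
    (hle : ∀ᵐ Y, Y ∈ Ioi (-h) → |modeCoeff (-h) e G Y| ≤ ‖layerCoeff G j Y‖) :
    ∃ w : ℝ → ℝ, Continuous w ∧ (∀ᵐ Y, Y ∈ Ioi (-h) → modeCoeff (-h) e S Y = w Y) ∧
      ∀ Y, 0 ≤ Y → |w Y| ≤ modeBound h K G j ∧
        |w Y| ≤ (modeBound h K G j + C * momentConst n) * (1 + Y) ^ (n + 1)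
          * Real.exp (-(freqRate j * Y)) := by
  have hν := one_le_freqRate j
  have hνk := freqRate_le_mul_freqNorm hj
  set k := 2 * Real.pi * freqNorm j with hk
  have hk0 : 0 < k := by linarith
  obtain ⟨mS, hS2⟩ := memLp_modeCoeff ha hS he
  obtain ⟨mG, -⟩ := memLp_modeCoeff ha hG he
  obtain ⟨w, m, hwc, hsw, hm, hvar⟩ := exists_mode_representative hk0
    (hasWeakDerivIoi_modeCoeff ha he hS hSY hg)
    (hasWeakDerivIoi_modeCoeff_snd hH ha he hS hSX hSY hG hg hw) mS
    (memLp_modeCoeff ha hSY he).1 mG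
  have hb : ∀ Y, 0 ≤ Y → |w Y| ≤ modeBound h K G j := by
    intro Y hY
    refine (abs_mode_le hk0 mG mS hh rfl hwc hsw hm hvar hY).trans ?_
    have h1 : ∫ Y, modeCoeff (-h) e S Y ^ 2 ≤ K ^ 2 :=
      hS2.trans (integral_sq_le_of_eLpNorm_le hS hK hSK)
    have h2 : ∫ Y, modeCoeff (-h) e G Y ^ 2 ≤ ∫ Y in Ioi (-h), ‖layerCoeff G j Y‖ ^ 2 := by
      rw [← integral_indicator measurableSet_Ioi]
      refine integral_mono_ae mG.integrable_sq ((integrable_indicator_iff measurableSet_Ioi).2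
        (integrable_norm_layerCoeff_sq (hG.strip ha) j)) ?_
      filter_upwards [hle] with Y hY
      by_cases hYh : Y ∈ Ioi (-h)
      · simp only [indicator_of_mem hYh]
        rw [← sq_abs]
        exact pow_le_pow_left₀ (abs_nonneg _) (hY hYh) 2
      · simp only [modeCoeff, indicator_of_notMem hYh]; norm_num
    unfold modeBound
    refine add_le_add (add_le_add ?_ ?_) h2
    · refine mul_le_mul (Real.exp_le_exp.2 ?_) (by gcongr) ?_ (Real.exp_pos _).le
      · nlinarith
      · have : 0 ≤ ∫ Y, modeCoeff (-h) e S Y ^ 2 := integral_nonneg fun Y => sq_nonneg _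
        positivity
    · gcongr
  refine ⟨w, hwc, hsw, fun Y hY => ⟨hb Y hY, ?_⟩⟩
  have hγ : ∀ᵐ t, 0 < t → |modeCoeff (-h) e G t|
      ≤ C * (1 + t) ^ n * Real.exp (-(freqRate j * t)) := by
    filter_upwards [hle, hdec j] with t h1 h2 ht
    exact (h1 (mem_Ioi.2 (by linarith))).trans (h2 ht)
  refine (abs_mode_le_of_decay (by linarith) hν hνk hC mG.aestronglyMeasurable hγ hm hvar
    hY).trans ?_
  gcongr
  exact hb 0 le_rfl

/-- The zeroth Fourier coefficient is determined by the integrals against functions of the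
vertical coordinate. -/
lemma ae_layerCoeff_zero_eq (hH : Continuous H) (hpos : ∀ X, 0 < H X)
    (hS : MemLp S 2 (layerMeasure H)) {A : ℝ → ℝ} (hA : Continuous A)
    (hSA : ∀ η : ℝ → ℝ, Continuous η → HasCompactSupport η →
      ∫ p, S p * (Ioi (0 : ℝ)).indicator η p.2 ∂layerMeasure H = ∫ Y in Ioi (0 : ℝ), A Y * η Y) :
    ∀ᵐ Y, Y ∈ Ioi (0 : ℝ) → layerCoeff S 0 Y = A Y := by
  have h0 : ∀ X, -H X ≤ (0 : ℝ) := fun X => by linarith [hpos X]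
  have he := isFourierMode_cosMode (0 : Fin d → ℤ)
  have hcos : ∀ p : UnitAddTorus (Fin d) × ℝ, cosMode 0 p = 1 := fun p => by
    simp [cosMode, mFourier_zero]
  have hsin : ∀ p : UnitAddTorus (Fin d) × ℝ, sinMode 0 p = 0 := fun p => by
    simp [sinMode, mFourier_zero]
  have hloc : LocallyIntegrable (modeCoeff 0 (cosMode 0) S) :=
    (memLp_modeCoeff h0 hS he).1.locallyIntegrable (by norm_num)
  have hz : ∀ᵐ Y, Y ∈ Ioi (0 : ℝ) → modeCoeff 0 (cosMode 0) S Y - A Y = 0 := by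
    refine isOpen_Ioi.ae_eq_zero_of_integral_contDiff_smul_eq_zero
      ((hloc.sub hA.locallyIntegrable).locallyIntegrableOn _) fun ψ hψ hc hs => ?_
    have i1 := hloc.integrable_mul_of_hasCompactSupport hψ.continuous hc
    have i2 := hA.locallyIntegrable.integrable_mul_of_hasCompactSupport hψ.continuous hc
    have h1 := integral_mul_snd_mode h0 hS he.smooth he.abs_le hψ.continuous hc hs
    have h2 := hSA ψ hψ.continuous hc
    have h3 : ∀ Y, Y ∉ Ioi (0 : ℝ) → ψ Y = 0 := fun Y hY =>
      image_eq_zero_of_notMem_tsupport fun h => hY (hs h)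
    have h4 : ∀ Y, (Ioi (0 : ℝ)).indicator ψ Y = ψ Y := fun Y => by
      by_cases hY : Y ∈ Ioi (0 : ℝ)
      · rw [indicator_of_mem hY]
      · rw [indicator_of_notMem hY, h3 Y hY]
    simp_rw [h4] at h2
    simp_rw [hcos, mul_one] at h1
    rw [setIntegral_eq_integral_of_forall_compl_eq_zero fun Y hY => by rw [h3 Y hY, mul_zero]]
      at h2
    simp only [smul_eq_mul, mul_sub, Pi.sub_apply]
    simp_rw [mul_comm (ψ _)]
    rw [integral_sub i1 i2]
    linarith
  have hslice := ae_memLp_slice (hS.strip h0)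
  rw [ae_restrict_iff' measurableSet_Ioi] at hslice
  filter_upwards [hz, ae_modeCoeff_cosMode h0 hS 0] with Y h1 h2 hY
  obtain ⟨h3, h4⟩ := h2 hY
  apply Complex.ext
  · rw [← h3, Complex.ofReal_re]; linarith [h1 hY]
  · rw [Complex.ofReal_im]
    have : modeCoeff 0 (sinMode 0) S Y = 0 := by
      rw [modeCoeff, indicator_of_mem hY]; simp [hsin]
    linarith

end Representative

/-! ### The continuous, decaying representative -/

section Regularity

open Set Filter UnitAddTorus

variable {d : ℕ} {H : UnitAddTorus (Fin d) → ℝ}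

lemma meanDecay_le_momentConst (n : ℕ) (Y : ℝ) : meanDecay n Y ≤ momentConst n := by
  have h0 := le_max_right Y 0
  have hp : 0 ≤ n.factorial * 2 ^ n * Real.exp (1 / 2) := by positivity
  calc meanDecay n Y ≤ n.factorial * 2 ^ n * Real.exp (1 / 2)
        * Real.exp (-(1 / 2) * max Y 0) := one_add_pow_mul_exp_le_exp_half h0
    _ ≤ n.factorial * 2 ^ n * Real.exp (1 / 2) * 1 := by
        gcongr
        exact Real.exp_le_one_iff.2 (by linarith)
    _ ≤ momentConst n := by unfold momentConst; linarith

lemma exists_pos_le_of_continuous (hH : Continuous H) (hpos : ∀ X, 0 < H X) :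
    ∃ h : ℝ, 0 < h ∧ ∀ X, -H X ≤ -h := by
  obtain ⟨X₀, -, hX₀⟩ := isCompact_univ.exists_isMinOn univ_nonempty hH.continuousOn
  exact ⟨H X₀, hpos X₀, fun X => neg_le_neg (hX₀ (mem_univ X))⟩

/-- A weak solution has a continuous representative in `{Y > 0}` which decays exponentially. -/
theorem exists_decaying_representative (hd : d = 1 ∨ d = 2) (hH : Continuous H)
    (hpos : ∀ X, 0 < H X) {C K : ℝ} (hC : 0 ≤ C) (hK : 0 ≤ K) (n : ℕ) (M : NNReal) :
    ∃ D : ℝ, 0 ≤ D ∧ ∀ (G : UnitAddTorus (Fin d) × ℝ → ℝ) (N : UnitAddTorus (Fin d) → ℝ)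
      (S : UnitAddTorus (Fin d) × ℝ → ℝ) (SX : Fin d → UnitAddTorus (Fin d) × ℝ → ℝ)
      (SY : UnitAddTorus (Fin d) × ℝ → ℝ) (A : ℝ → ℝ),
      MemLp G 2 (layerMeasure H) → eLpNorm G 2 (layerMeasure H) ≤ M → HasFourierDecay G C n →
      MemLp S 2 (layerMeasure H) → (∀ l, MemLp (SX l) 2 (layerMeasure H)) →
      MemLp SY 2 (layerMeasure H) → IsWeakGradient H S SX SY →
      (∀ φ, IsTest φ →
        ∫ p, ((∑ l, SX l p * partialX l φ p) + SY p * partialY φ p) ∂layerMeasure H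
          = (∫ p, G p * φ p ∂layerMeasure H) + ∫ X, N X * φ (X, -H X)) →
      eLpNorm S 2 (layerMeasure H) ≤ ENNReal.ofReal K → Continuous A →
      (∀ Y, |A Y| ≤ K * meanDecay n Y) →
      (∀ η : ℝ → ℝ, Continuous η → HasCompactSupport η →
        ∫ p, S p * (Ioi (0 : ℝ)).indicator η p.2 ∂layerMeasure H
          = ∫ Y in Ioi (0 : ℝ), A Y * η Y) →
      ∃ T : UnitAddTorus (Fin d) × ℝ → ℝ, T =ᵐ[layerMeasure H] S ∧
        ContinuousOn T {p | 0 < p.2} ∧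
        (∀ j Y, 0 < Y → ‖layerCoeff T j Y‖
          ≤ D * (1 + Y) ^ (n + 1) * Real.exp (-(freqRate j * Y))) ∧
        ∀ X Y, 0 < Y → |T (X, Y)| ≤ D * (1 + Y) ^ (n + 1) * Real.exp (-Y) := by
  obtain ⟨h, hh, ha⟩ := exists_pos_le_of_continuous hH hpos
  obtain ⟨B, hB, hsum⟩ := exists_summable_modeBound (H := H) hd hh K M
  have hmc := momentConst_nonneg n
  set D₀ := K + 2 * (B + C * momentConst n) with hD₀
  set B₀ := K * momentConst n + 2 * B with hB₀
  set Z := ∑' j : Fin d → ℤ, Real.exp (-(1 * freqRate j)) with hZ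
  have hZs := summable_exp_freqRate hd (c := 1) one_pos
  have hZ0 : 0 ≤ Z := tsum_nonneg fun j => (Real.exp_pos _).le
  have hD₀0 : 0 ≤ D₀ := by positivity
  have hB₀0 : 0 ≤ B₀ := by positivity
  -- The three terms serve the coefficients, the pointwise bound for Y > 1 and the pointwise bound
  -- for Y ≤ 1, in this order.
  refine ⟨D₀ + D₀ * (Real.exp 1 * Z) + B₀ * Real.exp 1, by positivity,
    fun G N S SX SY A hG hGM hdec hS hSX hSY hg hw hSK hA hAb hSA => ?_⟩
  obtain ⟨hms, hmB⟩ := hsum G hG ha hGM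
  have hmn := modeBound_nonneg hh K G
  have hmle : ∀ j, modeBound h K G j ≤ B := fun j =>
    (hms.le_tsum j fun i _ => hmn i).trans hmB
  -- The mean mode needs its own term, because `modeBound` controls solutions of an equation with k
  -- > 0. The factor 2 counts the cosine and sine parts.
  set β : (Fin d → ℤ) → ℝ := fun j => (if j = 0 then K * momentConst n else 0)
    + 2 * modeBound h K G j with hβ
  have hβ1 : HasSum (fun j : Fin d → ℤ => if j = 0 then K * momentConst n else 0)
      (K * momentConst n) := hasSum_ite_eq 0 _
  have hβs : Summable β := hβ1.summable.add (hms.mul_left 2)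
  have hβB : ∑' j, β j ≤ B₀ := by
    rw [hβ1.summable.tsum_add (hms.mul_left 2), hβ1.tsum_eq, tsum_mul_left]
    linarith
  have hmode : ∀ j : Fin d → ℤ, ∃ v : ℝ → ℂ, Continuous v ∧
      (∀ᵐ Y, Y ∈ Ioi (0 : ℝ) → layerCoeff S j Y = v Y) ∧ ∀ Y, 0 < Y → ‖v Y‖ ≤ β j ∧
        ‖v Y‖ ≤ D₀ * (1 + Y) ^ (n + 1) * Real.exp (-(freqRate j * Y)) := by
    intro j
    by_cases hj : j = 0
    · subst hj
      refine ⟨fun Y => (A Y : ℂ), Complex.continuous_ofReal.comp hA,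
        ae_layerCoeff_zero_eq hH hpos hS hA hSA, fun Y hY => ?_⟩
      rw [Complex.norm_real, Real.norm_eq_abs]
      constructor
      · simp only [hβ, if_true]
        have h1 := mul_le_mul_of_nonneg_left (meanDecay_le_momentConst n Y) hK
        linarith [hAb Y, hmn 0]
      · refine (hAb Y).trans ?_
        rw [meanDecay_of_pos n hY, freqRate_zero, one_mul, ← mul_assoc]
        have h1 : (1 + Y) ^ n ≤ (1 + Y) ^ (n + 1) :=
          pow_le_pow_right₀ (by linarith) (Nat.le_succ n)
        have h2 : K ≤ D₀ := by
          have : 0 ≤ 2 * (B + C * momentConst n) := by positivity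
          linarith
        gcongr
    · have hae := ae_modeCoeff_cosMode ha hG j
      obtain ⟨w, hwc, hwS, hwb⟩ := exists_mode_bound hH hh ha hC hK hj
        (isFourierMode_cosMode j) hS hSX hSY hG hg hw hdec hSK (by
          filter_upwards [hae] with Y h1 hY
          rw [(h1 hY).1]; exact Complex.abs_re_le_norm _)
      obtain ⟨w', hwc', hwS', hwb'⟩ := exists_mode_bound hH hh ha hC hK hj
        (isFourierMode_sinMode j) hS hSX hSY hG hg hw hdec hSK (by
          filter_upwards [hae] with Y h1 hY
          rw [(h1 hY).2, abs_neg]; exact Complex.abs_im_le_norm _)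
      have hn : ∀ Y, ‖(w Y : ℂ) - w' Y * Complex.I‖ ≤ |w Y| + |w' Y| := fun Y => by
        refine (norm_sub_le _ _).trans ?_
        rw [norm_mul, Complex.norm_I, mul_one, Complex.norm_real, Complex.norm_real]
        rfl
      refine ⟨fun Y => (w Y : ℂ) - w' Y * Complex.I,
        (Complex.continuous_ofReal.comp hwc).sub
          ((Complex.continuous_ofReal.comp hwc').mul continuous_const), ?_, fun Y hY => ⟨?_, ?_⟩⟩
      · filter_upwards [ae_modeCoeff_cosMode ha hS j, hwS, hwS'] with Y h1 h2 h3 hY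
        have hYh : Y ∈ Ioi (-h) := mem_Ioi.2 (by linarith [mem_Ioi.1 hY])
        obtain ⟨h4, h5⟩ := h1 hYh
        rw [h2 hYh] at h4
        rw [h3 hYh] at h5
        apply Complex.ext <;> simp [h4, h5]
      · simp only [hβ, if_neg hj, zero_add]
        linarith [hn Y, (hwb Y hY.le).1, (hwb' Y hY.le).1]
      · have h6 : (modeBound h K G j + C * momentConst n) * (1 + Y) ^ (n + 1)
            * Real.exp (-(freqRate j * Y))
            ≤ (B + C * momentConst n) * (1 + Y) ^ (n + 1) * Real.exp (-(freqRate j * Y)) := by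
          gcongr
          exact hmle j
        have h7 : 0 ≤ K * (1 + Y) ^ (n + 1) * Real.exp (-(freqRate j * Y)) := by positivity
        calc ‖(w Y : ℂ) - w' Y * Complex.I‖
            ≤ 2 * ((B + C * momentConst n) * (1 + Y) ^ (n + 1)
              * Real.exp (-(freqRate j * Y))) := by
              linarith [hn Y, (hwb Y hY.le).2, (hwb' Y hY.le).2]
          _ ≤ K * (1 + Y) ^ (n + 1) * Real.exp (-(freqRate j * Y))
              + 2 * ((B + C * momentConst n) * (1 + Y) ^ (n + 1)
              * Real.exp (-(freqRate j * Y))) := by linarith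
          _ = _ := by rw [hD₀]; ring
  choose v hvc hvS hvb using hmode
  -- The Fourier series replaces S above Y = 0 only; below, no regularity is claimed.
  set T : UnitAddTorus (Fin d) × ℝ → ℝ := fun p => if 0 < p.2 then seriesFun v p else S p with hT
  have hTpos : ∀ p : UnitAddTorus (Fin d) × ℝ, 0 < p.2 → T p = seriesFun v p := fun p hp =>
    if_pos hp
  have hTcont : ContinuousOn T {p | 0 < p.2} :=
    (continuousOn_seriesFun hβs (fun j => (hvc j).continuousOn)
      fun j Y hY => (hvb j Y hY).1).congr fun p hp => hTpos p hp
  have h0 : ∀ X, -H X ≤ (0 : ℝ) := fun X => by linarith [hpos X]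
  refine ⟨T, ?_, hTcont, fun j Y hY => ?_, fun X Y hY => ?_⟩
  · have hm : MeasurableSet {p : UnitAddTorus (Fin d) × ℝ | 0 < p.2} :=
      measurableSet_lt measurable_const measurable_snd
    have hsl := ae_memLp_slice (hS.strip h0)
    have hae : ∀ᵐ Y ∂(volume.restrict (Ioi (0 : ℝ))), ∀ᵐ X, T (X, Y) = S (X, Y) := by
      have h1 : ∀ᵐ Y ∂(volume.restrict (Ioi (0 : ℝ))), ∀ j, Y ∈ Ioi (0 : ℝ) →
          layerCoeff S j Y = v j Y := ae_restrict_of_ae (ae_all_iff.2 hvS)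
      filter_upwards [h1, hsl, ae_restrict_mem measurableSet_Ioi] with Y h2 h3 hY
      filter_upwards [seriesFun_slice_ae_eq hβs (fun j => (hvb j Y hY).1) h3
        fun j => h2 j hY] with X hX
      rw [hTpos (X, Y) hY, hX]
    have hmeasT : AEStronglyMeasurable T
        ((volume : Measure (UnitAddTorus (Fin d))).prod (volume.restrict (Ioi 0))) := by
      have : (volume : Measure (UnitAddTorus (Fin d))).prod ((volume : Measure ℝ).restrict (Ioi 0))
          = volume.restrict {p | 0 < p.2} := by
        rw [show {p : UnitAddTorus (Fin d) × ℝ | 0 < p.2} = univ ×ˢ Ioi 0 by ext p; simp,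
          Measure.volume_eq_prod, ← Measure.prod_restrict, Measure.restrict_univ]
      rw [this]
      exact hTcont.aestronglyMeasurable hm
    have hprod : ∀ᵐ p ∂((volume : Measure (UnitAddTorus (Fin d))).prod
        (volume.restrict (Ioi 0))), T p = S p := by
      have hd0 : AEStronglyMeasurable (fun p => T p - S p)
          ((volume : Measure (UnitAddTorus (Fin d))).prod (volume.restrict (Ioi 0))) :=
        hmeasT.sub (hS.strip h0).aestronglyMeasurable
      -- Equality on almost every slice gives a vanishing L¹ norm by Tonelli; the joint
      -- measurability this needs comes from the continuity of `T`.
      have hz : eLpNorm (fun p => T p - S p) 1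
          ((volume : Measure (UnitAddTorus (Fin d))).prod (volume.restrict (Ioi 0))) = 0 := by
        rw [eLpNorm_one_eq_lintegral_enorm, lintegral_prod_symm _ hd0.enorm]
        refine lintegral_eq_zero_of_ae_eq_zero ?_
        filter_upwards [hae] with Y hY
        refine lintegral_eq_zero_of_ae_eq_zero ?_
        filter_upwards [hY] with X hX
        simp [hX]
      rw [eLpNorm_eq_zero_iff hd0 one_ne_zero] at hz
      filter_upwards [hz] with p hp
      exact sub_eq_zero.1 hp
    have hres : ∀ᵐ p ∂((layerMeasure H).restrict {p | 0 < p.2}), T p = S p := by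
      refine ae_mono ?_ hprod
      rw [layerMeasure, Measure.restrict_restrict hm,
        show (volume : Measure (UnitAddTorus (Fin d))).prod ((volume : Measure ℝ).restrict (Ioi 0))
          = volume.restrict {p | 0 < p.2} by
        rw [show {p : UnitAddTorus (Fin d) × ℝ | 0 < p.2} = univ ×ˢ Ioi 0 by ext p; simp,
          Measure.volume_eq_prod, ← Measure.prod_restrict, Measure.restrict_univ]]
      exact Measure.restrict_mono inter_subset_left le_rfl
    rw [ae_restrict_iff' hm] at hres
    filter_upwards [hres] with p hp
    by_cases h1 : 0 < p.2
    · exact hp h1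
    · exact if_neg h1
  · have h1 : layerCoeff T j Y = layerCoeff (seriesFun v) j Y := by
      unfold layerCoeff
      congr 1; ext X
      rw [hTpos (X, Y) hY]
    rw [h1]
    have h2 : D₀ * (1 + Y) ^ (n + 1) * Real.exp (-(freqRate j * Y))
        ≤ (D₀ + D₀ * (Real.exp 1 * Z) + B₀ * Real.exp 1) * (1 + Y) ^ (n + 1)
          * Real.exp (-(freqRate j * Y)) := by
      have : 0 ≤ D₀ * (Real.exp 1 * Z) + B₀ * Real.exp 1 := by positivity
      gcongr
      linarith
    have h3 : freqRate (-j) = freqRate j := by rw [freqRate, freqNorm_neg]; rfl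
    refine norm_layerCoeff_seriesFun_le hβs (fun j => (hvb j Y hY).1)
      ((hvb j Y hY).2.trans h2) ?_
    rw [← h3] at h2
    refine ((hvb (-j) Y hY).2.trans h2).trans_eq ?_
    rw [h3]
  · rw [hTpos (X, Y) hY]
    have hp1 : (1 : ℝ) ≤ (1 + Y) ^ (n + 1) := one_le_pow₀ (by linarith)
    -- The sum of e^{-νY} over frequencies is not bounded as Y → 0. Up to Y = 1 the summable
    -- majorant `β` is used instead, and e · e^{-Y} ≥ 1 restores the exponential.
    rcases le_or_gt Y 1 with hY1 | hY1
    · have h1 : |seriesFun v (X, Y)| ≤ B₀ :=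
        (abs_seriesFun_le hβs fun j => (hvb j Y hY).1).trans hβB
      have h2 : 1 ≤ Real.exp 1 * Real.exp (-Y) := by
        rw [← Real.exp_add]; exact Real.one_le_exp (by linarith)
      calc |seriesFun v (X, Y)| ≤ B₀ * 1 * 1 := by linarith
        _ ≤ B₀ * (1 + Y) ^ (n + 1) * (Real.exp 1 * Real.exp (-Y)) := by gcongr
        _ = B₀ * Real.exp 1 * (1 + Y) ^ (n + 1) * Real.exp (-Y) := by ring
        _ ≤ _ := by
            gcongr
            have : 0 ≤ D₀ * (Real.exp 1 * Z) := by positivity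
            linarith
    -- Beyond Y = 1, (ν - 1)(Y - 1) ≥ 0 gives e^{-νY} ≤ e^{1-Y} e^{-ν}, which sums to `Z` over the
    -- frequencies.
    · have h1 : |seriesFun v (X, Y)|
          ≤ ∑' j : Fin d → ℤ, D₀ * (1 + Y) ^ (n + 1) * Real.exp (1 - Y)
            * Real.exp (-(1 * freqRate j)) := by
        refine abs_seriesFun_le (hZs.mul_left _) fun j => ((hvb j Y hY).2).trans ?_
        rw [mul_assoc (D₀ * (1 + Y) ^ (n + 1)), ← Real.exp_add]
        gcongr
        have := one_le_freqRate j
        nlinarith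
      rw [tsum_mul_left, ← hZ] at h1
      calc |seriesFun v (X, Y)| ≤ _ := h1
        _ = D₀ * (Real.exp 1 * Z) * (1 + Y) ^ (n + 1) * Real.exp (-Y) := by
            rw [sub_eq_add_neg, Real.exp_add]; ring
        _ ≤ _ := by
            gcongr
            have : 0 ≤ B₀ * Real.exp 1 := by positivity
            linarith

end Regularity

/-! ### Bump functions and the fundamental lemma on 𝕋^d × ℝ -/

section Bumps

open Set Filter UnitAddTorus
open scoped Topology

variable {d : ℕ}

/-- A smooth function on `𝕋^d × ℝ` which vanishes at the origin only. -/
def layerGauge (p : UnitAddTorus (Fin d) × ℝ) : ℝ :=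
  ∑ l, (1 - cosMode (Pi.single l 1) p) + p.2 ^ 2

lemma smoothLift_layerGauge : SmoothLift (layerGauge (d := d)) := by
  unfold SmoothLift layerGauge
  refine ContDiff.add (ContDiff.sum fun l _ => contDiff_const.sub (smoothLift_cosMode _)) ?_
  exact contDiff_snd.pow 2

lemma layerGauge_summand_nonneg (l : Fin d) (p : UnitAddTorus (Fin d) × ℝ) :
    0 ≤ 1 - cosMode (Pi.single l 1) p := by
  linarith [(abs_le.1 (abs_cosMode_le (Pi.single l 1) p)).2]

lemma layerGauge_nonneg (p : UnitAddTorus (Fin d) × ℝ) : 0 ≤ layerGauge p :=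
  add_nonneg (Finset.sum_nonneg fun l _ => layerGauge_summand_nonneg l p) (sq_nonneg _)

lemma layerGauge_zero : layerGauge (0 : UnitAddTorus (Fin d) × ℝ) = 0 := by
  simp [layerGauge, cosMode, mFourier]

lemma layerGauge_eq_zero {p : UnitAddTorus (Fin d) × ℝ} (h : layerGauge p = 0) : p = 0 := by
  have h1 := (add_eq_zero_iff_of_nonneg
    (Finset.sum_nonneg fun l _ => layerGauge_summand_nonneg l p) (sq_nonneg p.2)).1 h
  have h2 := (Finset.sum_eq_zero_iff_of_nonneg fun l _ => layerGauge_summand_nonneg l p).1 h1.1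
  refine Prod.ext (funext fun l => ?_) (pow_eq_zero_iff (two_ne_zero) |>.1 h1.2)
  have h3 : (mFourier (Pi.single l 1) p.1).re = 1 := by
    have := h2 l (Finset.mem_univ l)
    simp only [cosMode] at this
    linarith
  rw [mFourier_single, fourier_one] at h3
  have h4 : ((p.1 l).toCircle : ℂ) = 1 := by
    have hn : ‖((p.1 l).toCircle : ℂ)‖ = 1 := Circle.norm_coe _
    have h5 := Complex.sq_norm ((p.1 l).toCircle : ℂ)
    rw [hn, Complex.normSq_apply, h3] at h5
    apply Complex.ext
    · exact h3
    · have : ((p.1 l).toCircle : ℂ).im * ((p.1 l).toCircle : ℂ).im = 0 := by linarith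
      simpa using this
  have h6 : (p.1 l).toCircle = (0 : UnitAddCircle).toCircle := by
    rw [AddCircle.toCircle_zero]
    exact Circle.ext h4
  exact AddCircle.injective_toCircle one_ne_zero h6

/-- Sublevel sets of `layerGauge` are compact and shrink to the origin, so a small one fits into
`U`. Composing the gauge with `expNegInvGlue` gives a bump on it without charts. -/
lemma exists_bump_zero {U : Set (UnitAddTorus (Fin d) × ℝ)} (hU : U ∈ 𝓝 0) :
    ∃ k, IsTest k ∧ (∀ p, 0 ≤ k p) ∧ tsupport k ⊆ U ∧ 0 < k (0 : UnitAddTorus (Fin d) × ℝ) := by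
  have hg : Continuous (layerGauge (d := d)) := smoothLift_layerGauge.continuous
  have hK : ∀ ε : ℝ, IsCompact {p : UnitAddTorus (Fin d) × ℝ | layerGauge p ≤ ε} := fun ε => by
    refine (isCompact_univ.prod (isCompact_Icc (a := -(1 + ε)) (b := 1 + ε))).of_isClosed_subset
      (isClosed_le hg continuous_const) fun p hp => ⟨mem_univ _, ?_⟩
    have h1 : p.2 ^ 2 ≤ ε := by
      have h2 : 0 ≤ ∑ l, (1 - cosMode (Pi.single l 1) p) :=
        Finset.sum_nonneg fun l _ => layerGauge_summand_nonneg l p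
      have h3 : layerGauge p ≤ ε := hp
      unfold layerGauge at h3
      linarith
    exact abs_le.1 (by nlinarith [sq_abs p.2, sq_nonneg (|p.2| - 1), abs_nonneg p.2])
  obtain ⟨V, hVU, hV, hV0⟩ := mem_nhds_iff.1 hU
  obtain ⟨ε, hε, hεU⟩ : ∃ ε : ℝ, 0 < ε ∧ {p : UnitAddTorus (Fin d) × ℝ | layerGauge p ≤ ε} ⊆ U := by
    have hc := (hK 1).diff hV
    rcases ({p : UnitAddTorus (Fin d) × ℝ | layerGauge p ≤ 1} \ V).eq_empty_or_nonempty with he | hne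
    · exact ⟨1, one_pos, (sdiff_eq_empty.1 he).trans hVU⟩
    · obtain ⟨p₀, hp₀, hmin⟩ := hc.exists_isMinOn hne hg.continuousOn
      have hpos : 0 < layerGauge p₀ := lt_of_le_of_ne (layerGauge_nonneg p₀) fun h =>
        hp₀.2 (layerGauge_eq_zero h.symm ▸ hV0)
      refine ⟨layerGauge p₀ / 2, half_pos hpos, fun p hp => hVU ?_⟩
      by_contra hn
      have h1 : layerGauge p ≤ layerGauge p₀ / 2 := hp
      have h2 : layerGauge p₀ ≤ 1 := hp₀.1
      have h3 : layerGauge p₀ ≤ layerGauge p := hmin ⟨show layerGauge p ≤ 1 by linarith, hn⟩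
      linarith
  have hsupp : tsupport (fun p : UnitAddTorus (Fin d) × ℝ => expNegInvGlue (ε - layerGauge p))
      ⊆ {p | layerGauge p ≤ ε} := by
    refine closure_minimal (fun p hp => ?_) (isClosed_le hg continuous_const)
    by_contra hn
    have h1 : ε < layerGauge p := not_le.1 hn
    exact hp (expNegInvGlue.zero_of_nonpos (by linarith))
  refine ⟨fun p => expNegInvGlue (ε - layerGauge p), ⟨?_, ?_⟩, fun p => expNegInvGlue.nonneg _,
    hsupp.trans hεU, expNegInvGlue.pos_of_pos (by rw [layerGauge_zero]; linarith)⟩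
  · exact expNegInvGlue.contDiff.comp (contDiff_const.sub smoothLift_layerGauge)
  · exact (hK ε).of_isClosed_subset (isClosed_tsupport _) hsupp

/-- The fundamental lemma of the calculus of variations for continuous functions. -/
lemma eq_zero_of_integral_isTest_eq_zero {h : UnitAddTorus (Fin d) × ℝ → ℝ} (hc : Continuous h)
    {O : Set (UnitAddTorus (Fin d) × ℝ)} (hO : IsOpen O)
    (h0 : ∀ k, IsTest k → tsupport k ⊆ O → ∫ p, k p * h p = 0) : ∀ r ∈ O, h r = 0 := by
  have key : ∀ g : UnitAddTorus (Fin d) × ℝ → ℝ, Continuous g →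
      (∀ k, IsTest k → tsupport k ⊆ O → ∫ p, k p * g p = 0) → ∀ r ∈ O, ¬ 0 < g r := by
    intro g hg hg0 r hr hpos
    have hU : {p | p + r ∈ O ∧ 0 < g (p + r)} ∈ 𝓝 (0 : UnitAddTorus (Fin d) × ℝ) := by
      have hcont : Continuous fun p : UnitAddTorus (Fin d) × ℝ => p + r := continuous_add_const r
      have h1 : IsOpen {p | p + r ∈ O ∧ 0 < g (p + r)} :=
        (hO.preimage hcont).inter (isOpen_lt continuous_const (hg.comp hcont))
      exact h1.mem_nhds ⟨by simpa using hr, by simpa using hpos⟩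
    obtain ⟨k, hk, hk0, hks, hkpos⟩ := exists_bump_zero hU
    have ht : IsTest fun p => k (p + -r) := hk.comp_add (-r)
    have hts : tsupport (fun p => k (p + -r)) ⊆ {p | p ∈ O ∧ 0 < g p} := by
      have := tsupport_comp_eq_preimage k (Homeomorph.addRight (-r))
      intro p hp
      have h2 : p + -r ∈ tsupport k := by
        have h3 : p ∈ tsupport (k ∘ Homeomorph.addRight (-r)) := hp
        rw [this] at h3
        exact h3
      have h4 := hks h2
      simpa using h4
    have hcc : Continuous fun p => k (p + -r) * g p := ht.continuous.mul hg
    have hnn : ∀ p, 0 ≤ k (p + -r) * g p := fun p => by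
      by_cases hp : p ∈ tsupport (fun p => k (p + -r))
      · exact mul_nonneg (hk0 _) (hts hp).2.le
      · have : k (p + -r) = 0 :=
          image_eq_zero_of_notMem_tsupport (f := fun p => k (p + -r)) hp
        rw [this, zero_mul]
    have hpos' := hcc.integral_pos_of_hasCompactSupport_nonneg_nonzero
      (μ := (volume : Measure (UnitAddTorus (Fin d) × ℝ))) ht.compact.mul_right hnn (x := r)
      (by simpa using ⟨hkpos.ne', hpos.ne'⟩)
    exact absurd (hg0 _ ht fun p hp => (hts hp).1) hpos'.ne'
  intro r hr
  rcases lt_trichotomy (h r) 0 with hlt | heq | hgt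
  · refine absurd ?_ (key (fun p => -h p) hc.neg (fun k hk hs => ?_) r hr)
    · linarith
    · simp_rw [mul_neg]; rw [integral_neg, h0 k hk hs, neg_zero]
  · exact heq
  · exact absurd hgt (key h hc h0 r hr)

end Bumps

/-! ### Cross correlations of square integrable functions -/

section Correlation

open Set Filter
open scoped Topology

variable {E : Type*} [AddCommGroup E] [TopologicalSpace E] [IsTopologicalAddGroup E]
  [MeasurableSpace E] [BorelSpace E] [SecondCountableTopology E] [LocallyCompactSpace E]
  [T2Space E] {μ : Measure E} [μ.IsAddHaarMeasure] {f g κ : E → ℝ}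

/-- The cross correlation of two functions. -/
def crossCorr (μ : Measure E) (f g : E → ℝ) (r : E) : ℝ := ∫ p, f p * g (p + r) ∂μ

lemma crossCorr_eq_inner (hf : MemLp f 2 μ) (hg : MemLp g 2 μ) (r : E) :
    crossCorr μ f g r = inner ℝ (Lp.compMeasurePreserving (fun p => p + r)
      (measurePreserving_add_right μ r) hg.toLp) hf.toLp := by
  rw [L2.inner_def]
  refine integral_congr_ae ?_
  have h1 := Lp.coeFn_compMeasurePreserving hg.toLp (measurePreserving_add_right μ r)
  have h2 := (measurePreserving_add_right μ r).quasiMeasurePreserving.ae_eq_comp hg.coeFn_toLp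
  filter_upwards [h1, h2, hf.coeFn_toLp] with p e1 e2 e3
  rw [e1, e2, e3]
  simp

/-- Translation acts continuously on L². This continuity replaces traces when the shift tends to
zero. -/
lemma continuous_crossCorr (hf : MemLp f 2 μ) (hg : MemLp g 2 μ) :
    Continuous (crossCorr μ f g) := by
  have h1 : Continuous fun r : E => Lp.compMeasurePreserving (fun p => p + r)
      (measurePreserving_add_right μ r) hg.toLp := by
    let T : C(E, C(E, E)) := (ContinuousMap.mk (fun a : E × E => a.2 + a.1) (by fun_prop)).curry
    exact Continuous.compMeasurePreservingLp (f := fun _ : E => hg.toLp) (g := T)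
      continuous_const T.continuous (fun r => measurePreserving_add_right μ r) (by norm_num)
  have h2 : crossCorr μ f g = fun r => inner ℝ (Lp.compMeasurePreserving (fun p => p + r)
      (measurePreserving_add_right μ r) hg.toLp) hf.toLp :=
    funext fun r => crossCorr_eq_inner hf hg r
  rw [h2]
  exact h1.inner continuous_const

/-- The product is dominated by f(p)²|κ| + g(q)²|κ|, and each summand is the convolution integrand
of two integrable functions. -/
lemma integrable_mul_mul_comp_sub (hf : MemLp f 2 μ) (hg : MemLp g 2 μ) (hκ : Continuous κ)
    (hc : HasCompactSupport κ) :
    Integrable (fun z : E × E => f z.1 * (g z.2 * κ (z.2 - z.1))) (μ.prod μ) := by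
  have hκi : Integrable κ μ := hκ.integrable_of_hasCompactSupport hc
  have hκn : Integrable (fun r => κ (-r)) μ :=
    (hκ.comp continuous_neg).integrable_of_hasCompactSupport
      (hc.comp_homeomorph (Homeomorph.neg E))
  have i1 : Integrable (fun z : E × E => f z.1 ^ 2 * κ (z.2 - z.1)) (μ.prod μ) :=
    (hf.integrable_sq.convolution_integrand (ContinuousLinearMap.mul ℝ ℝ) hκi).swap
  have i2 : Integrable (fun z : E × E => g z.2 ^ 2 * κ (z.2 - z.1)) (μ.prod μ) := by
    have := hg.integrable_sq.convolution_integrand (ContinuousLinearMap.mul ℝ ℝ) hκn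
    simpa using this
  have hm : AEStronglyMeasurable (fun z : E × E => f z.1 * (g z.2 * κ (z.2 - z.1)))
      (μ.prod μ) :=
    hf.aestronglyMeasurable.comp_fst.mul (hg.aestronglyMeasurable.comp_snd.mul
      (hκ.comp (continuous_snd.sub continuous_fst)).aestronglyMeasurable)
  refine (i1.norm.add i2.norm).mono' hm (Eventually.of_forall fun z => ?_)
  simp only [Pi.add_apply, norm_mul, norm_pow, Real.norm_eq_abs]
  nlinarith [mul_nonneg (sq_nonneg (|f z.1| - |g z.2|)) (abs_nonneg (κ (z.2 - z.1))),
    mul_nonneg (add_nonneg (sq_nonneg (|f z.1|)) (sq_nonneg (|g z.2|)))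
      (abs_nonneg (κ (z.2 - z.1)))]

lemma integral_mul_integral_comp_sub_swap (hf : MemLp f 2 μ) (hg : MemLp g 2 μ)
    (hκ : Continuous κ) (hc : HasCompactSupport κ) :
    ∫ q, g q * ∫ p, f p * κ (q - p) ∂μ ∂μ = ∫ p, f p * ∫ q, g q * κ (q - p) ∂μ ∂μ := by
  have h := integral_integral_swap (f := fun p q => f p * (g q * κ (q - p)))
    (integrable_mul_mul_comp_sub hf hg hκ hc)
  simp_rw [integral_const_mul] at h
  rw [h]
  refine integral_congr_ae (Eventually.of_forall fun q => ?_)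
  simp only
  rw [← integral_const_mul]
  congr 1; ext p; ring

/-- The shear (p, r) ↦ (p, p + r) preserves the product measure and turns a kernel in q - p into a
weight on the shift r. -/
lemma integral_mul_integral_comp_sub (hf : MemLp f 2 μ) (hg : MemLp g 2 μ)
    (hκ : Continuous κ) (hc : HasCompactSupport κ) :
    ∫ p, f p * ∫ q, g q * κ (q - p) ∂μ ∂μ = ∫ r, κ r * crossCorr μ f g r ∂μ := by
  have h1 : ∀ p, ∫ q, g q * κ (q - p) ∂μ = ∫ r, g (p + r) * κ r ∂μ := fun p => by
    rw [← integral_add_left_eq_self (fun q => g q * κ (q - p)) p]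
    simp
  have hi : Integrable (fun z : E × E => f z.1 * (g (z.1 + z.2) * κ z.2)) (μ.prod μ) := by
    have h2 := (measurePreserving_prod_add μ μ).integrable_comp_of_integrable
      (integrable_mul_mul_comp_sub hf hg hκ hc)
    simpa [Function.comp_def] using h2
  have h := integral_integral_swap (f := fun p r => f p * (g (p + r) * κ r)) hi
  simp_rw [h1, ← integral_const_mul]
  rw [h]
  refine integral_congr_ae (Eventually.of_forall fun r => ?_)
  simp only [crossCorr]
  rw [← integral_const_mul]
  congr 1; ext p; ring

end Correlation

/-! ### Shifts into the layer -/

section InteriorShifts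

open Set Filter
open scoped Topology

variable {d : ℕ} {H : UnitAddTorus (Fin d) → ℝ} {T TY : UnitAddTorus (Fin d) × ℝ → ℝ}
  {TX : Fin d → UnitAddTorus (Fin d) × ℝ → ℝ} {k : UnitAddTorus (Fin d) × ℝ → ℝ}

/-- The translations which map the closure of the layer domain into the layer domain. -/
def inwardShifts (H : UnitAddTorus (Fin d) → ℝ) : Set (UnitAddTorus (Fin d) × ℝ) :=
  {r | ∀ X, H X < H (X + r.1) + r.2}

/-- The torus is compact, so a strict inequality valid for all X persists for nearby shifts. -/
lemma isOpen_inwardShifts (hH : Continuous H) : IsOpen (inwardShifts H) := by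
  rw [isOpen_iff_mem_nhds]
  intro r hr
  have h := isCompact_univ.eventually_forall_of_forall_eventually (x₀ := r)
    (P := fun r X => H X < H (X + r.1) + r.2) (K := (univ : Set (UnitAddTorus (Fin d))))
    fun X _ => (isOpen_lt (f := fun z : (UnitAddTorus (Fin d) × ℝ) × UnitAddTorus (Fin d) => H z.2)
      (g := fun z => H (z.2 + z.1.1) + z.1.2) (by fun_prop) (by fun_prop)).mem_nhds (hr X)
  filter_upwards [h] with s hs X
  exact hs X (mem_univ X)

lemma up_mem_inwardShifts {δ : ℝ} (hδ : 0 < δ) :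
    ((0, δ) : UnitAddTorus (Fin d) × ℝ) ∈ inwardShifts H := fun X => by simpa using hδ

lemma add_mem_layerDomain {p r : UnitAddTorus (Fin d) × ℝ} (hp : p ∈ layerDomain H)
    (hr : r ∈ inwardShifts H) : r + p ∈ layerDomain H := by
  have h1 : -H p.1 < p.2 := hp
  have h2 := hr p.1
  change -H (r.1 + p.1) < r.2 + p.2
  rw [add_comm r.1]
  linarith

lemma partialX_comp_sub_right (l : Fin d) (p q : UnitAddTorus (Fin d) × ℝ) :
    partialX l (fun q => k (q - p)) q = partialX l k (q - p) := by
  unfold partialX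
  congr 1; ext t
  refine congrArg k (Prod.ext ?_ rfl)
  simp only [Prod.fst_sub]
  abel

lemma partialY_comp_sub_right (p q : UnitAddTorus (Fin d) × ℝ) :
    partialY (fun q => k (q - p)) q = partialY k (q - p) := by
  have h := deriv_comp_sub_const (fun t => k (q.1 - p.1, t)) p.2 q.2
  exact h

lemma partialX_comp_const_sub (l : Fin d) (p q : UnitAddTorus (Fin d) × ℝ) :
    partialX l (fun p => k (q - p)) p = -partialX l k (q - p) := by
  have h := deriv_comp_neg
    (fun t : ℝ => k ((q - p).1 + Pi.single l (t : UnitAddCircle), (q - p).2)) 0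
  rw [neg_zero] at h
  unfold partialX
  rw [← h]
  congr 1; ext t
  refine congrArg k (Prod.ext ?_ rfl)
  simp only [Prod.fst_sub, AddCircle.coe_neg, Pi.single_neg]
  abel

lemma partialY_comp_const_sub (p q : UnitAddTorus (Fin d) × ℝ) :
    partialY (fun p => k (q - p)) p = -partialY k (q - p) :=
  deriv_comp_const_sub (fun t => k (q.1 - p.1, t)) q.2 p.2

lemma IsTest.comp_sub_right (hk : IsTest k) (p : UnitAddTorus (Fin d) × ℝ) :
    IsTest (fun q => k (q - p)) := by
  simp_rw [sub_eq_add_neg]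
  exact hk.comp_add (-p)

/-- The translated kernel is supported in p + tsupport k, which stays in the open layer because only
inward shifts occur. It is thus admissible for the weak gradient, without any approximation at the
boundary. -/
lemma tsupport_comp_sub_subset (hk : tsupport k ⊆ inwardShifts H)
    {p : UnitAddTorus (Fin d) × ℝ} (hp : p ∈ layerDomain H) :
    tsupport (fun q => k (q - p)) ⊆ layerDomain H := by
  intro q hq
  have h1 : q ∈ tsupport (k ∘ Homeomorph.subRight p) := hq
  rw [tsupport_comp_eq_preimage] at h1
  have h2 := add_mem_layerDomain hp (hk h1)
  simpa using h2

lemma integral_layerMeasure_mul (hH : Continuous H) (f g : UnitAddTorus (Fin d) × ℝ → ℝ) :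
    ∫ p, f p * g p ∂layerMeasure H = ∫ p, (layerDomain H).indicator f p * g p := by
  rw [layerMeasure, ← integral_indicator (measurableSet_layerDomain hH)]
  congr 1; ext p
  by_cases hp : p ∈ layerDomain H
  · rw [indicator_of_mem hp, indicator_of_mem hp]
  · rw [indicator_of_notMem hp, indicator_of_notMem hp, zero_mul]

/-- The weak gradient tested against translated kernels. -/
lemma IsWeakGradient.integral_comp_sub (hH : Continuous H) (hg : IsWeakGradient H T TX TY)
    (hk : IsTest k) (hs : tsupport k ⊆ inwardShifts H) {p : UnitAddTorus (Fin d) × ℝ}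
    (hp : p ∈ layerDomain H) :
    (∀ l, ∫ q, (layerDomain H).indicator T q * partialX l k (q - p)
        = -∫ q, (layerDomain H).indicator (TX l) q * k (q - p)) ∧
      ∫ q, (layerDomain H).indicator T q * partialY k (q - p)
        = -∫ q, (layerDomain H).indicator TY q * k (q - p) := by
  refine ⟨fun l => ?_, ?_⟩
  · have h := hg.weakX l _ (hk.comp_sub_right p) (tsupport_comp_sub_subset hs hp)
    simp_rw [partialX_comp_sub_right] at h
    rwa [integral_layerMeasure_mul hH, integral_layerMeasure_mul hH] at h
  · have h := hg.weakY _ (hk.comp_sub_right p) (tsupport_comp_sub_subset hs hp)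
    simp_rw [partialY_comp_sub_right] at h
    rwa [integral_layerMeasure_mul hH, integral_layerMeasure_mul hH] at h

lemma memLp_cutoff_mul {f : UnitAddTorus (Fin d) × ℝ → ℝ} {θ : ℝ → ℝ} {R C : ℝ}
    (hf : MemLp f 2 ((layerMeasure H).restrict {p | p.2 < R})) (hθ : Continuous θ)
    (hC : ∀ Y, |θ Y| ≤ C) (hR : ∀ Y, R ≤ Y → θ Y = 0) :
    MemLp (fun p => θ p.2 * f p) 2 (layerMeasure H) := by
  have hm : MeasurableSet {p : UnitAddTorus (Fin d) × ℝ | p.2 < R} :=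
    measurableSet_lt measurable_snd measurable_const
  have e : (fun p : UnitAddTorus (Fin d) × ℝ => θ p.2 * f p)
      = {p : UnitAddTorus (Fin d) × ℝ | p.2 < R}.indicator fun p => θ p.2 * f p := by
    ext p
    by_cases hp : p.2 < R
    · simp [indicator, hp]
    · simp [indicator, hp, hR p.2 (not_lt.1 hp)]
  rw [e, memLp_indicator_iff_restrict hm]
  refine hf.of_le_mul (c := C) ((hθ.comp continuous_snd).aestronglyMeasurable.mul
    hf.aestronglyMeasurable) (Eventually.of_forall fun p => ?_)
  rw [norm_mul]
  exact mul_le_mul_of_nonneg_right (hC _) (norm_nonneg _)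

end InteriorShifts

/-! ### Moving derivatives onto correlated functions -/

section CorrelationLayer

open Set Filter
open scoped Topology

variable {E : Type*} [AddCommGroup E] [TopologicalSpace E] [IsTopologicalAddGroup E]
  [MeasurableSpace E] [BorelSpace E] [SecondCountableTopology E] [LocallyCompactSpace E]
  [T2Space E] {μ : Measure E} [μ.IsAddHaarMeasure] {f g κ : E → ℝ}

lemma integrable_mul_integral_comp_sub (hf : MemLp f 2 μ) (hg : MemLp g 2 μ) (hκ : Continuous κ)
    (hc : HasCompactSupport κ) : Integrable (fun q => g q * ∫ p, f p * κ (q - p) ∂μ) μ := by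
  refine (integrable_mul_mul_comp_sub hf hg hκ hc).integral_prod_right.congr
    (Eventually.of_forall fun q => ?_)
  simp only
  rw [← integral_const_mul]
  congr 1; ext p; ring

/-- Exchanging the integrals lets the hypothesis act in q for each p with f p ≠ 0. In use, κ is a
derivative of u and v the weak derivative of g. -/
lemma integral_mul_crossCorr_eq (hf : MemLp f 2 μ) {u v : E → ℝ} (hg : MemLp g 2 μ)
    (hv : MemLp v 2 μ) (hκ : Continuous κ) (hc : HasCompactSupport κ) (hu : Continuous u)
    (huc : HasCompactSupport u)
    (h : ∀ p, f p ≠ 0 → ∫ q, g q * κ (q - p) ∂μ = -∫ q, v q * u (q - p) ∂μ) :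
    ∫ q, g q * ∫ p, f p * κ (q - p) ∂μ ∂μ = -∫ r, u r * crossCorr μ f v r ∂μ := by
  rw [integral_mul_integral_comp_sub_swap hf hg hκ hc, ← integral_mul_integral_comp_sub hf hv hu huc,
    ← integral_neg]
  refine integral_congr_ae (Eventually.of_forall fun p => ?_)
  by_cases hp : f p = 0
  · simp [hp]
  · simp only [h p hp, mul_neg]

end CorrelationLayer

/-! ### The localized energy identity -/

section EnergyIdentity

open Set Filter
open scoped Topology

variable {d : ℕ} {H : UnitAddTorus (Fin d) → ℝ} {T TY : UnitAddTorus (Fin d) × ℝ → ℝ}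
  {TX : Fin d → UnitAddTorus (Fin d) × ℝ → ℝ}

lemma memLp_indicator_layerDomain (hH : Continuous H) {f : UnitAddTorus (Fin d) × ℝ → ℝ}
    (hf : MemLp f 2 (layerMeasure H)) : MemLp ((layerDomain H).indicator f) 2 volume :=
  (memLp_indicator_iff_restrict (measurableSet_layerDomain hH)).2 hf

/-- The zero shift is not inward, but it is the limit of the upward shifts (0, δ), which are. -/
lemma eq_zero_of_up_eq_zero {h : UnitAddTorus (Fin d) × ℝ → ℝ} (hc : Continuous h)
    (h0 : ∀ δ : ℝ, 0 < δ → δ < 1 → h (0, δ) = 0) : h 0 = 0 := by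
  have h1 : Tendsto (fun δ : ℝ => h (0, δ)) (𝓝[>] 0) (𝓝 (h (0, 0))) :=
    ((hc.comp (by fun_prop : Continuous fun δ : ℝ =>
      ((0, δ) : UnitAddTorus (Fin d) × ℝ))).tendsto 0).mono_left nhdsWithin_le_nhds
  have h2 : Tendsto (fun δ : ℝ => h (0, δ)) (𝓝[>] 0) (𝓝 0) := by
    refine tendsto_const_nhds.congr' ?_
    filter_upwards [Ioo_mem_nhdsGT (zero_lt_one' ℝ)] with δ hδ
    exact (h0 δ hδ.1 hδ.2).symm
  exact tendsto_nhds_unique h1 h2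

/-- The weak form of a harmonic function with zero flux, tested against a localized shift. -/
lemma weak_eq_comp_const_sub (hH : Continuous H) {θ : ℝ → ℝ} (hθ : ContDiff ℝ ∞ θ)
    (hfX : ∀ l, MemLp (fun p => θ p.2 * TX l p) 2 (layerMeasure H))
    (hfY : MemLp (fun p => θ p.2 * TY p) 2 (layerMeasure H))
    (he : MemLp (fun p => deriv θ p.2 * TY p) 2 (layerMeasure H))
    (hw : ∀ φ, IsTest φ →
      ∫ p, ((∑ l, TX l p * partialX l φ p) + TY p * partialY φ p) ∂layerMeasure H = 0)
    {k : UnitAddTorus (Fin d) × ℝ → ℝ} (hk : IsTest k) (q : UnitAddTorus (Fin d) × ℝ) :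
    (∑ l, ∫ p, (layerDomain H).indicator (fun p => θ p.2 * TX l p) p * partialX l k (q - p))
      + ∫ p, (layerDomain H).indicator (fun p => θ p.2 * TY p) p * partialY k (q - p)
      = ∫ p, (layerDomain H).indicator (fun p => deriv θ p.2 * TY p) p * k (q - p) := by
  -- No condition on the support of `k` is needed here: test functions of the weak formulation may
  -- reach the boundary.
  have hφ : IsTest ((fun p => θ p.2) * fun p => k (q - p)) :=
    (hk.comp_const_sub q).mul_left (SmoothLift.of_snd hθ)
  have h := hw _ hφ
  have eX : ∀ l p, partialX l ((fun p => θ p.2) * fun p => k (q - p)) p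
      = -(θ p.2 * partialX l k (q - p)) := fun l p => by
    have := partialX_snd_mul (e := fun p => k (q - p)) θ l p
    rw [partialX_comp_const_sub, mul_neg] at this
    exact this
  have eY : ∀ p, partialY ((fun p => θ p.2) * fun p => k (q - p)) p
      = deriv θ p.2 * k (q - p) - θ p.2 * partialY k (q - p) := fun p => by
    rw [(SmoothLift.of_snd hθ).partialY_mul (hk.comp_const_sub q).lift, partialY_of_snd,
      partialY_comp_const_sub]
    ring
  simp_rw [eX, eY] at h
  have mk := (hk.comp_const_sub q).memLp_layerMeasure hH 2
  have iX : ∀ l, Integrable (fun p => θ p.2 * TX l p * partialX l k (q - p)) (layerMeasure H) :=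
    fun l => (hfX l).integrable_fun_mul
      (((hk.partialX l).comp_const_sub q).memLp_layerMeasure hH 2)
  have iY : Integrable (fun p => θ p.2 * TY p * partialY k (q - p)) (layerMeasure H) :=
    hfY.integrable_fun_mul ((hk.partialY.comp_const_sub q).memLp_layerMeasure hH 2)
  have iE : Integrable (fun p => deriv θ p.2 * TY p * k (q - p)) (layerMeasure H) :=
    he.integrable_fun_mul mk
  have e1 : ∀ p, (∑ l, TX l p * -(θ p.2 * partialX l k (q - p)))
      + TY p * (deriv θ p.2 * k (q - p) - θ p.2 * partialY k (q - p))
      = deriv θ p.2 * TY p * k (q - p) - ((∑ l, θ p.2 * TX l p * partialX l k (q - p))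
        + θ p.2 * TY p * partialY k (q - p)) := fun p => by
    have : ∑ l, TX l p * -(θ p.2 * partialX l k (q - p))
        = -∑ l, θ p.2 * TX l p * partialX l k (q - p) := by
      rw [← Finset.sum_neg_distrib]
      exact Finset.sum_congr rfl fun l _ => by ring
    rw [this]; ring
  simp_rw [e1] at h
  have iS := integrable_finsetSum Finset.univ fun l _ => iX l
  have iSY : Integrable (fun p => (∑ l, θ p.2 * TX l p * partialX l k (q - p))
      + θ p.2 * TY p * partialY k (q - p)) (layerMeasure H) := iS.add iY
  rw [integral_sub iE iSY, integral_add iS iY, integral_finsetSum _ fun l _ => iX l] at h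
  simp_rw [integral_layerMeasure_mul hH] at h
  linarith

/-- The localized energy identity for harmonic functions with zero flux. -/
theorem localized_energy_identity (hH : Continuous H) (hT : MemLp T 2 (layerMeasure H))
    (hF : ∀ R : ℝ, (∀ l, MemLp (TX l) 2 ((layerMeasure H).restrict {p | p.2 < R})) ∧
      MemLp TY 2 ((layerMeasure H).restrict {p | p.2 < R}))
    (hg : IsWeakGradient H T TX TY)
    (hw : ∀ φ, IsTest φ →
      ∫ p, ((∑ l, TX l p * partialX l φ p) + TY p * partialY φ p) ∂layerMeasure H = 0)
    {θ : ℝ → ℝ} (hθ : ContDiff ℝ ∞ θ) {R C : ℝ} (hC : ∀ Y, |θ Y| ≤ C)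
    (hC' : ∀ Y, |deriv θ Y| ≤ C) (hR : ∀ Y, R ≤ Y → θ Y = 0)
    (hR' : ∀ Y, R ≤ Y → deriv θ Y = 0) :
    (∑ l, ∫ p, θ p.2 * TX l p ^ 2 ∂layerMeasure H) + ∫ p, θ p.2 * TY p ^ 2 ∂layerMeasure H
      + ∫ p, deriv θ p.2 * TY p * T p ∂layerMeasure H = 0 := by
  have hdθ : Continuous (deriv θ) := hθ.continuous_deriv (by simp)
  have hfX := fun l => memLp_cutoff_mul ((hF R).1 l) hθ.continuous hC hR
  have hfY := memLp_cutoff_mul (hF R).2 hθ.continuous hC hR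
  have he := memLp_cutoff_mul (hF R).2 hdθ hC' hR'
  have hm : MeasurableSet {p : UnitAddTorus (Fin d) × ℝ | p.2 < R + 1} :=
    measurableSet_lt measurable_snd measurable_const
  have hgX : ∀ l, MemLp ({p : UnitAddTorus (Fin d) × ℝ | p.2 < R + 1}.indicator (TX l)) 2
      (layerMeasure H) := fun l => (memLp_indicator_iff_restrict hm).2 ((hF (R + 1)).1 l)
  have hgY : MemLp ({p : UnitAddTorus (Fin d) × ℝ | p.2 < R + 1}.indicator TY) 2
      (layerMeasure H) := (memLp_indicator_iff_restrict hm).2 (hF (R + 1)).2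
  have mfX := fun l => memLp_indicator_layerDomain hH (hfX l)
  have mfY := memLp_indicator_layerDomain hH hfY
  have me := memLp_indicator_layerDomain hH he
  have mgX := fun l => memLp_indicator_layerDomain hH (hgX l)
  have mgY := memLp_indicator_layerDomain hH hgY
  have mT := memLp_indicator_layerDomain hH hT
  set fX : Fin d → UnitAddTorus (Fin d) × ℝ → ℝ :=
    fun l => (layerDomain H).indicator fun p => θ p.2 * TX l p with hfXdef
  set fY := (layerDomain H).indicator fun p => θ p.2 * TY p with hfYdef
  set e := (layerDomain H).indicator fun p => deriv θ p.2 * TY p with hedef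
  set gX : Fin d → UnitAddTorus (Fin d) × ℝ → ℝ := fun l =>
    (layerDomain H).indicator ({p : UnitAddTorus (Fin d) × ℝ | p.2 < R + 1}.indicator (TX l))
    with hgXdef
  set gY := (layerDomain H).indicator
    ({p : UnitAddTorus (Fin d) × ℝ | p.2 < R + 1}.indicator TY) with hgYdef
  set T' := (layerDomain H).indicator T with hT'
  -- At r = 0 this is the left-hand side of the identity. For inward shifts of height below 1 it
  -- vanishes, because one kernel k(q - p) then tests both relations: the weak equation as a
  -- function of p, the weak gradient as a function of q.
  set h : UnitAddTorus (Fin d) × ℝ → ℝ := fun r => (∑ l, crossCorr volume (fX l) (gX l) r)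
    + crossCorr volume fY gY r + crossCorr volume e T' r with hh
  have cX := fun l => continuous_crossCorr (mfX l) (mgX l)
  have cY := continuous_crossCorr mfY mgY
  have cE := continuous_crossCorr me mT
  have hhc : Continuous h := ((continuous_finsetSum _ fun l _ => cX l).add cY).add cE
  have hO : IsOpen (inwardShifts H ∩ {r | r.2 < 1}) :=
    (isOpen_inwardShifts hH).inter (isOpen_lt continuous_snd continuous_const)
  have hzero : ∀ k, IsTest k → tsupport k ⊆ inwardShifts H ∩ {r | r.2 < 1} →
      ∫ r, k r * h r = 0 := by
    intro k hk hs
    have hs1 : tsupport k ⊆ inwardShifts H := hs.trans inter_subset_left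
    have hkX := fun l => hk.partialX l
    have hkY := hk.partialY
    -- Shifts of height below 1 move points under R only to points under R + 1. Truncating the
    -- gradient there changes nothing and makes it square integrable on the whole layer.
    have hcut : ∀ (f : UnitAddTorus (Fin d) × ℝ → ℝ) (p : UnitAddTorus (Fin d) × ℝ), p.2 < R →
        ∫ q, (layerDomain H).indicator f q * k (q - p)
          = ∫ q, (layerDomain H).indicator
            ({p : UnitAddTorus (Fin d) × ℝ | p.2 < R + 1}.indicator f) q * k (q - p) := by
      intro f p hp
      congr 1; ext q
      by_cases hq : q - p ∈ tsupport k
      · have h1 : q.2 - p.2 < 1 := (hs hq).2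
        have h2 : q ∈ {p : UnitAddTorus (Fin d) × ℝ | p.2 < R + 1} :=
          show q.2 < R + 1 by linarith
        by_cases hqD : q ∈ layerDomain H
        · rw [indicator_of_mem hqD, indicator_of_mem hqD, indicator_of_mem h2]
        · rw [indicator_of_notMem hqD, indicator_of_notMem hqD]
      · rw [image_eq_zero_of_notMem_tsupport hq, mul_zero, mul_zero]
    have hsup : ∀ (f : UnitAddTorus (Fin d) × ℝ → ℝ) (p : UnitAddTorus (Fin d) × ℝ),
        (layerDomain H).indicator (fun p => θ p.2 * f p) p ≠ 0 → p ∈ layerDomain H ∧ p.2 < R := by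
      intro f p hp
      have hpD : p ∈ layerDomain H := by
        by_contra hn; exact hp (indicator_of_notMem hn _)
      refine ⟨hpD, ?_⟩
      by_contra hn
      rw [indicator_of_mem hpD, hR p.2 (not_lt.1 hn), zero_mul] at hp
      exact hp rfl
    have e1 : ∀ l, ∫ q, T' q * ∫ p, fX l p * partialX l k (q - p)
        = -∫ r, k r * crossCorr volume (fX l) (gX l) r := fun l => by
      refine integral_mul_crossCorr_eq (mfX l) mT (mgX l) (hkX l).continuous (hkX l).compact
        hk.continuous hk.compact fun p hp => ?_
      obtain ⟨hpD, hpR⟩ := hsup _ p hp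
      rw [(hg.integral_comp_sub hH hk hs1 hpD).1 l, hcut _ p hpR]
    have e2 : ∫ q, T' q * ∫ p, fY p * partialY k (q - p)
        = -∫ r, k r * crossCorr volume fY gY r := by
      refine integral_mul_crossCorr_eq mfY mT mgY hkY.continuous hkY.compact
        hk.continuous hk.compact fun p hp => ?_
      obtain ⟨hpD, hpR⟩ := hsup _ p hp
      rw [(hg.integral_comp_sub hH hk hs1 hpD).2, hcut _ p hpR]
    have e3 : ∫ q, T' q * ∫ p, e p * k (q - p) = ∫ r, k r * crossCorr volume e T' r := by
      rw [integral_mul_integral_comp_sub_swap me mT hk.continuous hk.compact,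
        integral_mul_integral_comp_sub me mT hk.continuous hk.compact]
    have iX := fun l => integrable_mul_integral_comp_sub (mfX l) mT (hkX l).continuous
      (hkX l).compact
    have iY := integrable_mul_integral_comp_sub mfY mT hkY.continuous hkY.compact
    -- The weak equation in p, for each q, integrated against T(q).
    have e4 : (∑ l, ∫ q, T' q * ∫ p, fX l p * partialX l k (q - p))
        + ∫ q, T' q * ∫ p, fY p * partialY k (q - p) = ∫ q, T' q * ∫ p, e p * k (q - p) := by
      rw [← integral_finsetSum _ fun l _ => iX l,
        ← integral_add (integrable_finsetSum _ fun l _ => iX l) iY]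
      congr 1; ext q
      rw [← weak_eq_comp_const_sub hH hθ hfX hfY he hw hk q, mul_add, Finset.mul_sum]
    have jk : ∀ c : UnitAddTorus (Fin d) × ℝ → ℝ, Continuous c →
        Integrable (fun r => k r * c r) volume := fun c hc =>
      (hk.continuous.mul hc).integrable_of_hasCompactSupport hk.compact.mul_right
    simp only [hh, mul_add, Finset.mul_sum]
    have jS := integrable_finsetSum Finset.univ fun l _ => jk _ (cX l)
    have jSY : Integrable (fun r => (∑ l, k r * crossCorr volume (fX l) (gX l) r)
        + k r * crossCorr volume fY gY r) volume := jS.add (jk _ cY)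
    rw [integral_add jSY (jk _ cE), integral_add jS (jk _ cY),
      integral_finsetSum _ fun l _ => jk _ (cX l), ← e3, ← e4, e2]
    simp_rw [e1]
    rw [Finset.sum_neg_distrib]
    ring
  have h0 : h 0 = 0 := eq_zero_of_up_eq_zero hhc fun δ hδ hδ1 =>
    eq_zero_of_integral_isTest_eq_zero hhc hO hzero _ ⟨up_mem_inwardShifts hδ, hδ1⟩
  have hfin : ∀ f : UnitAddTorus (Fin d) × ℝ → ℝ,
      crossCorr volume ((layerDomain H).indicator fun p => θ p.2 * f p) ((layerDomain H).indicator
        ({p : UnitAddTorus (Fin d) × ℝ | p.2 < R + 1}.indicator f)) 0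
        = ∫ p, θ p.2 * f p ^ 2 ∂layerMeasure H := by
    intro f
    rw [layerMeasure, ← integral_indicator (measurableSet_layerDomain hH)]
    unfold crossCorr
    congr 1; ext p
    rw [add_zero]
    by_cases hp : p ∈ layerDomain H
    · rw [indicator_of_mem hp, indicator_of_mem hp, indicator_of_mem hp]
      by_cases hpR : p.2 < R + 1
      · rw [indicator_of_mem (show p ∈ {p : UnitAddTorus (Fin d) × ℝ | p.2 < R + 1} from hpR)]
        ring
      · rw [hR p.2 (by linarith [not_lt.1 hpR])]; ring
    · rw [indicator_of_notMem hp, indicator_of_notMem hp, indicator_of_notMem hp, zero_mul]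
  have hfinE : crossCorr volume e T' 0 = ∫ p, deriv θ p.2 * TY p * T p ∂layerMeasure H := by
    rw [integral_layerMeasure_mul hH]
    unfold crossCorr
    congr 1; ext p
    rw [add_zero, hedef, hT']
    by_cases hp : p ∈ layerDomain H
    · rw [indicator_of_mem hp, indicator_of_mem hp]
    · rw [indicator_of_notMem hp, zero_mul, zero_mul]
  simp only [hh, hfXdef, hgXdef, hfYdef, hgYdef, hfin, hfinE] at h0
  exact h0

end EnergyIdentity

/-! ### Caccioppoli inequality and vanishing of the vertical derivative -/

section Caccioppoli

open Set Filter
open scoped Topology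

variable {d : ℕ} {H : UnitAddTorus (Fin d) → ℝ} {T TY : UnitAddTorus (Fin d) × ℝ → ℝ}
  {TX : Fin d → UnitAddTorus (Fin d) × ℝ → ℝ}

/-- A smooth cutoff which is `1` up to `1` and vanishes from `2` on. -/
def dropCutoff (t : ℝ) : ℝ := Real.smoothTransition (2 - t)

lemma contDiff_dropCutoff : ContDiff ℝ ∞ dropCutoff :=
  Real.smoothTransition.contDiff.comp (contDiff_const.sub contDiff_id)

lemma dropCutoff_of_le_one {t : ℝ} (ht : t ≤ 1) : dropCutoff t = 1 :=
  Real.smoothTransition.one_of_one_le (by linarith)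

lemma dropCutoff_of_two_le {t : ℝ} (ht : 2 ≤ t) : dropCutoff t = 0 :=
  Real.smoothTransition.zero_of_nonpos (by linarith)

lemma abs_dropCutoff_le (t : ℝ) : |dropCutoff t| ≤ 1 := by
  rw [dropCutoff, abs_of_nonneg (Real.smoothTransition.nonneg _)]
  exact Real.smoothTransition.le_one _

/-- The zero set of the continuous derivative is closed, which includes the endpoint t = 1. -/
lemma deriv_dropCutoff_of_le_one {t : ℝ} (ht : t ≤ 1) : deriv dropCutoff t = 0 := by
  have hc : Continuous (deriv dropCutoff) := contDiff_dropCutoff.continuous_deriv (by simp)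
  have h : Iio (1 : ℝ) ⊆ {t | deriv dropCutoff t = 0} := fun t (ht : t < 1) => by
    have e : dropCutoff =ᶠ[𝓝 t] fun _ => 1 := by
      filter_upwards [Iio_mem_nhds ht] with u hu using dropCutoff_of_le_one (le_of_lt hu)
    simpa using e.deriv_eq
  have h1 := closure_minimal h (isClosed_eq hc continuous_const)
  rw [closure_Iio] at h1
  exact h1 ht

lemma deriv_dropCutoff_of_two_le {t : ℝ} (ht : 2 ≤ t) : deriv dropCutoff t = 0 := by
  have hc : Continuous (deriv dropCutoff) := contDiff_dropCutoff.continuous_deriv (by simp)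
  have h : Ioi (2 : ℝ) ⊆ {t | deriv dropCutoff t = 0} := fun t (ht : 2 < t) => by
    have e : dropCutoff =ᶠ[𝓝 t] fun _ => 0 := by
      filter_upwards [Ioi_mem_nhds ht] with u hu using dropCutoff_of_two_le (le_of_lt hu)
    simpa using e.deriv_eq
  have h1 := closure_minimal h (isClosed_eq hc continuous_const)
  rw [closure_Ioi] at h1
  exact h1 ht

lemma exists_abs_deriv_dropCutoff_le : ∃ B, 0 ≤ B ∧ ∀ t, |deriv dropCutoff t| ≤ B := by
  have hc : Continuous (deriv dropCutoff) := contDiff_dropCutoff.continuous_deriv (by simp)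
  obtain ⟨B, hB⟩ := (isCompact_Icc (a := (1 : ℝ)) (b := 2)).exists_bound_of_continuousOn
    hc.continuousOn
  refine ⟨|B|, abs_nonneg B, fun t => ?_⟩
  rcases le_total t 1 with h1 | h1
  · rw [deriv_dropCutoff_of_le_one h1, abs_zero]; exact abs_nonneg B
  rcases le_total t 2 with h2 | h2
  · exact (hB t ⟨h1, h2⟩).trans (le_abs_self B)
  · rw [deriv_dropCutoff_of_two_le h2, abs_zero]; exact abs_nonneg B

/-- The Caccioppoli inequality for the vertical derivative. -/
lemma integral_sq_cutoff_le (hH : Continuous H) (hT : MemLp T 2 (layerMeasure H))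
    (hF : ∀ R : ℝ, (∀ l, MemLp (TX l) 2 ((layerMeasure H).restrict {p | p.2 < R})) ∧
      MemLp TY 2 ((layerMeasure H).restrict {p | p.2 < R}))
    (hg : IsWeakGradient H T TX TY)
    (hw : ∀ φ, IsTest φ →
      ∫ p, ((∑ l, TX l p * partialX l φ p) + TY p * partialY φ p) ∂layerMeasure H = 0)
    {B : ℝ} (hB0 : 0 ≤ B) (hB : ∀ t, |deriv dropCutoff t| ≤ B) {R : ℝ} (hR : 0 < R) :
    Integrable (fun p => (dropCutoff (p.2 / R) * TY p) ^ 2) (layerMeasure H) ∧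
    ∫ p, (dropCutoff (p.2 / R) * TY p) ^ 2 ∂layerMeasure H
      ≤ 4 * (B / R) ^ 2 * ∫ p, T p ^ 2 ∂layerMeasure H := by
  set χ : ℝ → ℝ := fun Y => dropCutoff (Y / R) with hχ
  have hχs : ContDiff ℝ ∞ χ := contDiff_dropCutoff.comp (contDiff_id.div_const R)
  have hχd : ∀ Y, deriv χ Y = deriv dropCutoff (Y / R) / R := fun Y => by
    have h1 : HasDerivAt dropCutoff (deriv dropCutoff (Y / R)) (Y / R) :=
      (contDiff_dropCutoff.differentiable (by simp) _).hasDerivAt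
    have h2 := h1.comp Y ((hasDerivAt_id Y).div_const R)
    have h3 : deriv χ Y = _ := h2.deriv
    rw [h3]; simp [div_eq_mul_inv]
  have hχ1 : ∀ Y, |χ Y| ≤ 1 := fun Y => abs_dropCutoff_le _
  have hχ0 : ∀ Y, 2 * R ≤ Y → χ Y = 0 := fun Y hY =>
    dropCutoff_of_two_le (by rwa [le_div_iff₀ hR])
  have hχB : ∀ Y, |deriv χ Y| ≤ B / R := fun Y => by
    rw [hχd, abs_div, abs_of_pos hR]
    exact div_le_div_of_nonneg_right (hB _) hR.le
  -- With a square as cutoff, θ' = 2χχ' keeps a factor χ next to ∂_Y T, so Young's inequality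
  -- absorbs that term into the energy.
  set θ : ℝ → ℝ := fun Y => χ Y ^ 2 with hθ
  have hθs : ContDiff ℝ ∞ θ := hχs.pow 2
  have hθd : ∀ Y, deriv θ Y = 2 * χ Y * deriv χ Y := fun Y => by
    have h1 : HasDerivAt χ (deriv χ Y) Y := (hχs.differentiable (by simp) _).hasDerivAt
    have h2 := h1.pow 2
    have h3 : deriv θ Y = _ := h2.deriv
    rw [h3]; simp
  have hBR : 0 ≤ B / R := div_nonneg hB0 hR.le
  have hθ1 : ∀ Y, |θ Y| ≤ 1 + 2 * (B / R) := fun Y => by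
    have h1 : |θ Y| = |χ Y| ^ 2 := abs_pow _ _
    have := pow_le_one₀ (n := 2) (abs_nonneg _) (hχ1 Y)
    linarith
  have hθ2 : ∀ Y, |deriv θ Y| ≤ 1 + 2 * (B / R) := fun Y => by
    rw [hθd, abs_mul, abs_mul, abs_two]
    have := mul_le_mul (hχ1 Y) (hχB Y) (abs_nonneg _) zero_le_one
    linarith
  have hθ3 : ∀ Y, 2 * R ≤ Y → deriv θ Y = 0 := fun Y hY => by
    rw [hθd, hχ0 Y hY]; ring
  have hE := localized_energy_identity hH hT hF hg hw hθs hθ1 hθ2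
    (fun Y hY => by simp only [hθ, hχ0 Y hY]; norm_num) hθ3
  have iE := (memLp_cutoff_mul (hF (2 * R)).2 (hθs.continuous_deriv (by simp)) hθ2
    hθ3).integrable_fun_mul hT
  have mχ := memLp_cutoff_mul (hF (2 * R)).2 hχs.continuous hχ1 hχ0
  have i1 := mχ.integrable_sq
  have i2 := hT.integrable_sq
  refine ⟨i1, ?_⟩
  -- The horizontal energy is discarded; the vertical derivative alone suffices for uniqueness.
  have hX : 0 ≤ ∑ l, ∫ p, θ p.2 * TX l p ^ 2 ∂layerMeasure H :=
    Finset.sum_nonneg fun l _ => integral_nonneg fun p =>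
      mul_nonneg (sq_nonneg _) (sq_nonneg _)
  have e1 : ∫ p, θ p.2 * TY p ^ 2 ∂layerMeasure H
      = ∫ p, (χ p.2 * TY p) ^ 2 ∂layerMeasure H := by
    congr 1; ext p; simp only [hθ]; ring
  have hb : -∫ p, deriv θ p.2 * TY p * T p ∂layerMeasure H
      ≤ ∫ p, (1 / 2 * (χ p.2 * TY p) ^ 2 + 2 * (B / R) ^ 2 * T p ^ 2) ∂layerMeasure H := by
    rw [← integral_neg]
    refine integral_mono iE.neg ((i1.const_mul _).add (i2.const_mul _)) fun p => ?_
    simp only [hθd]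
    have h1 : deriv χ p.2 ^ 2 ≤ (B / R) ^ 2 := sq_le_sq' (by linarith [(abs_le.1 (hχB p.2)).1])
      (abs_le.1 (hχB p.2)).2
    nlinarith [sq_nonneg (χ p.2 * TY p + 2 * (deriv χ p.2 * T p)),
      mul_le_mul_of_nonneg_right h1 (sq_nonneg (T p))]
  rw [integral_add (i1.const_mul _) (i2.const_mul _), integral_const_mul, integral_const_mul] at hb
  rw [e1] at hE
  change ∫ p, (χ p.2 * TY p) ^ 2 ∂layerMeasure H ≤ _
  linarith

/-- A harmonic function with zero flux has no vertical derivative. -/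
lemma partialY_ae_eq_zero (hH : Continuous H) (hT : MemLp T 2 (layerMeasure H))
    (hF : ∀ R : ℝ, (∀ l, MemLp (TX l) 2 ((layerMeasure H).restrict {p | p.2 < R})) ∧
      MemLp TY 2 ((layerMeasure H).restrict {p | p.2 < R}))
    (hg : IsWeakGradient H T TX TY)
    (hw : ∀ φ, IsTest φ →
      ∫ p, ((∑ l, TX l p * partialX l φ p) + TY p * partialY φ p) ∂layerMeasure H = 0) :
    TY =ᵐ[layerMeasure H] 0 := by
  obtain ⟨B, hB0, hB⟩ := exists_abs_deriv_dropCutoff_le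
  have hm : ∀ R : ℝ, MeasurableSet {p : UnitAddTorus (Fin d) × ℝ | p.2 < R} := fun R =>
    measurableSet_lt measurable_snd measurable_const
  have key : ∀ n : ℕ, ∀ᵐ p ∂layerMeasure H, p ∈ {p : UnitAddTorus (Fin d) × ℝ | p.2 < n} →
      TY p = 0 := by
    intro n
    rw [← ae_restrict_iff' (hm n)]
    have i0 := (hF n).2.integrable_sq
    have h1 : ∀ R : ℝ, 0 < R → (n : ℝ) ≤ R →
        ∫ p, TY p ^ 2 ∂(layerMeasure H).restrict {p | p.2 < n}
          ≤ 4 * (B / R) ^ 2 * ∫ p, T p ^ 2 ∂layerMeasure H := by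
      intro R hR hn
      obtain ⟨i1, h⟩ := integral_sq_cutoff_le hH hT hF hg hw hB0 hB hR
      refine le_trans (le_of_eq ?_) ((setIntegral_le_integral
        (s := {p : UnitAddTorus (Fin d) × ℝ | p.2 < (n : ℝ)}) i1
        (Eventually.of_forall fun p => sq_nonneg _)).trans h)
      refine setIntegral_congr_fun (hm n) fun p hp => ?_
      have : p.2 < n := hp
      rw [dropCutoff_of_le_one ((div_le_one hR).2 (by linarith)), one_mul]
    -- T is square integrable on the whole layer, so the bound vanishes as the cutoff moves to
    -- infinity.
    have h2 : Tendsto (fun R : ℝ => 4 * (B / R) ^ 2 * ∫ p, T p ^ 2 ∂layerMeasure H) atTop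
        (𝓝 0) := by
      have h3 : Tendsto (fun R : ℝ => B / R) atTop (𝓝 0) := tendsto_const_nhds.div_atTop tendsto_id
      simpa using ((h3.pow 2).const_mul 4).mul_const (∫ p, T p ^ 2 ∂layerMeasure H)
    have h4 : ∫ p, TY p ^ 2 ∂(layerMeasure H).restrict {p | p.2 < n} ≤ 0 := by
      refine ge_of_tendsto h2 ?_
      filter_upwards [eventually_gt_atTop 0, eventually_ge_atTop (n : ℝ)] with R hR hn
      exact h1 R hR hn
    have h5 := (integral_eq_zero_iff_of_nonneg (fun p => sq_nonneg (TY p)) i0).1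
      (le_antisymm h4 (integral_nonneg fun p => sq_nonneg _))
    filter_upwards [h5] with p hp
    exact pow_eq_zero_iff two_ne_zero |>.1 hp
  filter_upwards [ae_all_iff.2 key] with p hp
  obtain ⟨n, hn⟩ := exists_nat_gt p.2
  exact hp n hn

end Caccioppoli

/-! ### Autocorrelation under upward shifts -/

section VerticalRigidity

open Set Filter
open scoped Topology

variable {d : ℕ} {H : UnitAddTorus (Fin d) → ℝ} {T TY : UnitAddTorus (Fin d) × ℝ → ℝ}
  {TX : Fin d → UnitAddTorus (Fin d) × ℝ → ℝ}

lemma hasDerivAt_comp_sub_up {k : UnitAddTorus (Fin d) × ℝ → ℝ} (hk : IsTest k)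
    (r : UnitAddTorus (Fin d) × ℝ) (t : ℝ) :
    HasDerivAt (fun t : ℝ => k (r - (0, t))) (-partialY k (r - (0, t))) t := by
  have h1 : HasDerivAt (fun y : ℝ => k (r.1, y)) (partialY k (r.1, r.2 - t)) (r.2 - t) :=
    SmoothLift.hasDerivAt_snd hk.lift r.1 _
  have h2 := h1.comp t ((hasDerivAt_id t).const_sub r.2)
  simpa [Function.comp_def, Prod.mk_sub_mk, Prod.sub_def] using h2

lemma tsupport_comp_sub_up_subset {k : UnitAddTorus (Fin d) × ℝ → ℝ}
    (hs : tsupport k ⊆ inwardShifts H) {t : ℝ} (ht : 0 ≤ t) :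
    tsupport (fun r => k (r - (0, t))) ⊆ inwardShifts H := by
  intro r hr
  have h1 : r ∈ tsupport (k ∘ Homeomorph.subRight (0, t)) := hr
  rw [tsupport_comp_eq_preimage] at h1
  intro X
  have h2 : H X < H (X + (r.1 - 0)) + (r.2 - t) := hs h1 X
  rw [sub_zero] at h2
  linarith

/-- If the vertical derivative of `c` vanishes weakly on the set of inward shifts, then `c` does
not change under upward translations there. -/
lemma eq_add_up_of_weak_partialY_eq_zero (hH : Continuous H) {c : UnitAddTorus (Fin d) × ℝ → ℝ}
    (hc : Continuous c)
    (h0 : ∀ k, IsTest k → tsupport k ⊆ inwardShifts H → ∫ r, partialY k r * c r = 0)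
    {r : UnitAddTorus (Fin d) × ℝ} (hr : r ∈ inwardShifts H) {s : ℝ} (hs : 0 ≤ s) :
    c r = c (r + (0, s)) := by
  have hcs : Continuous fun r : UnitAddTorus (Fin d) × ℝ => c (r + (0, s)) :=
    hc.comp (continuous_add_const _)
  refine sub_eq_zero.1 (eq_zero_of_integral_isTest_eq_zero (h := fun r => c r - c (r + (0, s)))
    (hc.sub hcs) (isOpen_inwardShifts hH) (fun k hk hks => ?_) r hr)
  have hk1 : IsTest fun r => k (r - (0, s)) := hk.comp_sub_right _
  have hdk := hk.partialY
  have i1 : Integrable fun r => k r * c r :=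
    (hk.continuous.mul hc).integrable_of_hasCompactSupport hk.compact.mul_right
  have i2 : Integrable fun r => k r * c (r + (0, s)) :=
    (hk.continuous.mul hcs).integrable_of_hasCompactSupport hk.compact.mul_right
  have i3 : Integrable fun r => k (r - (0, s)) * c r :=
    (hk1.continuous.mul hc).integrable_of_hasCompactSupport hk1.compact.mul_right
  have e1 : ∫ r, k r * c (r + (0, s)) = ∫ r, k (r - (0, s)) * c r := by
    rw [← integral_add_right_eq_self (fun r => k (r - (0, s)) * c r)
      ((0, s) : UnitAddTorus (Fin d) × ℝ)]
    simp
  -- The difference between `k` and its upward translate is the integral of ∂_Y over the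
  -- intermediate translates. These keep their support among the inward shifts, so the hypothesis
  -- annihilates each of them.
  have e2 : ∀ r, ∫ t in (0 : ℝ)..s, partialY k (r - (0, t)) * c r
      = (k r - k (r - (0, s))) * c r := fun r => by
    rw [intervalIntegral.integral_mul_const]
    have hcont : Continuous fun t : ℝ => -partialY k (r - (0, t)) :=
      (hdk.continuous.comp (by fun_prop : Continuous fun t : ℝ =>
        r - ((0, t) : UnitAddTorus (Fin d) × ℝ))).neg
    have h := intervalIntegral.integral_eq_sub_of_hasDerivAt
      (fun t _ => hasDerivAt_comp_sub_up hk r t) (hcont.intervalIntegrable 0 s)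
    rw [intervalIntegral.integral_neg] at h
    have h00 : r - ((0, (0 : ℝ)) : UnitAddTorus (Fin d) × ℝ) = r := sub_zero r
    rw [h00] at h
    congr 1
    linarith
  have hF : Continuous fun z : (UnitAddTorus (Fin d) × ℝ) × ℝ =>
      partialY k (z.1 - (0, z.2)) * c z.1 :=
    (hdk.continuous.comp (by fun_prop : Continuous fun z : (UnitAddTorus (Fin d) × ℝ) × ℝ =>
        z.1 - ((0, z.2) : UnitAddTorus (Fin d) × ℝ))).mul (hc.comp continuous_fst)
  have hK : IsCompact ((fun z : (UnitAddTorus (Fin d) × ℝ) × ℝ => (z.1 + (0, z.2), z.2)) ''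
      (tsupport (partialY k) ×ˢ Icc 0 s)) :=
    (hdk.compact.prod isCompact_Icc).image (by fun_prop)
  have hFi : Integrable (fun z : (UnitAddTorus (Fin d) × ℝ) × ℝ =>
      partialY k (z.1 - (0, z.2)) * c z.1)
      ((volume : Measure (UnitAddTorus (Fin d) × ℝ)).prod (volume.restrict (Ioc 0 s))) := by
    have h := Measure.prod_restrict (μ := (volume : Measure (UnitAddTorus (Fin d) × ℝ)))
      (ν := (volume : Measure ℝ)) univ (Ioc 0 s)
    rw [Measure.restrict_univ] at h
    rw [h]
    refine (hF.continuousOn.integrableOn_compact hK).of_forall_sdiff_eq_zero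
      (MeasurableSet.univ.prod measurableSet_Ioc) fun z hz => ?_
    by_contra hn
    refine hz.2 ⟨(z.1 - (0, z.2), z.2), ⟨?_, Ioc_subset_Icc_self hz.1.2⟩, by simp⟩
    by_contra hn2
    exact hn (by rw [image_eq_zero_of_notMem_tsupport hn2, zero_mul])
  have e3 := integral_integral_swap (f := fun r t => partialY k (r - (0, t)) * c r) hFi
  simp_rw [← intervalIntegral.integral_of_le hs, e2] at e3
  have e4 : ∀ t ∈ uIcc 0 s, ∫ r, partialY k (r - (0, t)) * c r = 0 := fun t ht => by
    rw [uIcc_of_le hs] at ht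
    have h := h0 _ (hk.comp_sub_right (0, t)) (tsupport_comp_sub_up_subset hks ht.1)
    simp_rw [partialY_comp_sub_right] at h
    exact h
  rw [intervalIntegral.integral_congr (g := fun _ => (0 : ℝ)) e4] at e3
  simp only [intervalIntegral.integral_zero, sub_mul] at e3
  simp only [mul_sub]
  rw [integral_sub i1 i2, e1, ← integral_sub i1 i3]
  exact e3

/-- The autocorrelation of a square integrable function on the layer decays upwards. -/
lemma tendsto_crossCorr_up (hH : Continuous H) {f : UnitAddTorus (Fin d) × ℝ → ℝ}
    (hf : MemLp f 2 volume) (h0 : ∀ p, p ∉ layerDomain H → f p = 0) :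
    Tendsto (fun s : ℝ => crossCorr volume f f (0, s)) atTop (𝓝 0) := by
  obtain ⟨b, hb⟩ := (isCompact_univ.image hH).bddAbove
  have hb' : ∀ X, H X ≤ b := fun X => hb ⟨X, mem_univ X, rfl⟩
  have hm : ∀ a : ℝ, MeasurableSet {p : UnitAddTorus (Fin d) × ℝ | a < p.2} := fun a =>
    measurableSet_lt measurable_const measurable_snd
  have hsq := hf.integrable_sq
  have htail : Tendsto (fun s : ℝ => ∫ p in {p : UnitAddTorus (Fin d) × ℝ | s - b < p.2}, f p ^ 2)
      atTop (𝓝 0) := by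
    simp_rw [← integral_indicator (hm _)]
    have := tendsto_integral_filter_of_dominated_convergence (l := (atTop : Filter ℝ))
      (F := fun s : ℝ => {p : UnitAddTorus (Fin d) × ℝ | s - b < p.2}.indicator fun p => f p ^ 2)
      (f := fun _ => (0 : ℝ)) (fun p => f p ^ 2)
      (Eventually.of_forall fun s => hsq.aestronglyMeasurable.indicator (hm _))
      (Eventually.of_forall fun s => Eventually.of_forall fun p => by
        refine (norm_indicator_le_norm_self _ _).trans ?_
        rw [Real.norm_of_nonneg (sq_nonneg _)]) hsq
      (Eventually.of_forall fun p => by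
        refine tendsto_const_nhds.congr' ?_
        filter_upwards [eventually_ge_atTop (p.2 + b)] with s hs
        rw [indicator_of_notMem]
        exact not_lt.2 (by linarith : p.2 ≤ s - b))
    simpa using this
  -- Points of the layer lie above -b, so shifted ones lie above s - b. Young's inequality with
  -- weight ε leaves a small multiple of ‖f‖² and a tail that vanishes as s grows.
  have hbound : ∀ ε : ℝ, 0 < ε → ∀ s : ℝ, |crossCorr volume f f (0, s)|
      ≤ ε * (∫ p, f p ^ 2)
        + ε⁻¹ * ∫ p in {p : UnitAddTorus (Fin d) × ℝ | s - b < p.2}, f p ^ 2 := by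
    intro ε hε s
    have hi := (hsq.indicator (hm (s - b))).comp_add_right ((0, s) : UnitAddTorus (Fin d) × ℝ)
    rw [← integral_indicator (hm _), ← integral_add_right_eq_self
      ({p : UnitAddTorus (Fin d) × ℝ | s - b < p.2}.indicator fun p => f p ^ 2)
      ((0, s) : UnitAddTorus (Fin d) × ℝ), ← integral_const_mul, ← integral_const_mul,
      ← integral_add (hsq.const_mul _) (hi.const_mul _)]
    refine norm_integral_le_of_norm_le (f := fun p => f p * f (p + (0, s)))
      ((hsq.const_mul _).add (hi.const_mul _)) (Eventually.of_forall fun p => ?_)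
    by_cases hp : p ∈ layerDomain H
    · have h1 : p + (0, s) ∈ {p : UnitAddTorus (Fin d) × ℝ | s - b < p.2} := by
        have h2 : -H p.1 < p.2 := hp
        change s - b < p.2 + s
        linarith [hb' p.1]
      rw [indicator_of_mem h1, norm_mul, Real.norm_eq_abs, Real.norm_eq_abs]
      have e : ε * f p ^ 2 + ε⁻¹ * f (p + (0, s)) ^ 2 - |f p| * |f (p + (0, s))|
          = ε⁻¹ * ((ε * |f p| - |f (p + (0, s))| / 2) ^ 2 + 3 / 4 * |f (p + (0, s))| ^ 2) := by
        rw [← sq_abs (f p), ← sq_abs (f (p + (0, s)))]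
        field_simp
        ring
      have : 0 ≤ ε⁻¹ * ((ε * |f p| - |f (p + (0, s))| / 2) ^ 2 + 3 / 4 * |f (p + (0, s))| ^ 2) := by
        positivity
      linarith
    · rw [h0 p hp, zero_mul, norm_zero]
      exact add_nonneg (by simp) (mul_nonneg (inv_nonneg.2 hε.le)
        (indicator_nonneg (fun _ _ => sq_nonneg _) _))
  rw [Metric.tendsto_atTop]
  intro δ hδ
  set A := ∫ p, f p ^ 2 with hA
  have hA0 : 0 ≤ A := integral_nonneg fun p => sq_nonneg _
  set ε := δ / (2 * (A + 1)) with hε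
  have hε0 : 0 < ε := by positivity
  have hεA : ε * A < δ / 2 := by
    have h1 : ε * (A + 1) = δ / 2 := by rw [hε]; field_simp
    nlinarith
  have h2 := htail.const_mul ε⁻¹
  rw [mul_zero] at h2
  obtain ⟨s₀, hs₀⟩ := eventually_atTop.1 (h2.eventually (gt_mem_nhds (half_pos hδ)))
  refine ⟨s₀, fun s hs => ?_⟩
  rw [Real.dist_eq, sub_zero]
  linarith [hbound ε hε0 s, hs₀ s hs]

/-- A square integrable harmonic function with zero flux vanishes. -/
theorem ae_eq_zero_of_homogeneous (hH : Continuous H) (hT : MemLp T 2 (layerMeasure H))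
    (hF : ∀ R : ℝ, (∀ l, MemLp (TX l) 2 ((layerMeasure H).restrict {p | p.2 < R})) ∧
      MemLp TY 2 ((layerMeasure H).restrict {p | p.2 < R}))
    (hg : IsWeakGradient H T TX TY)
    (hw : ∀ φ, IsTest φ →
      ∫ p, ((∑ l, TX l p * partialX l φ p) + TY p * partialY φ p) ∂layerMeasure H = 0) :
    T =ᵐ[layerMeasure H] 0 := by
  have hY := partialY_ae_eq_zero hH hT hF hg hw
  have hY' : (layerDomain H).indicator TY =ᵐ[volume] 0 := by
    rw [layerMeasure] at hY
    exact indicator_ae_eq_zero_of_restrict_ae_eq_zero (measurableSet_layerDomain hH) hY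
  have mT := memLp_indicator_layerDomain hH hT
  set T' := (layerDomain H).indicator T with hT'
  have hT0 : ∀ p, p ∉ layerDomain H → T' p = 0 := fun p hp => indicator_of_notMem hp _
  have cc := continuous_crossCorr mT mT
  -- The derivative of the kernel moves onto T as ∂_Y T = 0, so the autocorrelation does not change
  -- along upward shifts.
  have hweak : ∀ k, IsTest k → tsupport k ⊆ inwardShifts H →
      ∫ r, partialY k r * crossCorr volume T' T' r = 0 := by
    intro k hk hks
    rw [← integral_mul_integral_comp_sub mT mT hk.partialY.continuous hk.partialY.compact]
    rw [integral_eq_zero_of_ae]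
    refine Eventually.of_forall fun p => ?_
    by_cases hp : p ∈ layerDomain H
    · have h1 : ∫ q, (layerDomain H).indicator TY q * k (q - p) = 0 := by
        refine integral_eq_zero_of_ae ?_
        filter_upwards [hY'] with q hq
        rw [hq]; simp
      simp only
      rw [(hg.integral_comp_sub hH hk hks hp).2, h1]; simp
    · simp only
      rw [hT0 p hp, zero_mul]; rfl
  -- Constant upwards and tending to zero at infinity, the autocorrelation vanishes at every (0, δ),
  -- hence in the limit at 0, where it equals the squared norm of T.
  have hc0 : crossCorr volume T' T' 0 = 0 := by
    refine eq_zero_of_up_eq_zero cc fun δ hδ _ => ?_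
    have h1 : ∀ s : ℝ, 0 ≤ s →
        crossCorr volume T' T' (0, δ + s) = crossCorr volume T' T' (0, δ) := fun s hs => by
      rw [eq_add_up_of_weak_partialY_eq_zero hH cc hweak (up_mem_inwardShifts hδ) hs]
      simp
    have h2 := (tendsto_crossCorr_up hH mT hT0).comp (tendsto_atTop_add_const_left atTop δ tendsto_id)
    refine tendsto_nhds_unique (tendsto_const_nhds.congr' ?_) h2
    filter_upwards [eventually_ge_atTop 0] with s hs
    exact (h1 s hs).symm
  have h3 : ∫ p, T' p ^ 2 = 0 := by
    rw [← hc0, crossCorr]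
    congr 1; ext p
    rw [add_zero, sq]
  have h4 := (integral_eq_zero_iff_of_nonneg (fun p => sq_nonneg (T' p)) mT.integrable_sq).1 h3
  rw [layerMeasure]
  have h5 : T' =ᵐ[volume.restrict (layerDomain H)] 0 := by
    filter_upwards [ae_restrict_of_ae h4] with p hp
    exact pow_eq_zero_iff two_ne_zero |>.1 hp
  exact (indicator_ae_eq_restrict (measurableSet_layerDomain hH)).symm.trans h5

end VerticalRigidity

/-! ### Uniqueness and change of representative -/

section Uniqueness

open Set Filter
open scoped Topology

variable {d : ℕ} {H : UnitAddTorus (Fin d) → ℝ}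

/-- Gradients of weak solutions are square integrable only on bounded parts of the layer, and a test
function lives on one of these. -/
lemma IsTest.integrable_mul_of_strip (hH : Continuous H) {f φ : UnitAddTorus (Fin d) × ℝ → ℝ}
    (hφ : IsTest φ) (hf : ∀ R : ℝ, MemLp f 2 ((layerMeasure H).restrict {p | p.2 < R})) :
    Integrable (fun p => f p * φ p) (layerMeasure H) := by
  obtain ⟨R, -, hR⟩ := hφ.exists_strip
  have hm : MeasurableSet {p : UnitAddTorus (Fin d) × ℝ | p.2 < R + 1} :=
    measurableSet_lt measurable_snd measurable_const
  have h1 : MemLp ({p : UnitAddTorus (Fin d) × ℝ | p.2 < R + 1}.indicator f) 2 (layerMeasure H) :=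
    (memLp_indicator_iff_restrict hm).2 (hf (R + 1))
  refine (h1.integrable_fun_mul (hφ.memLp_layerMeasure hH 2)).congr (Eventually.of_forall fun p => ?_)
  by_cases hp : φ p = 0
  · simp only [hp, mul_zero]
  · have h2 : p ∈ {p : UnitAddTorus (Fin d) × ℝ | p.2 < R + 1} := by
      have := (abs_le.1 (hR p hp)).2
      change p.2 < R + 1
      linarith
    simp only [indicator_of_mem h2]

/-- Weak solutions of the Neumann problem are unique. -/
theorem IsWeakNeumannSolution.ae_eq (hH : Continuous H) {G : UnitAddTorus (Fin d) × ℝ → ℝ}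
    {N : UnitAddTorus (Fin d) → ℝ} {S T : UnitAddTorus (Fin d) × ℝ → ℝ}
    (hT : IsWeakNeumannSolution H G N T) (hS : IsWeakNeumannSolution H G N S) :
    T =ᵐ[layerMeasure H] S := by
  obtain ⟨mT, TX, TY, hTF, hTg, hTw⟩ := hT
  obtain ⟨mS, SX, SY, hSF, hSg, hSw⟩ := hS
  have iTX : ∀ l φ, IsTest φ → Integrable (fun p => TX l p * φ p) (layerMeasure H) :=
    fun l φ hφ => hφ.integrable_mul_of_strip hH fun R => (hTF R).1 l
  have iSX : ∀ l φ, IsTest φ → Integrable (fun p => SX l p * φ p) (layerMeasure H) :=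
    fun l φ hφ => hφ.integrable_mul_of_strip hH fun R => (hSF R).1 l
  have iTY : ∀ φ, IsTest φ → Integrable (fun p => TY p * φ p) (layerMeasure H) :=
    fun φ hφ => hφ.integrable_mul_of_strip hH fun R => (hTF R).2
  have iSY : ∀ φ, IsTest φ → Integrable (fun p => SY p * φ p) (layerMeasure H) :=
    fun φ hφ => hφ.integrable_mul_of_strip hH fun R => (hSF R).2
  have h := ae_eq_zero_of_homogeneous hH (T := T - S) (TX := fun l => TX l - SX l)
    (TY := TY - SY) (mT.sub mS)
    (fun R => ⟨fun l => ((hTF R).1 l).sub ((hSF R).1 l), (hTF R).2.sub (hSF R).2⟩)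
    ⟨fun l φ hφ hs => ?_, fun φ hφ hs => ?_⟩ fun φ hφ => ?_
  · filter_upwards [h] with p hp
    exact sub_eq_zero.1 hp
  · have m := (hφ.partialX l).memLp_layerMeasure hH 2
    simp only [Pi.sub_apply, sub_mul]
    rw [integral_sub (mT.integrable_fun_mul m) (mS.integrable_fun_mul m),
      integral_sub (iTX l φ hφ) (iSX l φ hφ), hTg.weakX l φ hφ hs, hSg.weakX l φ hφ hs]
    ring
  · have m := hφ.partialY.memLp_layerMeasure hH 2
    simp only [Pi.sub_apply, sub_mul]
    rw [integral_sub (mT.integrable_fun_mul m) (mS.integrable_fun_mul m),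
      integral_sub (iTY φ hφ) (iSY φ hφ), hTg.weakY φ hφ hs, hSg.weakY φ hφ hs]
    ring
  · have j1 : Integrable (fun p => (∑ l, TX l p * partialX l φ p) + TY p * partialY φ p)
        (layerMeasure H) := (integrable_finsetSum Finset.univ fun l _ =>
      iTX l _ (hφ.partialX l)).add (iTY _ hφ.partialY)
    have j2 : Integrable (fun p => (∑ l, SX l p * partialX l φ p) + SY p * partialY φ p)
        (layerMeasure H) := (integrable_finsetSum Finset.univ fun l _ =>
      iSX l _ (hφ.partialX l)).add (iSY _ hφ.partialY)
    have e := (integral_sub j1 j2).trans (sub_eq_zero.2 ((hTw φ hφ).trans (hSw φ hφ).symm))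
    rw [← e]
    congr 1; ext p
    simp only [Pi.sub_apply, sub_mul, Finset.sum_sub_distrib]
    ring

lemma IsWeakNeumannSolution.congr {G : UnitAddTorus (Fin d) × ℝ → ℝ}
    {N : UnitAddTorus (Fin d) → ℝ} {S T : UnitAddTorus (Fin d) × ℝ → ℝ}
    (hS : IsWeakNeumannSolution H G N S) (h : T =ᵐ[layerMeasure H] S) :
    IsWeakNeumannSolution H G N T := by
  obtain ⟨mS, SX, SY, hF, hg, hw⟩ := hS
  refine ⟨(memLp_congr_ae h).2 mS, SX, SY, hF, ⟨fun l φ hφ hs => ?_, fun φ hφ hs => ?_⟩, hw⟩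
  · rw [← hg.weakX l φ hφ hs]
    exact integral_congr_ae (by filter_upwards [h] with p hp; rw [hp])
  · rw [← hg.weakY φ hφ hs]
    exact integral_congr_ae (by filter_upwards [h] with p hp; rw [hp])

end Uniqueness

end

/-! ### Conclusion -/

theorem proposition2 (d : ℕ) (hd : d = 1 ∨ d = 2)
    (H : UnitAddTorus (Fin d) → ℝ) (hH : SmoothOnTorus H) (hHpos : ∀ X, 0 < H X)
    (Q : Polynomial ℝ) (M : NNReal) :
    ∃ Q' : Polynomial ℝ,
      ∀ (G : UnitAddTorus (Fin d) × ℝ → ℝ) (N : UnitAddTorus (Fin d) → ℝ),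
        MemLp G 2 (layerMeasure H) → MemLp N 2 volume →
        eLpNorm G 2 (layerMeasure H) ≤ M → eLpNorm N 2 volume ≤ M →
        (∫ p, G p ∂layerMeasure H) + ∫ X, N X = 0 →
        (∀ᵐ Y ∂(volume : Measure ℝ), 0 < Y →
          ‖layerCoeff G 0 Y‖ ≤ Q.eval Y * Real.exp (-Y)) →
        (∀ j : Fin d → ℤ, j ≠ 0 → ∀ᵐ Y ∂(volume : Measure ℝ), 0 < Y →
          ‖layerCoeff G j Y‖ ≤ Q.eval Y * Real.exp (-freqNorm j * Y)) →
        ∃ S : UnitAddTorus (Fin d) × ℝ → ℝ,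
          IsWeakNeumannSolution H G N S ∧
          (∀ T : UnitAddTorus (Fin d) × ℝ → ℝ, IsWeakNeumannSolution H G N T →
            T =ᵐ[layerMeasure H] S) ∧
          ContinuousOn S {p | 0 < p.2} ∧
          (∀ Y : ℝ, 0 < Y → ‖layerCoeff S 0 Y‖ ≤ Q'.eval Y * Real.exp (-Y)) ∧
          (∀ j : Fin d → ℤ, j ≠ 0 → ∀ Y : ℝ, 0 < Y →
            ‖layerCoeff S j Y‖ ≤ Q'.eval Y * Real.exp (-freqNorm j * Y)) ∧
          (∀ (X : UnitAddTorus (Fin d)) (Y : ℝ), 0 < Y →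
            |S (X, Y)| ≤ Q'.eval Y * Real.exp (-Y)) := by
  have hHc := hH.continuous
  obtain ⟨C, hC, n, hQ⟩ := exists_abs_eval_le Q
  obtain ⟨K, hK, hsol⟩ := exists_weak_solution hd hHc hHpos hC n M
  obtain ⟨D, -, hrep⟩ := exists_decaying_representative hd hHc hHpos hC hK n M
  -- The degree n + 1 reflects the one power of 1 + Y lost in solving the mode equations.
  refine ⟨Polynomial.C D * (1 + Polynomial.X) ^ (n + 1),
    fun G N hG hN hGM hNM hcomp hG0 hGj => ?_⟩
  have hdec : HasFourierDecay G C n := by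
    intro j
    rcases eq_or_ne j 0 with rfl | hj
    · filter_upwards [hG0] with Y hY hpos
      rw [freqRate_zero, one_mul]
      exact (hY hpos).trans (mul_le_mul_of_nonneg_right
        ((le_abs_self _).trans (hQ Y hpos.le)) (Real.exp_pos _).le)
    · filter_upwards [hGj j hj] with Y hY hpos
      rw [freqRate_of_ne_zero hj, ← neg_mul]
      exact (hY hpos).trans (mul_le_mul_of_nonneg_right
        ((le_abs_self _).trans (hQ Y hpos.le)) (Real.exp_pos _).le)
  obtain ⟨S, SX, SY, A, hS, hSX, hSY, hg, hw, hSK, hA, hAb, hSA⟩ :=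
    hsol G N hG hN hGM hNM hcomp hdec
  obtain ⟨T, hTS, hTc, hTj, hTb⟩ := hrep G N S SX SY A hG hGM hdec hS hSX hSY hg hw hSK hA hAb hSA
  have hSsol : IsWeakNeumannSolution H G N S :=
    ⟨hS, SX, SY, fun R => ⟨fun l => (hSX l).restrict _, hSY.restrict _⟩, hg, hw⟩
  have hTsol := hSsol.congr hTS
  have hev : ∀ Y, (Polynomial.C D * (1 + Polynomial.X) ^ (n + 1)).eval Y
      = D * (1 + Y) ^ (n + 1) := fun Y => by simp
  refine ⟨T, hTsol, fun U hU => hU.ae_eq hHc hTsol, hTc, fun Y hY => ?_, fun j hj Y hY => ?_,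
    fun X Y hY => ?_⟩
  · rw [hev]
    have h := hTj 0 Y hY
    rwa [freqRate_zero, one_mul] at h
  · rw [hev]
    have h := hTj j Y hY
    rwa [freqRate_of_ne_zero hj, ← neg_mul] at h
  · rw [hev]
    exact hTb X Y hY
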